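/- Let $f_1,f_2,f_3$ be smooth functions of $(a,b,z,\varepsilon)\in\mathbb R^4$ and consider the $A_3$ slow-fast system $$X_\varepsilon=\varepsilon(1+f_1)\,\partial_a+\varepsilon f_2\,\partial_b-\left(z^3+bz+a+\varepsilon f_3\right)\partial_z ,$$ its slow manifold $S=\{z^3+bz+a=0\}$, and the sections $\Sigma^-=\{a=-a^-,\ z>0\}$, $\Sigma^+=\{a=a^+,\ z<0\}$ with constants $a^\pm>0$. Let $\Pi:\Sigma^-\to\Sigma^+$ be the transition (Poincaré) map of $X_\varepsilon$, $\varepsilon>0$. Let $\ell\ge 1$, and let $(B,Z,\varepsilon)$ and $(\tilde B,\tilde Z,\varepsilon)$ be $C^\ell$ coordinates on parts of $\Sigma^-$ and $\Sigma^+$ (regular up to $\varepsilon=0$, the first ones defined near the origin, and such that the curve $Z=0$, $\varepsilon=0$ of $\Sigma^-$ lies in $S$) in which $\Pi$ has the exponential form $$\Pi(B,Z,\varepsilon)=\left(B+h(B,\varepsilon),\ \phi(B,\varepsilon)+Z\exp\left(-\frac{A(B,\varepsilon)+\Psi(B,Z,\varepsilon)}{\varepsilon}\right),\ \varepsilon\right),$$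 where $h$ is $C^\ell$ and flat at the origin (all its derivatives of order $\le\ell$ vanish there), $A>0$, $\phi$ and $\Psi$ are continuous for $\varepsilon\ge 0$, $\phi(B,0)=0$ and $\Psi(B,Z,0)=0$; it is understood that the points $(B+h(B,0),0,0)$ belong to the domain of the coordinates on $\Sigma^+$. Then $1+\partial_Bh(B,0)\neq0$ for all $B$ close to $0$, and for every $B$ in the domain with $1+\partial_B h(B,0)\ne 0$ the following holds. Let $p_B=(-a^-,b,\zeta^-)\in\Sigma^-\cap S$ be the point with coordinates $(B,0,0)$. (1) If $\gamma_0$ is a slow orbit from $p_B$ to $\Sigma^+$, then $$-A(B,0)=I(B):=\int_{\gamma_0}\operatorname{Div}X_0\,dt ,$$ the slow divergence integral, where $t$ is the slow time. Here a slow orbit is a curve $(a,b,z)$ on $[0,T]$ that, except at finitely many contact times in $(0,T)$, is continuous, runs in the attracting part $\{3z^2+b>0\}$ of $S$ and satisfies $\dot a=1+f_1|_{\varepsilon=0}$, $\dot b=f_2|_{\varepsilon=0}$, with $a,b$ continuous on all of $[0,T]$; at a contact time it arrives at a point $(a,b,\zeta)\in S$ with $3\zeta^2+b=0$ and $1+f_1+\zeta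 f_2\neq0$ (at $\varepsilon=0$) and continues from $(a,b,-2\zeta)\in S$ (a jump at a fold if $\zeta\ne0$, the passage through the cusp if $\zeta=0$); moreover $a<a^+$ before the end point, which lies in $\Sigma^+$, and $1+f_1>0$ (at $\varepsilon=0$) at both end points. (2) Suppose that $f_1=f_2=0$ at $\varepsilon=0$ (as for the normal form of an $A_3$ slow-fast system). Put $\tilde I(b,\zeta)=\tfrac95\zeta^5+2\zeta^3b+b^2\zeta$ and let $\zeta^+<0$ be defined by $(a^+,b,\zeta^+)\in S$. If $b\ge0$, then a slow orbit from $p_B$ to $\Sigma^+$ exists and $$-A(B,0)=I(B)=\tilde I(b,\zeta^+)-\tilde I(b,\zeta^-).$$ If $b<0$ and, with $s=\sqrt{-b/3}$, $2s^3<a^+$ (the fold is reached before $\Sigma^+$), then a slow orbit from $p_B$ to $\Sigma^+$ exists, it jumps at the fold point $z=s$ to $z=-2s$, and $$-A(B,0)=I(B)=\left(\tilde I(b,s)-\tilde I(b,\zeta^-)\right)+\left(\tilde I(b,\zeta^+)-\tilde I(b,-2s)\right).$$ -/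

import Mathlib

open Set Filter Topology
open scoped ContDiff

noncomputable section

namespace CuspSFS

/-- The vector field `X_ε` on `ℝ³ ∋ (a, b, z)` of the `A₃` slow-fast system
`ε (1 + f₁) ∂_a + ε f₂ ∂_b - (z³ + b z + a + ε f₃) ∂_z`, where `f_i = f_i (a, b, z, ε)`. -/
def field (f₁ f₂ f₃ : ℝ × ℝ × ℝ × ℝ → ℝ) (ε : ℝ) (p : ℝ × ℝ × ℝ) : ℝ × ℝ × ℝ :=
  (ε * (1 + f₁ (p.1, p.2.1, p.2.2, ε)),
    ε * f₂ (p.1, p.2.1, p.2.2, ε),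
    -(p.2.2 ^ 3 + p.2.1 * p.2.2 + p.1 + ε * f₃ (p.1, p.2.1, p.2.2, ε)))

/-- The divergence of a vector field on `ℝ³`. -/
def divergence (X : ℝ × ℝ × ℝ → ℝ × ℝ × ℝ) (p : ℝ × ℝ × ℝ) : ℝ :=
  deriv (fun x => (X (x, p.2.1, p.2.2)).1) p.1
    + deriv (fun x => (X (p.1, x, p.2.2)).2.1) p.2.1
    + deriv (fun x => (X (p.1, p.2.1, x)).2.2) p.2.2

/-- The slow manifold `S = {z³ + b z + a = 0}`. -/
def slowManifold : Set (ℝ × ℝ × ℝ) := {p | p.2.2 ^ 3 + p.2.1 * p.2.2 + p.1 = 0}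

/-- The section `Σ⁻ = {a = -a⁻, z > 0}` (at a fixed value of `ε`). -/
def sectionMinus (am : ℝ) : Set (ℝ × ℝ × ℝ) := {p | p.1 = -am ∧ 0 < p.2.2}

/-- The section `Σ⁺ = {a = a⁺, z < 0}` (at a fixed value of `ε`). -/
def sectionPlus (ap : ℝ) : Set (ℝ × ℝ × ℝ) := {p | p.1 = ap ∧ p.2.2 < 0}

/-- `q` is the image of `p` under the Poincaré map `Σ⁻ → Σ⁺` of `X_ε`: the trajectory of `p ∈ Σ⁻`
(in the fast time) meets `Σ⁺` for the first time at `q`. -/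
def IsTransition (f₁ f₂ f₃ : ℝ × ℝ × ℝ × ℝ → ℝ) (am ap ε : ℝ) (p q : ℝ × ℝ × ℝ) : Prop :=
  p ∈ sectionMinus am ∧ q ∈ sectionPlus ap ∧
    ∃ τ : ℝ, 0 < τ ∧ ∃ γ : ℝ → ℝ × ℝ × ℝ, γ 0 = p ∧ γ τ = q ∧
      (∀ s ∈ Icc 0 τ, HasDerivWithinAt γ (field f₁ f₂ f₃ ε (γ s)) (Icc 0 τ) s) ∧
      ∀ s ∈ Ico 0 τ, γ s ∉ sectionPlus ap

/-- A slow orbit `γ₀` from `Σ⁻` to `Σ⁺`, parametrized by the slow time `t ∈ [0, T]`.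

Outside a finite set of contact times it runs in the attracting part `3z² + b > 0` of `S` and solves
the slow equations `da/dt = 1 + f₁`, `db/dt = f₂` (at `ε = 0`). At a contact time it arrives at a
point `(a, b, ζ)` of `S` with `3ζ² + b = 0`, where the slow flow is transversal to the line of
contact points (`1 + f₁ + ζ f₂ ≠ 0`). It leaves this point along the fast fibre for the second point
`(a, b, -2ζ)` of `S` on that fibre; if `ζ = 0` this is a passage through the cusp point without a
jump. -/
structure SlowOrbit (f₁ f₂ : ℝ × ℝ × ℝ × ℝ → ℝ) (am ap : ℝ) where
  /-- the duration, in the slow time -/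
  T : ℝ
  a : ℝ → ℝ
  b : ℝ → ℝ
  z : ℝ → ℝ
  /-- the contact times -/
  contact : Finset ℝ
  T_pos : 0 < T
  contact_mem : ∀ t ∈ contact, t ∈ Ioo 0 T
  a_cont : ContinuousOn a (Icc 0 T)
  b_cont : ContinuousOn b (Icc 0 T)
  z_cont : ∀ t ∈ Icc 0 T, t ∉ contact → ContinuousWithinAt z (Icc 0 T) t
  mem_slowManifold : ∀ t ∈ Icc 0 T, t ∉ contact → (a t, b t, z t) ∈ slowManifold
  attracting : ∀ t ∈ Icc 0 T, t ∉ contact → 0 < 3 * z t ^ 2 + b t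
  a_deriv : ∀ t ∈ Icc 0 T, t ∉ contact →
    HasDerivWithinAt a (1 + f₁ (a t, b t, z t, 0)) (Icc 0 T) t
  b_deriv : ∀ t ∈ Icc 0 T, t ∉ contact →
    HasDerivWithinAt b (f₂ (a t, b t, z t, 0)) (Icc 0 T) t
  jump : ∀ t ∈ contact, ∃ ζ : ℝ, Tendsto z (𝓝[<] t) (𝓝 ζ) ∧ Tendsto z (𝓝[>] t) (𝓝 (-2 * ζ)) ∧
    3 * ζ ^ 2 + b t = 0 ∧ 1 + f₁ (a t, b t, ζ, 0) + ζ * f₂ (a t, b t, ζ, 0) ≠ 0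
  start_mem : (a 0, b 0, z 0) ∈ sectionMinus am
  end_mem : (a T, b T, z T) ∈ sectionPlus ap
  a_lt : ∀ t ∈ Ico 0 T, a t < ap
  start_transversal : 0 < 1 + f₁ (a 0, b 0, z 0, 0)
  end_transversal : 0 < 1 + f₁ (a T, b T, z T, 0)

/-- The slow divergence integral `∫_{γ₀} Div X₀ dt`, where `t` is the slow time. -/
def SlowOrbit.integral {f₁ f₂ : ℝ × ℝ × ℝ × ℝ → ℝ} {am ap : ℝ} (f₃ : ℝ × ℝ × ℝ × ℝ → ℝ)
    (γ : SlowOrbit f₁ f₂ am ap) : ℝ :=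
  ∫ t in (0 : ℝ)..γ.T, divergence (field f₁ f₂ f₃ 0) (γ.a t, γ.b t, γ.z t)

/-- `Θ : (B, Z, ε) ↦ (b, z, ε)` is (the inverse of) a system of `C^ℓ` coordinates on a part of a
section that is itself parametrized by `(b, z, ε)`. -/
structure IsSectionChart (ℓ : ℕ) (Θ : OpenPartialHomeomorph (ℝ × ℝ × ℝ) (ℝ × ℝ × ℝ)) : Prop where
  smooth : ContDiffOn ℝ ℓ Θ Θ.source
  smooth_symm : ContDiffOn ℝ ℓ Θ.symm Θ.target
  preserves : ∀ p ∈ Θ.source, (Θ p).2.2 = p.2.2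

/-- The point `(a, b, z)` of the section `{a = c}` that has the coordinates `(B, Z, ε)`. -/
def chartPoint (Θ : OpenPartialHomeomorph (ℝ × ℝ × ℝ) (ℝ × ℝ × ℝ)) (c B Z ε : ℝ) : ℝ × ℝ × ℝ :=
  (c, (Θ (B, Z, ε)).1, (Θ (B, Z, ε)).2.1)

/-- The pairs `(B, ε)` that occur in the domain of a chart. -/
def baseDomain (Θ : OpenPartialHomeomorph (ℝ × ℝ × ℝ) (ℝ × ℝ × ℝ)) : Set (ℝ × ℝ) :=
  {x | ∃ Z : ℝ, (x.1, Z, x.2) ∈ Θ.source}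

/-- In the coordinates `Θm` on `Σ⁻` and `Θp` on `Σ⁺` the transition map has the exponential form
`Π (B, Z, ε) = (B + h (B, ε), φ (B, ε) + Z exp (-(A (B, ε) + Ψ (B, Z, ε)) / ε), ε)`. -/
structure IsExponentialTransition (ℓ : ℕ) (f₁ f₂ f₃ : ℝ × ℝ × ℝ × ℝ → ℝ) (am ap : ℝ)
    (Θm Θp : OpenPartialHomeomorph (ℝ × ℝ × ℝ) (ℝ × ℝ × ℝ))
    (h φ A : ℝ → ℝ → ℝ) (Ψ : ℝ → ℝ → ℝ → ℝ) : Prop where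
  chart_minus : IsSectionChart ℓ Θm
  chart_plus : IsSectionChart ℓ Θp
  origin_mem : (0, 0, 0) ∈ Θm.source
  /-- at `ε = 0` the curve `Z = 0` of `Σ⁻` lies in the slow manifold -/
  slow : ∀ B, (B, 0, 0) ∈ Θm.source → chartPoint Θm (-am) B 0 0 ∈ slowManifold
  h_smooth : ContDiffOn ℝ ℓ (fun x : ℝ × ℝ => h x.1 x.2) (baseDomain Θm)
  h_flat : ∀ k ≤ ℓ, iteratedFDeriv ℝ k (fun x : ℝ × ℝ => h x.1 x.2) (0, 0) = 0
  φ_cont : ContinuousOn (fun x : ℝ × ℝ => φ x.1 x.2) (baseDomain Θm ∩ {x | 0 ≤ x.2})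
  φ_zero : ∀ B, (B, 0) ∈ baseDomain Θm → φ B 0 = 0
  A_cont : ContinuousOn (fun x : ℝ × ℝ => A x.1 x.2) (baseDomain Θm ∩ {x | 0 ≤ x.2})
  A_pos : ∀ B ε, (B, ε) ∈ baseDomain Θm → 0 ≤ ε → 0 < A B ε
  Ψ_cont : ContinuousOn (fun x : ℝ × ℝ × ℝ => Ψ x.1 x.2.1 x.2.2) (Θm.source ∩ {x | 0 ≤ x.2.2})
  Ψ_zero : ∀ B Z, (B, Z, 0) ∈ Θm.source → Ψ B Z 0 = 0
  limit_mem : ∀ B, (B, 0) ∈ baseDomain Θm → (B + h B 0, 0, 0) ∈ Θp.source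
  target_mem : ∀ B Z ε, (B, Z, ε) ∈ Θm.source → 0 < ε →
    (B + h B ε, φ B ε + Z * Real.exp (-(A B ε + Ψ B Z ε) / ε), ε) ∈ Θp.source
  transition : ∀ B Z ε, (B, Z, ε) ∈ Θm.source → 0 < ε →
    IsTransition f₁ f₂ f₃ am ap ε (chartPoint Θm (-am) B Z ε)
      (chartPoint Θp ap (B + h B ε) (φ B ε + Z * Real.exp (-(A B ε + Ψ B Z ε) / ε)) ε)

/-- `Ĩ (b, ζ) = (9/5) ζ⁵ + 2 ζ³ b + b² ζ`. -/
def primitive (b ζ : ℝ) : ℝ := 9 / 5 * ζ ^ 5 + 2 * ζ ^ 3 * b + b ^ 2 * ζ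

end CuspSFS

end

/-!
The transition map is compared with the slow divergence integral through its Jacobian.

*Jacobian at fixed `ε`.* For `ε > 0` the transition map is a crossing map between two transversal
sections, hence differentiable, and by Liouville's formula its Jacobian is, up to the ratio of the
speeds `1 + f₁` at the two sections, the exponential of `ε⁻¹` times the integral of the divergence
along the transition in the slow time (`IsCrossing.jacobian`). In the coordinates of the exponential
form the Jacobian of the map is triangular, with diagonal entries `1 + ∂h/∂B` and `∂F/∂Z`, where `F`
denotes the `Z`-component (`IsExponentialTransition.jacobian`). The functions `φ`, `A`, `Ψ` are only
continuous, so `∂F/∂Z` cannot be read off from the formula for `F`. However, `F` is differentiable in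
`Z`, and the mean value theorem on `0 ≤ Z ≤ ε` provides a point where `∂F/∂Z` equals
`exp (-(A (B, ε) + Ψ (B, ε, ε)) / ε)` (`IsExponentialTransition.eventually_balance`). Taking
`ε log` of Liouville's formula there and letting `ε → 0` makes all factors disappear that stay away
from `0` and `∞`; what remains is `-A (B, 0)` on one side and the limit of the divergence integrals
on the other (`IsExponentialTransition.neg_A_eq_integral`).

*Limit of the divergence integrals.* In the slow time, transitions that start near a slow orbit
converge to it at all times except the contact times and stay in a fixed box, so their divergence
integrals converge by dominated convergence (`SlowOrbit.tendsto_transit`). The convergence is proved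
piece by piece and glued by a supremum argument (`SlowOrbit.good`):

* along an attracting part of `S`, the defect `z³ + b z + a` stays small, so the fast variable is
  controlled by the slow ones and Grönwall's inequality applies (`IsBounded.exists_track`);
* near a fold point with `ζ > 0`, the quantity `a + ζ b` grows at a definite speed, because the slow
  flow is transversal and the orbit arrives from the attracting sheet; this pushes the trajectory off
  the fold, and it comes down along the fast fibre to `-2 ζ` (`IsContact.passes_of_fold`);
* past the cusp, `a` grows linearly in the time `τ` since the passage, and `-c τ ^ (1 / 3)` is a
  barrier for `z`. Hence the attraction rate is at least of order `τ ^ (2 / 3)`, the Grönwall rate of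
  the slow variables is at most of order `τ ^ (-2 / 3)`, and the latter is integrable
  (`IsContact.passes_of_cusp`);
* the symmetry `(a, b, z) ↦ (-a, b, -z)` reduces the remaining contact points to these two cases;
* near its end point the slow orbit crosses `Σ⁺` at positive speed, which fixes the duration of the
  transition up to a small error (`SlowOrbit.exists_capture`).

*Normal form.* If `f₁ = f₂ = 0` at `ε = 0`, then `b` is constant along the slow flow and `a` is the
slow time. With `s = √(-b/3)` for `b ≤ 0` and `s = 0` for `b ≥ 0`, the slow orbit is the branch
`z ≥ s` of `S` up to `a = 2 s³` and the branch `z ≤ -2 s` afterwards. On `S` one has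
`da = -(3 z² + b) dz`, so the slow divergence `-(3 z² + b)` integrates to `∫ (3 z² + b)² dz`, which
has the primitive `Ĩ` (`IsSlowCurve.integral_slowOrbit`). For `s = 0` the two contributions of the
cusp vanish.
-/

noncomputable section

namespace CuspSFS

/-! ### Differential inequalities and linear equations -/

section

theorem hasDerivWithinAt_Ici_of_Icc {E : Type*} [NormedAddCommGroup E] [NormedSpace ℝ E]
    {f : ℝ → E} {f' : E} {s u t : ℝ} (hf : HasDerivWithinAt f f' (Icc s u) t) (ht : t ∈ Ico s u) :
    HasDerivWithinAt f f' (Ici t) t :=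
  hf.mono_of_mem_nhdsWithin (Icc_mem_nhdsGE_of_mem ht)

/-- A function that decreases strictly wherever it equals `M` cannot cross the level `M` upwards. -/
theorem le_of_barrier {f f' : ℝ → ℝ} {s u M : ℝ} (hf : ContinuousOn f (Icc s u))
    (hf' : ∀ t ∈ Ico s u, HasDerivWithinAt f (f' t) (Ici t) t) (hs : f s ≤ M)
    (hM : ∀ t ∈ Ico s u, f t = M → f' t < 0) : ∀ t ∈ Icc s u, f t ≤ M :=
  fun _ ht => image_le_of_deriv_right_lt_deriv_boundary (B := fun _ => M) (B' := fun _ => 0)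
    hf hf' hs (fun x => hasDerivAt_const x M) hM ht

theorem ge_of_barrier {f f' : ℝ → ℝ} {s u M : ℝ} (hf : ContinuousOn f (Icc s u))
    (hf' : ∀ t ∈ Ico s u, HasDerivWithinAt f (f' t) (Ici t) t) (hs : M ≤ f s)
    (hM : ∀ t ∈ Ico s u, f t = M → 0 < f' t) : ∀ t ∈ Icc s u, M ≤ f t := by
  intro t ht
  have := le_of_barrier (f := fun t => -f t) (f' := fun t => -f' t) (M := -M) hf.neg
    (fun t ht => (hf' t ht).neg) (by linarith)
    (fun t ht h => by have := hM t ht (by linarith); linarith) t ht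
  linarith

theorem sub_le_of_deriv_le {f f' : ℝ → ℝ} {s u c : ℝ} (hf : ContinuousOn f (Icc s u))
    (hf' : ∀ t ∈ Ico s u, HasDerivWithinAt f (f' t) (Ici t) t)
    (hc : ∀ t ∈ Ico s u, f' t ≤ c) : ∀ t ∈ Icc s u, f t ≤ f s + c * (t - s) := by
  intro t ht
  refine image_le_of_deriv_right_le_deriv_boundary (B := fun t => f s + c * (t - s))
    (B' := fun _ => c) hf hf' (by simp) (by fun_prop) (fun x _ => ?_) hc ht
  have : HasDerivAt (fun t => f s + c * (t - s)) c x := by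
    simpa using (((hasDerivAt_id x).sub_const s).const_mul c).const_add (f s)
  exact this.hasDerivWithinAt

theorem le_sub_of_le_deriv {f f' : ℝ → ℝ} {s u c : ℝ} (hf : ContinuousOn f (Icc s u))
    (hf' : ∀ t ∈ Ico s u, HasDerivWithinAt f (f' t) (Ici t) t)
    (hc : ∀ t ∈ Ico s u, c ≤ f' t) : ∀ t ∈ Icc s u, f s + c * (t - s) ≤ f t := by
  intro t ht
  have := sub_le_of_deriv_le (f := fun t => -f t) (f' := fun t => -f' t) (c := -c) hf.neg
    (fun t ht => (hf' t ht).neg) (fun t ht => by have := hc t ht; linarith) t ht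
  linarith

theorem abs_sub_le_of_abs_deriv_le {f f' : ℝ → ℝ} {s u c : ℝ} (hf : ContinuousOn f (Icc s u))
    (hf' : ∀ t ∈ Ico s u, HasDerivWithinAt f (f' t) (Ici t) t)
    (hc : ∀ t ∈ Ico s u, |f' t| ≤ c) : ∀ t ∈ Icc s u, |f t - f s| ≤ c * (t - s) := by
  intro t ht
  have h1 := sub_le_of_deriv_le hf hf' (fun t ht => (abs_le.1 (hc t ht)).2) t ht
  have h2 := le_sub_of_le_deriv hf hf' (fun t ht => (abs_le.1 (hc t ht)).1) t ht
  rw [abs_le]; constructor <;> linarith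

/-- A function that decreases at speed at least `c` as long as it is `≥ m` is `≤ m` once the time
needed to come down from its initial value has passed. -/
theorem le_of_exit {f f' : ℝ → ℝ} {s u c m : ℝ} (hsu : s ≤ u) (hc : 0 < c)
    (hf : ContinuousOn f (Icc s u))
    (hf' : ∀ t ∈ Ico s u, HasDerivWithinAt f (f' t) (Ici t) t)
    (hm : ∀ t ∈ Ico s u, m ≤ f t → f' t ≤ -c) (h : f s - c * (u - s) ≤ m) : f u ≤ m := by
  by_contra! hu
  have key : ∀ t ∈ Icc s u, m < f t := by
    intro t ht
    by_contra! h'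
    have := le_of_barrier (M := m) (hf.mono (Icc_subset_Icc_left ht.1))
      (fun x hx => hf' x ⟨ht.1.trans hx.1, hx.2⟩) h'
      (fun x hx h => by have := hm x ⟨ht.1.trans hx.1, hx.2⟩ h.ge; linarith) u ⟨ht.2, le_rfl⟩
    linarith
  have := sub_le_of_deriv_le hf hf' (fun t ht => hm t ht (key t ⟨ht.1, ht.2.le⟩).le) u
    ⟨hsu, le_rfl⟩
  linarith

/-- Continuous induction: a bound that improves itself holds throughout. -/
theorem lt_of_bootstrap {φ : ℝ → ℝ} {s u r : ℝ} (hφ : ContinuousOn φ (Icc s u)) (hs : φ s < r)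
    (h : ∀ t ∈ Icc s u, (∀ x ∈ Icc s t, φ x ≤ r) → φ t < r) : ∀ t ∈ Icc s u, φ t < r := by
  by_contra! hcon
  obtain ⟨t, ht, hrt⟩ := hcon
  -- the first time at which the value `r` is reached
  have hcl : IsCompact (Icc s t ∩ φ ⁻¹' Ici r) :=
    isCompact_Icc.of_isClosed_subset
      ((hφ.mono (Icc_subset_Icc_right ht.2)).preimage_isClosed_of_isClosed isClosed_Icc isClosed_Ici)
      inter_subset_left
  obtain ⟨m, hm, hmin⟩ := hcl.exists_isLeast ⟨t, ⟨ht.1, le_rfl⟩, hrt⟩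
  have hmu : m ∈ Icc s u := ⟨hm.1.1, hm.1.2.trans ht.2⟩
  refine absurd (h m hmu fun x hx => ?_) (not_lt.2 hm.2)
  rcases hx.2.eq_or_lt with rfl | hlt
  · -- the value at the first time is exactly `r`, by the intermediate value theorem
    by_contra! hgt
    obtain ⟨y, hy, hyr⟩ := intermediate_value_Icc hm.1.1 (hφ.mono (Icc_subset_Icc_right hmu.2))
      (show r ∈ Icc (φ s) (φ x) from ⟨hs.le, hgt.le⟩)
    have : x ≤ y := hmin ⟨⟨hy.1, hy.2.trans hm.1.2⟩, hyr.ge⟩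
    have : y = x := le_antisymm hy.2 this
    subst this; linarith
  · by_contra! hgt
    have := hmin ⟨⟨hx.1, hx.2.trans hm.1.2⟩, hgt.le⟩
    linarith

/-- Grönwall's inequality with a time-dependent rate `k = K'`. -/
theorem norm_add_le_of_deriv_le_kernel {E : Type*} [NormedAddCommGroup E] [NormedSpace ℝ E]
    {f f' : ℝ → E} {k K : ℝ → ℝ} {s u π : ℝ} (hf : ContinuousOn f (Icc s u))
    (hf' : ∀ t ∈ Ico s u, HasDerivWithinAt f (f' t) (Ici t) t)
    (hK : ContinuousOn K (Icc s u)) (hK' : ∀ t ∈ Ico s u, HasDerivWithinAt K (k t) (Ici t) t)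
    (hπ : 0 < π)
    (hle : ∀ t ∈ Ico s u, ‖f' t‖ ≤ k t * (‖f t‖ + π)) :
    ∀ t ∈ Icc s u, ‖f t‖ ≤ (‖f s‖ + π) * Real.exp (K t - K s) := by
  -- compare with the boundaries `(‖f s‖ + π) exp (K t - K s + δ (t - s)) - π`, then let `δ → 0`
  intro t ht
  have key : ∀ δ > 0, ‖f t‖ ≤ (‖f s‖ + π) * Real.exp (K t - K s + δ * (t - s)) - π := by
    intro δ hδ
    refine image_norm_le_of_norm_deriv_right_lt_deriv_boundary'
      (B := fun t => (‖f s‖ + π) * Real.exp (K t - K s + δ * (t - s)) - π)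
      (B' := fun t => (‖f s‖ + π) * (Real.exp (K t - K s + δ * (t - s)) * (k t + δ)))
      hf hf' (by simp) (by fun_prop) (fun x hx => ?_) (fun x hx h => ?_) ht
    · have h1 : HasDerivWithinAt (fun t => K t - K s + δ * (t - s)) (k x + δ) (Ici x) x := by
        have h2 : HasDerivAt (fun t => δ * (t - s)) δ x := by
          simpa using ((hasDerivAt_id x).sub_const s).const_mul δ
        exact ((hK' x hx).sub_const _).add h2.hasDerivWithinAt
      exact (h1.exp.const_mul _).sub_const _
    · have h1 := hle x hx
      rw [h] at h1
      have h3 : 0 < (‖f s‖ + π) * Real.exp (K x - K s + δ * (x - s)) := by positivity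
      nlinarith
  have hlim : Tendsto (fun δ : ℝ => (‖f s‖ + π) * Real.exp (K t - K s + δ * (t - s)) - π)
      (𝓝[>] 0) (𝓝 ((‖f s‖ + π) * Real.exp (K t - K s + 0 * (t - s)) - π)) :=
    Tendsto.mono_left (Continuous.tendsto (by fun_prop) 0) nhdsWithin_le_nhds
  have := ge_of_tendsto hlim (eventually_nhdsWithin_of_forall fun δ hδ => key δ hδ)
  simp only [zero_mul, add_zero] at this
  linarith

theorem norm_le_of_deriv_le {E : Type*} [NormedAddCommGroup E] [NormedSpace ℝ E]
    {f f' : ℝ → E} {k s u π : ℝ} (hf : ContinuousOn f (Icc s u))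
    (hf' : ∀ t ∈ Ico s u, HasDerivWithinAt f (f' t) (Ici t) t)
    (hπ : 0 < π)
    (hle : ∀ t ∈ Ico s u, ‖f' t‖ ≤ k * (‖f t‖ + π)) :
    ∀ t ∈ Icc s u, ‖f t‖ ≤ (‖f s‖ + π) * Real.exp (k * (t - s)) := by
  intro t ht
  have := norm_add_le_of_deriv_le_kernel (k := fun _ => k) (K := fun t => k * t) hf hf'
    (by fun_prop) (fun x _ => by
      simpa using ((hasDerivAt_id x).const_mul k).hasDerivWithinAt) hπ hle t ht
  rwa [← mul_sub] at this

/-- A linear equation `v' = M(t) v` with continuous coefficients has a solution on the whole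
interval. The field is cut off outside a large ball, where the a priori bound of Grönwall's
inequality keeps the solution away from; the cut-off field is bounded, so that the Picard-Lindelöf
theorem applies to an interval of any length. -/
theorem exists_linear_solution {τ : ℝ} (hτ : 0 ≤ τ) {M : ℝ → (ℝ × ℝ × ℝ) →L[ℝ] (ℝ × ℝ × ℝ)}
    (hM : ContinuousOn M (Icc 0 τ)) (v₀ : ℝ × ℝ × ℝ) :
    ∃ v : ℝ → ℝ × ℝ × ℝ, v 0 = v₀ ∧
      ∀ t ∈ Icc 0 τ, HasDerivWithinAt v (M t (v t)) (Icc 0 τ) t := by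
  obtain ⟨C, hC⟩ := isCompact_Icc.exists_bound_of_continuousOn hM
  have hC0 : 0 ≤ C := (norm_nonneg _).trans (hC 0 ⟨le_rfl, hτ⟩)
  set R : ℝ := (‖v₀‖ + 1) * Real.exp (C * τ) with hR
  have hR0 : 0 < R := by positivity
  let cl : ℝ → ℝ := fun x => max (-R) (min R x)
  have hcl_lip : LipschitzWith 1 cl :=
    (LipschitzWith.id.const_min R).const_max (-R)
  let pr : ℝ × ℝ × ℝ → ℝ × ℝ × ℝ := fun p => (cl p.1, cl p.2.1, cl p.2.2)
  have hcl_abs : ∀ x, |cl x| ≤ |x| := by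
    intro x
    simp only [cl]
    rcases max_cases (-R) (min R x) with h | h <;> rcases min_cases R x with h' | h' <;>
      cases abs_cases x <;> rw [abs_le] <;> constructor <;> linarith
  have hcl_R : ∀ x, |cl x| ≤ R := fun x => by
    rw [abs_le]; exact ⟨le_max_left _ _, max_le (by linarith) (min_le_left _ _)⟩
  have hpr_lip : LipschitzWith 1 pr := by
    have h1 : LipschitzWith 1 (fun p : ℝ × ℝ × ℝ => cl p.1) := by
      simpa [Function.comp_def] using hcl_lip.comp LipschitzWith.prod_fst
    have h2 : LipschitzWith 1 (fun p : ℝ × ℝ × ℝ => cl p.2.1) := by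
      simpa [Function.comp_def] using hcl_lip.comp (LipschitzWith.prod_fst.comp LipschitzWith.prod_snd)
    have h3 : LipschitzWith 1 (fun p : ℝ × ℝ × ℝ => cl p.2.2) := by
      simpa [Function.comp_def] using hcl_lip.comp (LipschitzWith.prod_snd.comp LipschitzWith.prod_snd)
    simpa using h1.prodMk (h2.prodMk h3)
  have hpr_norm : ∀ p, ‖pr p‖ ≤ ‖p‖ := fun p => by
    simp only [pr, Prod.norm_def, Real.norm_eq_abs]
    exact max_le_max (hcl_abs _) (max_le_max (hcl_abs _) (hcl_abs _))
  have hpr_R : ∀ p, ‖pr p‖ ≤ R := fun p => by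
    simp only [pr, Prod.norm_def, Real.norm_eq_abs]
    exact max_le (hcl_R _) (max_le (hcl_R _) (hcl_R _))
  have hpr_id : ∀ p, ‖p‖ ≤ R → pr p = p := fun p hp => by
    simp only [Prod.norm_def, Real.norm_eq_abs, max_le_iff, abs_le] at hp
    obtain ⟨⟨h1, h2⟩, ⟨h3, h4⟩, h5, h6⟩ := hp
    simp [pr, cl, h1, h2, h3, h4, h5, h6]
  have hPL : IsPicardLindelof (fun t x => M t (pr x)) (tmin := 0) (tmax := τ) ⟨0, le_rfl, hτ⟩ v₀
      (Real.toNNReal (C * R * τ)) 0 (Real.toNNReal (C * R)) (Real.toNNReal C) := by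
    refine ⟨fun t ht => ?_, fun x _ => ?_, fun t ht x _ => ?_, ?_⟩
    · refine LipschitzOnWith.of_dist_le_mul fun x _ y _ => ?_
      rw [Real.coe_toNNReal _ hC0, dist_eq_norm, dist_eq_norm, ← map_sub]
      have h1 := hpr_lip.dist_le_mul x y
      rw [dist_eq_norm, dist_eq_norm] at h1
      simp only [NNReal.coe_one, one_mul] at h1
      exact ((M t).le_opNorm _).trans (mul_le_mul (hC t ht) h1 (norm_nonneg _) hC0)
    · exact hM.clm_apply continuousOn_const
    · rw [Real.coe_toNNReal _ (by positivity)]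
      exact ((M t).le_opNorm _).trans (mul_le_mul (hC t ht) (hpr_R x) (norm_nonneg _) hC0)
    · rw [Real.coe_toNNReal _ (by positivity), Real.coe_toNNReal _ (by positivity)]
      simp [hτ]
  obtain ⟨v, hv0, hv⟩ := hPL.exists_eq_forall_mem_Icc_hasDerivWithinAt₀
  refine ⟨v, hv0, fun t ht => ?_⟩
  have hvc : ContinuousOn v (Icc 0 τ) := fun t ht => (hv t ht).continuousWithinAt
  have hbd := norm_le_of_deriv_le hvc
    (fun t ht => hasDerivWithinAt_Ici_of_Icc (hv t ⟨ht.1, ht.2.le⟩) ht) one_pos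
    (fun t ht => by
      refine ((M t).le_opNorm _).trans (mul_le_mul (hC t ⟨ht.1, ht.2.le⟩) ?_ (norm_nonneg _) hC0)
      linarith [hpr_norm (v t)]) t ht
  have hR' : ‖v t‖ ≤ R := by
    refine hbd.trans ?_
    have : v 0 = v₀ := hv0
    rw [hR, this]
    gcongr
    linarith [ht.2]
  have := hv t ht
  rwa [hpr_id _ hR'] at this

end

/-! ### Trajectories near attracting parts of the slow manifold -/

section

/-- The cubic `z³ + b z + a`, whose zero set is the slow manifold. -/
def cubic (z a b : ℝ) : ℝ := z ^ 3 + b * z + a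

/-- The box `|a|, |b|, |z| ≤ R`. -/
def InBox (R a b z : ℝ) : Prop := |a| ≤ R ∧ |b| ≤ R ∧ |z| ≤ R

/-- The bounds and Lipschitz estimates for the right-hand sides that tracking a slow orbit uses:
`g₁` and `g₂` are compared with their values at `ε = 0`. -/
structure IsBounded (g₁ g₂ g₃ : ℝ × ℝ × ℝ × ℝ → ℝ) (R L : ℝ) : Prop where
  one_le_R : 1 ≤ R
  one_le_L : 1 ≤ L
  bound₁ : ∀ a b z e, InBox R a b z → 0 ≤ e → e ≤ 1 → |g₁ (a, b, z, e)| ≤ L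
  bound₂ : ∀ a b z e, InBox R a b z → 0 ≤ e → e ≤ 1 → |g₂ (a, b, z, e)| ≤ L
  bound₃ : ∀ a b z e, InBox R a b z → 0 ≤ e → e ≤ 1 → |g₃ (a, b, z, e)| ≤ L
  lip₁ : ∀ a b z a' b' z' e, InBox R a b z → InBox R a' b' z' → 0 ≤ e → e ≤ 1 →
    |g₁ (a, b, z, e) - g₁ (a', b', z', 0)| ≤ L * (|a - a'| + |b - b'| + |z - z'| + e)
  lip₂ : ∀ a b z a' b' z' e, InBox R a b z → InBox R a' b' z' → 0 ≤ e → e ≤ 1 →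
    |g₂ (a, b, z, e) - g₂ (a', b', z', 0)| ≤ L * (|a - a'| + |b - b'| + |z - z'| + e)

/-- A trajectory of `a' = g₁, b' = g₂, e z' = -(z³ + b z + a + e g₃)` (in the slow time) that runs in
the box of size `R` on `[0, T]`. -/
structure IsTraj (g₁ g₂ g₃ : ℝ × ℝ × ℝ × ℝ → ℝ) (R e T : ℝ) (a b z : ℝ → ℝ) : Prop where
  e_pos : 0 < e
  e_le : e ≤ 1
  box : ∀ t ∈ Icc 0 T, InBox R (a t) (b t) (z t)
  da : ∀ t ∈ Icc 0 T, HasDerivWithinAt a (g₁ (a t, b t, z t, e)) (Icc 0 T) t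
  db : ∀ t ∈ Icc 0 T, HasDerivWithinAt b (g₂ (a t, b t, z t, e)) (Icc 0 T) t
  dz : ∀ t ∈ Icc 0 T, HasDerivWithinAt z
    (-(cubic (z t) (a t) (b t) + e * g₃ (a t, b t, z t, e)) / e) (Icc 0 T) t

/-- A solution of the reduced equations on the slow manifold during `[s, u]`. Right derivatives
suffice for the comparison arguments. The continuity of the fast component is not included. -/
structure IsSlow (g₁ g₂ : ℝ × ℝ × ℝ × ℝ → ℝ) (R s u : ℝ) (A B Z : ℝ → ℝ) : Prop where
  contA : ContinuousOn A (Icc s u)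
  contB : ContinuousOn B (Icc s u)
  dA : ∀ t ∈ Ico s u, HasDerivWithinAt A (g₁ (A t, B t, Z t, 0)) (Ici t) t
  dB : ∀ t ∈ Ico s u, HasDerivWithinAt B (g₂ (A t, B t, Z t, 0)) (Ici t) t
  mem : ∀ t ∈ Icc s u, cubic (Z t) (A t) (B t) = 0
  box : ∀ t ∈ Icc s u, InBox R (A t) (B t) (Z t)

variable {g₁ g₂ g₃ : ℝ × ℝ × ℝ × ℝ → ℝ} {R L e T : ℝ} {a b z A B Z : ℝ → ℝ}

namespace IsTraj

theorem contA (h : IsTraj g₁ g₂ g₃ R e T a b z) : ContinuousOn a (Icc 0 T) :=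
  fun t ht => (h.da t ht).continuousWithinAt

theorem contB (h : IsTraj g₁ g₂ g₃ R e T a b z) : ContinuousOn b (Icc 0 T) :=
  fun t ht => (h.db t ht).continuousWithinAt

theorem contZ (h : IsTraj g₁ g₂ g₃ R e T a b z) : ContinuousOn z (Icc 0 T) :=
  fun t ht => (h.dz t ht).continuousWithinAt

theorem da' (h : IsTraj g₁ g₂ g₃ R e T a b z) {t : ℝ} (ht : t ∈ Ico 0 T) :
    HasDerivWithinAt a (g₁ (a t, b t, z t, e)) (Ici t) t :=
  hasDerivWithinAt_Ici_of_Icc (h.da t ⟨ht.1, ht.2.le⟩) ht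

theorem db' (h : IsTraj g₁ g₂ g₃ R e T a b z) {t : ℝ} (ht : t ∈ Ico 0 T) :
    HasDerivWithinAt b (g₂ (a t, b t, z t, e)) (Ici t) t :=
  hasDerivWithinAt_Ici_of_Icc (h.db t ⟨ht.1, ht.2.le⟩) ht

theorem dz' (h : IsTraj g₁ g₂ g₃ R e T a b z) {t : ℝ} (ht : t ∈ Ico 0 T) :
    HasDerivWithinAt z (-(cubic (z t) (a t) (b t) + e * g₃ (a t, b t, z t, e)) / e) (Ici t) t :=
  hasDerivWithinAt_Ici_of_Icc (h.dz t ⟨ht.1, ht.2.le⟩) ht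

theorem contCubic (h : IsTraj g₁ g₂ g₃ R e T a b z) :
    ContinuousOn (fun t => cubic (z t) (a t) (b t)) (Icc 0 T) := by
  have h1 := h.contA; have h2 := h.contB; have h3 := h.contZ
  unfold cubic
  fun_prop

/-- The equation for the defect `z³ + b z + a`: it decays at the rate `(3z² + b) / e`, up to a drift of
order one. -/
theorem dcubic (h : IsTraj g₁ g₂ g₃ R e T a b z) {t : ℝ} (ht : t ∈ Ico 0 T) :
    HasDerivWithinAt (fun t => cubic (z t) (a t) (b t))
      (-((3 * z t ^ 2 + b t) * (cubic (z t) (a t) (b t) + e * g₃ (a t, b t, z t, e))) / e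
        + (z t * g₂ (a t, b t, z t, e) + g₁ (a t, b t, z t, e))) (Ici t) t := by
  have := (((h.dz' ht).pow 3).add ((h.db' ht).mul (h.dz' ht))).add (h.da' ht)
  refine this.congr_deriv ?_
  have := h.e_pos.ne'
  field_simp
  push_cast
  ring

/-- The slow variables drift at speed at most `L`. -/
theorem drift (h : IsTraj g₁ g₂ g₃ R e T a b z) (hb : IsBounded g₁ g₂ g₃ R L) {s t : ℝ}
    (hs : 0 ≤ s) (hst : s ≤ t) (ht : t ≤ T) :
    |a t - a s| ≤ L * (t - s) ∧ |b t - b s| ≤ L * (t - s) := by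
  have hsub : Icc s T ⊆ Icc 0 T := Icc_subset_Icc_left hs
  constructor
  · exact abs_sub_le_of_abs_deriv_le (h.contA.mono hsub)
      (fun x hx => h.da' ⟨hs.trans hx.1, hx.2⟩)
      (fun x hx => hb.bound₁ _ _ _ _ (h.box x ⟨hs.trans hx.1, hx.2.le⟩) h.e_pos.le h.e_le)
      t ⟨hst, ht⟩
  · exact abs_sub_le_of_abs_deriv_le (h.contB.mono hsub)
      (fun x hx => h.db' ⟨hs.trans hx.1, hx.2⟩)
      (fun x hx => hb.bound₂ _ _ _ _ (h.box x ⟨hs.trans hx.1, hx.2.le⟩) h.e_pos.le h.e_le)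
      t ⟨hst, ht⟩

/-- The fast variable cannot cross the level `m` upwards where `z³ + b z + a > e L`. -/
theorem z_le (h : IsTraj g₁ g₂ g₃ R e T a b z) (hb : IsBounded g₁ g₂ g₃ R L) {s u m : ℝ}
    (hs : 0 ≤ s) (hu : u ≤ T) (hm : z s ≤ m)
    (hpos : ∀ t ∈ Ico s u, z t = m → e * L < cubic m (a t) (b t)) : ∀ t ∈ Icc s u, z t ≤ m := by
  refine le_of_barrier (h.contZ.mono (Icc_subset_Icc hs hu))
    (fun t ht => h.dz' ⟨hs.trans ht.1, ht.2.trans_le hu⟩) hm fun t ht htm => ?_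
  have h1 := hpos t ht htm
  have h2 := abs_le.1 (hb.bound₃ _ _ _ _ (h.box t ⟨hs.trans ht.1, ht.2.le.trans hu⟩) h.e_pos.le
    h.e_le)
  refine div_neg_of_neg_of_pos ?_ h.e_pos
  rw [htm] at h2 ⊢
  nlinarith [h.e_pos]

/-- The fast variable cannot cross the level `m` downwards where `z³ + b z + a < - e L`. -/
theorem le_z (h : IsTraj g₁ g₂ g₃ R e T a b z) (hb : IsBounded g₁ g₂ g₃ R L) {s u m : ℝ}
    (hs : 0 ≤ s) (hu : u ≤ T) (hm : m ≤ z s)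
    (hneg : ∀ t ∈ Ico s u, z t = m → cubic m (a t) (b t) < -(e * L)) : ∀ t ∈ Icc s u, m ≤ z t := by
  refine ge_of_barrier (h.contZ.mono (Icc_subset_Icc hs hu))
    (fun t ht => h.dz' ⟨hs.trans ht.1, ht.2.trans_le hu⟩) hm fun t ht htm => ?_
  have h1 := hneg t ht htm
  have h2 := abs_le.1 (hb.bound₃ _ _ _ _ (h.box t ⟨hs.trans ht.1, ht.2.le.trans hu⟩) h.e_pos.le
    h.e_le)
  refine div_pos ?_ h.e_pos
  rw [htm] at h2 ⊢
  nlinarith [h.e_pos]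

/-- If `z³ + b z + a ≥ c + e L` above the level `m`, the fast variable is below `m` after
the time needed to come down at speed `c / e`. -/
theorem z_exit (h : IsTraj g₁ g₂ g₃ R e T a b z) (hb : IsBounded g₁ g₂ g₃ R L) {s u m c : ℝ}
    (hs : 0 ≤ s) (hsu : s ≤ u) (hu : u ≤ T) (hc : 0 < c)
    (hpos : ∀ t ∈ Ico s u, m ≤ z t → c + e * L ≤ cubic (z t) (a t) (b t))
    (hlong : z s - c / e * (u - s) ≤ m) : z u ≤ m := by
  have he := h.e_pos
  refine le_of_exit hsu (div_pos hc he) (h.contZ.mono (Icc_subset_Icc hs hu))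
    (fun t ht => h.dz' ⟨hs.trans ht.1, ht.2.trans_le hu⟩) (fun t ht hmt => ?_) hlong
  have h1 := hpos t ht hmt
  have h2 := abs_le.1 (hb.bound₃ _ _ _ _ (h.box t ⟨hs.trans ht.1, ht.2.le.trans hu⟩) h.e_pos.le
    h.e_le)
  rw [← neg_div]
  refine div_le_div_of_nonneg_right ?_ he.le
  nlinarith

/-- Where `3z² + b ≥ c`, a bound `p` for `|z³ + b z + a|` that exceeds a multiple of `e` is kept. -/
theorem abs_cubic_le (h : IsTraj g₁ g₂ g₃ R e T a b z) (hb : IsBounded g₁ g₂ g₃ R L) {s u c p : ℝ}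
    (hs : 0 ≤ s) (hu : u ≤ T) (hc : 0 < c)
    (hl : ∀ t ∈ Ico s u, c ≤ 3 * z t ^ 2 + b t)
    (hp : e * (R + 1) * L < c * (p - e * L)) (h0 : |cubic (z s) (a s) (b s)| ≤ p) :
    ∀ t ∈ Icc s u, |cubic (z t) (a t) (b t)| ≤ p := by
  have he := h.e_pos
  have hR := hb.one_le_R
  have hL := hb.one_le_L
  have hpL : 0 < p - e * L := by
    have : 0 < e * (R + 1) * L := by positivity
    by_contra! hneg
    nlinarith
  have hcont := h.contCubic.mono (Icc_subset_Icc hs hu)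
  have key : ∀ t ∈ Ico s u, (c * (p - e * L) ≤ (3 * z t ^ 2 + b t) * (p - e * L)) ∧
      |g₃ (a t, b t, z t, e)| ≤ L ∧
      |z t * g₂ (a t, b t, z t, e) + g₁ (a t, b t, z t, e)| ≤ (R + 1) * L := by
    intro t ht
    have hbox := h.box t ⟨hs.trans ht.1, ht.2.le.trans hu⟩
    have h1 := hb.bound₁ _ _ _ _ hbox he.le h.e_le
    have h2 := hb.bound₂ _ _ _ _ hbox he.le h.e_le
    refine ⟨mul_le_mul_of_nonneg_right (hl t ht) hpL.le, hb.bound₃ _ _ _ _ hbox he.le h.e_le, ?_⟩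
    calc _ ≤ |z t * g₂ (a t, b t, z t, e)| + |g₁ (a t, b t, z t, e)| := abs_add_le _ _
      _ ≤ R * L + L := by
        rw [abs_mul]
        exact add_le_add (mul_le_mul hbox.2.2 h2 (abs_nonneg _) (by linarith)) h1
      _ = _ := by ring
  intro t ht
  rw [abs_le]
  constructor
  · refine ge_of_barrier hcont (fun t ht => h.dcubic ⟨hs.trans ht.1, ht.2.trans_le hu⟩)
      (abs_le.1 h0).1 (fun t ht htp => ?_) t ht
    obtain ⟨k1, k2, k3⟩ := key t ht
    rw [htp]
    have hlt := hl t ht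
    have : e * (R + 1) * L / e <
        -((3 * z t ^ 2 + b t) * (-p + e * g₃ (a t, b t, z t, e))) / e := by
      refine div_lt_div_of_pos_right ?_ he
      have : (3 * z t ^ 2 + b t) * (e * g₃ (a t, b t, z t, e)) ≤ (3 * z t ^ 2 + b t) * (e * L) :=
        mul_le_mul_of_nonneg_left (mul_le_mul_of_nonneg_left (abs_le.1 k2).2 he.le) (by linarith)
      linarith
    have h5 : e * (R + 1) * L / e = (R + 1) * L := by field_simp
    linarith [(abs_le.1 k3).1]
  · refine le_of_barrier hcont (fun t ht => h.dcubic ⟨hs.trans ht.1, ht.2.trans_le hu⟩)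
      (abs_le.1 h0).2 (fun t ht htp => ?_) t ht
    obtain ⟨k1, k2, k3⟩ := key t ht
    rw [htp]
    have hlt := hl t ht
    have : -((3 * z t ^ 2 + b t) * (p + e * g₃ (a t, b t, z t, e))) / e <
        -(e * (R + 1) * L) / e := by
      refine div_lt_div_of_pos_right ?_ he
      have : (3 * z t ^ 2 + b t) * (e * -L) ≤ (3 * z t ^ 2 + b t) * (e * g₃ (a t, b t, z t, e)) :=
        mul_le_mul_of_nonneg_left (mul_le_mul_of_nonneg_left (abs_le.1 k2).1 he.le) (by linarith)
      linarith
    have h5 : -(e * (R + 1) * L) / e = -((R + 1) * L) := by field_simp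
    linarith [(abs_le.1 k3).2]

end IsTraj

theorem cubic_sub (z a b Z A B : ℝ) :
    cubic z a b - cubic Z A B
      = (z - Z) * (z ^ 2 + z * Z + Z ^ 2 + b) + Z * (b - B) + (a - A) := by
  unfold cubic; ring

/-- The trajectory is within `ρ` of the slow orbit at the time `t`. -/
def Close (a b z A B Z : ℝ → ℝ) (ρ t : ℝ) : Prop :=
  |a t - A t| ≤ ρ ∧ |b t - B t| ≤ ρ ∧ |z t - Z t| ≤ ρ

/-- The distance in the slow variables is controlled by Grönwall's inequality, once the distance in
the fast variable is bounded in terms of it. -/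
theorem IsTraj.slow_dist_le (h : IsTraj g₁ g₂ g₃ R e T a b z) (hb : IsBounded g₁ g₂ g₃ R L)
    {s u π : ℝ} {k K : ℝ → ℝ} (hs : 0 ≤ s) (hu : u ≤ T) (hsl : IsSlow g₁ g₂ R s u A B Z)
    (hK : ContinuousOn K (Icc s u)) (hK' : ∀ t ∈ Ico s u, HasDerivWithinAt K (k t) (Ici t) t)
    (hπ : 0 < π)
    (hw : ∀ t ∈ Ico s u,
      L * (2 * max |a t - A t| |b t - B t| + |z t - Z t| + e)
        ≤ k t * (max |a t - A t| |b t - B t| + π)) :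
    ∀ t ∈ Icc s u, max |a t - A t| |b t - B t| ≤
      (max |a s - A s| |b s - B s| + π) * Real.exp (K t - K s) := by
  have hsub : Icc s u ⊆ Icc 0 T := Icc_subset_Icc hs hu
  refine norm_add_le_of_deriv_le_kernel (E := ℝ × ℝ)
    (f := fun t => (a t - A t, b t - B t))
    (f' := fun t => (g₁ (a t, b t, z t, e) - g₁ (A t, B t, Z t, 0),
      g₂ (a t, b t, z t, e) - g₂ (A t, B t, Z t, 0)))
    (((h.contA.mono hsub).sub hsl.contA).prodMk ((h.contB.mono hsub).sub hsl.contB))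
    (fun t ht => ?_) hK hK' hπ (fun t ht => ?_)
  · have ht' : t ∈ Ico 0 T := ⟨hs.trans ht.1, ht.2.trans_le hu⟩
    exact ((h.da' ht').sub (hsl.dA t ht)).prodMk ((h.db' ht').sub (hsl.dB t ht))
  · have ht' : t ∈ Icc s u := ⟨ht.1, ht.2.le⟩
    refine le_trans ?_ (hw t ht)
    have h1 := hb.lip₁ _ _ _ _ _ _ e (h.box t (hsub ht')) (hsl.box t ht') h.e_pos.le h.e_le
    have h2 := hb.lip₂ _ _ _ _ _ _ e (h.box t (hsub ht')) (hsl.box t ht') h.e_pos.le h.e_le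
    have h3 := le_max_left |a t - A t| |b t - B t|
    have h4 := le_max_right |a t - A t| |b t - B t|
    have h5 : |a t - A t| + |b t - B t| + |z t - Z t| + e
        ≤ 2 * max |a t - A t| |b t - B t| + |z t - Z t| + e := by linarith
    have h6 := mul_le_mul_of_nonneg_left h5 (zero_le_one.trans hb.one_le_L)
    simp only [Prod.norm_def, Real.norm_eq_abs]
    exact max_le (h1.trans h6) (h2.trans h6)

/-- The distance of two zeros in the fast direction, in terms of the defect of the first one. -/
theorem abs_sub_mul_le {z a b Z A B q : ℝ} (hZ : |Z| ≤ R) (h0 : cubic Z A B = 0)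
    (hq : q ≤ z ^ 2 + z * Z + Z ^ 2 + b) :
    |z - Z| * q ≤ |cubic z a b| + (R + 1) * max |a - A| |b - B| := by
  have h1 := cubic_sub z a b Z A B
  rw [h0, sub_zero] at h1
  have hR : 0 ≤ R := (abs_nonneg _).trans hZ
  calc |z - Z| * q
      ≤ |z - Z| * |z ^ 2 + z * Z + Z ^ 2 + b| :=
        mul_le_mul_of_nonneg_left (hq.trans (le_abs_self _)) (abs_nonneg _)
    _ = |cubic z a b - Z * (b - B) - (a - A)| := by
        rw [← abs_mul, h1]; congr 1; ring
    _ ≤ |cubic z a b| + |Z * (b - B)| + |a - A| :=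
        (abs_sub _ _).trans (add_le_add_left (abs_sub _ _) _)
    _ ≤ |cubic z a b| + R * max |a - A| |b - B| + max |a - A| |b - B| := by
        rw [abs_mul]
        exact add_le_add (add_le_add le_rfl (mul_le_mul hZ (le_max_right _ _)
          (abs_nonneg _) hR)) (le_max_left _ _)
    _ = _ := by ring

theorem abs_cubic_le_of_close {z a b Z A B ρ : ℝ} (hR : 1 ≤ R) (hB1 : InBox R a b z)
    (hZ : |Z| ≤ R) (h0 : cubic Z A B = 0) (ha : |a - A| ≤ ρ) (hb : |b - B| ≤ ρ)
    (hz : |z - Z| ≤ ρ) : |cubic z a b| ≤ 6 * R ^ 2 * ρ := by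
  have hρ : 0 ≤ ρ := (abs_nonneg _).trans ha
  have h1 := cubic_sub z a b Z A B
  rw [h0, sub_zero] at h1
  have hz2 : |z| ^ 2 ≤ R ^ 2 := by gcongr; exact hB1.2.2
  have hZ2 : |Z| ^ 2 ≤ R ^ 2 := by gcongr
  have hzZ : |z| * |Z| ≤ R * R := mul_le_mul hB1.2.2 hZ (abs_nonneg _) (by linarith)
  have h2 : |z ^ 2 + z * Z + Z ^ 2 + b| ≤ 4 * R ^ 2 := by
    calc _ ≤ |z ^ 2| + |z * Z| + |Z ^ 2| + |b| :=
          (abs_add_le _ _).trans (add_le_add_left ((abs_add_le _ _).trans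
            (add_le_add_left (abs_add_le _ _) _)) _)
      _ ≤ _ := by
        rw [abs_mul, abs_pow, abs_pow]
        nlinarith [hB1.2.1]
  rw [h1]
  have hRR : R ≤ R ^ 2 := by nlinarith
  calc _ ≤ |(z - Z) * (z ^ 2 + z * Z + Z ^ 2 + b)| + |Z * (b - B)| + |a - A| :=
        (abs_add_le _ _).trans (add_le_add_left (abs_add_le _ _) _)
    _ ≤ ρ * (4 * R ^ 2) + R * ρ + ρ := by
      rw [abs_mul, abs_mul]
      exact add_le_add (add_le_add (mul_le_mul hz h2 (abs_nonneg _) hρ)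
        (mul_le_mul hZ hb (abs_nonneg _) (by linarith))) ha
    _ = (4 * R ^ 2 + R + 1) * ρ := by ring
    _ ≤ 6 * R ^ 2 * ρ := mul_le_mul_of_nonneg_right (by linarith) hρ

/-- Near an attracting point of the slow manifold the rate `3z² + b` and the difference quotient of
the cubic are bounded below. -/
theorem half_le_rates {z b Z B r c : ℝ} (hR : 1 ≤ R) (hz : |z| ≤ R) (hZ : |Z| ≤ R)
    (hb : |b - B| ≤ r) (hzZ : |z - Z| ≤ r) (hc : c ≤ 3 * Z ^ 2 + B) (hr : 8 * R * r ≤ c / 2) :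
    c / 2 ≤ 3 * z ^ 2 + b ∧ c / 2 ≤ z ^ 2 + z * Z + Z ^ 2 + b := by
  have hrr : 0 ≤ r := (abs_nonneg _).trans hb
  have h1 : |(z - Z) * (z + Z)| ≤ r * (2 * R) := by
    rw [abs_mul]
    refine mul_le_mul hzZ ((abs_add_le _ _).trans (by linarith)) (abs_nonneg _) hrr
  have h2 : |(z - Z) * Z| ≤ r * R := by
    rw [abs_mul]; exact mul_le_mul hzZ hZ (abs_nonneg _) hrr
  have h4 : r ≤ R * r := by nlinarith
  rw [abs_le] at h1 h2 hb
  constructor <;> nlinarith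

/-- The improvement step of the bootstrap along an attracting part of the slow manifold: as long
as the trajectory is within a small distance `r` of the slow orbit, it is within `C ρ`, where `ρ`
bounds `e` and the initial distance. -/
theorem IsTraj.track_step (h : IsTraj g₁ g₂ g₃ R e T a b z) (hb : IsBounded g₁ g₂ g₃ R L)
    {s u c ℓ r ρ C₁ k C₂ : ℝ} (hs : 0 ≤ s) (hsu : s ≤ u) (hu : u ≤ T) (hℓ : u - s ≤ ℓ) (hc : 0 < c)
    (hsl : IsSlow g₁ g₂ R s u A B Z) (hl : ∀ t ∈ Icc s u, c ≤ 3 * Z t ^ 2 + B t)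
    (hr : 8 * R * r ≤ c / 2)
    (hC₁ : C₁ = 6 * R ^ 2 + L + 2 * (R + 1) * L / c + 1) (hk : k = L * (3 + 2 * (R + 1) / c))
    (hC₂ : C₂ = (1 + C₁) * Real.exp (k * ℓ)) (heρ : e ≤ ρ)
    (h0 : Close a b z A B Z ρ s) (hboot : ∀ t ∈ Icc s u, Close a b z A B Z r t) :
    Close a b z A B Z (2 / c * (C₁ + (R + 1) * C₂) * ρ + C₂ * ρ) u := by
  have hR := hb.one_le_R
  have hL := hb.one_le_L
  have he := h.e_pos
  have hρ : 0 < ρ := he.trans_le heρ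
  have hC₁0 : 0 < C₁ := by rw [hC₁]; positivity
  have hC₂0 : 0 < C₂ := by rw [hC₂]; positivity
  have hsub : Icc s u ⊆ Icc 0 T := Icc_subset_Icc hs hu
  have hrr : 0 ≤ r := (abs_nonneg _).trans (hboot s ⟨le_rfl, hsu⟩).1
  -- both the linear rate `3z² + b` and the difference quotient of the cubic stay above `c / 2`
  have hrate : ∀ t ∈ Icc s u, c / 2 ≤ 3 * z t ^ 2 + b t ∧
      c / 2 ≤ z t ^ 2 + z t * Z t + Z t ^ 2 + b t := by
    intro t ht
    obtain ⟨-, k2, k3⟩ := hboot t ht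
    exact half_le_rates hR (h.box t (hsub ht)).2.2 (hsl.box t ht).2.2 k2 k3 (hl t ht) hr
  have hp0 : |cubic (z s) (a s) (b s)| ≤ C₁ * ρ := by
    have hs' : s ∈ Icc s u := ⟨le_rfl, hsu⟩
    refine (abs_cubic_le_of_close hR (h.box s (hsub hs')) (hsl.box s hs').2.2 (hsl.mem s hs')
      h0.1 h0.2.1 h0.2.2).trans (mul_le_mul_of_nonneg_right ?_ hρ.le)
    have : 0 < 2 * (R + 1) * L / c := by positivity
    rw [hC₁]; linarith
  have hP := h.abs_cubic_le hb hs hu (half_pos hc) (fun t ht => (hrate t ⟨ht.1, ht.2.le⟩).1)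
    (p := C₁ * ρ) (by
      have h1 : C₁ * ρ - e * L ≥ (2 * (R + 1) * L / c + 1) * e := by
        have : C₁ * e ≤ C₁ * ρ := mul_le_mul_of_nonneg_left heρ hC₁0.le
        rw [hC₁] at this ⊢
        nlinarith [mul_pos he (pow_pos (zero_lt_one.trans_le hR) 2)]
      have h2 : c / 2 * ((2 * (R + 1) * L / c + 1) * e) = e * (R + 1) * L + c / 2 * e := by
        field_simp
      have h3 := mul_le_mul_of_nonneg_left h1 (half_pos hc).le
      have : 0 < c / 2 * e := by positivity
      linarith) hp0
  have hw : ∀ t ∈ Icc s u, |z t - Z t| ≤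
      2 / c * (C₁ * ρ + (R + 1) * max |a t - A t| |b t - B t|) := by
    intro t ht
    have h3 := (abs_sub_mul_le (hsl.box t ht).2.2 (hsl.mem t ht) (hrate t ht).2 (a := a t)).trans
      (add_le_add_left (hP t ht) _)
    rw [div_mul_eq_mul_div, le_div_iff₀ hc]
    linarith
  have hk0 : 0 ≤ k := by rw [hk]; positivity
  have hD := h.slow_dist_le hb hs hu hsl (k := fun _ => k) (K := fun t => k * t) (π := C₁ * ρ)
    (by fun_prop) (fun x _ => by
      simpa using ((hasDerivAt_id x).const_mul k).hasDerivWithinAt) (by positivity)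
    (fun t ht => by
      have h1 := hw t ⟨ht.1, ht.2.le⟩
      have h2 : 0 ≤ max |a t - A t| |b t - B t| := le_max_of_le_left (abs_nonneg _)
      set D := max |a t - A t| |b t - B t|
      have h3 : e ≤ C₁ * ρ := by
        have : 1 ≤ C₁ := by
          have : 0 < 2 * (R + 1) * L / c := by positivity
          rw [hC₁]; nlinarith
        nlinarith
      rw [hk, mul_assoc]
      refine mul_le_mul_of_nonneg_left ?_ (by linarith)
      have h4 : 2 / c * (C₁ * ρ) ≤ 2 * (R + 1) / c * (C₁ * ρ) := by
        refine mul_le_mul_of_nonneg_right ?_ (by positivity)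
        refine div_le_div_of_nonneg_right ?_ hc.le
        linarith
      have h5 : 2 / c * ((R + 1) * D) = 2 * (R + 1) / c * D := by ring
      have h6 : 0 < C₁ * ρ := by positivity
      nlinarith) u ⟨hsu, le_rfl⟩
  have hDu : max |a u - A u| |b u - B u| ≤ C₂ * ρ := by
    refine hD.trans ?_
    have h1 : max |a s - A s| |b s - B s| ≤ ρ := max_le h0.1 h0.2.1
    have h2 : Real.exp (k * u - k * s) ≤ Real.exp (k * ℓ) := by
      rw [← mul_sub]; gcongr
    rw [hC₂]
    calc _ ≤ (ρ + C₁ * ρ) * Real.exp (k * ℓ) := by gcongr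
      _ = _ := by ring
  have hwu := hw u ⟨hsu, le_rfl⟩
  have hpos : 0 ≤ 2 / c * (C₁ + (R + 1) * C₂) * ρ := by positivity
  have hwu' : |z u - Z u| ≤ 2 / c * (C₁ + (R + 1) * C₂) * ρ := by
    refine hwu.trans ?_
    rw [mul_assoc]
    refine mul_le_mul_of_nonneg_left ?_ (by positivity)
    nlinarith
  have h7 : 0 < C₂ * ρ := by positivity
  exact ⟨by linarith [le_max_left |a u - A u| |b u - B u|],
    by linarith [le_max_right |a u - A u| |b u - B u|], by linarith⟩

/-- Along an attracting part of the slow manifold (with rate at least `c`) a trajectory that starts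
near a slow orbit stays near it. The required closeness depends on `c` and the duration only. -/
theorem IsBounded.exists_track (hb : IsBounded g₁ g₂ g₃ R L) {c : ℝ} (hc : 0 < c) (ℓ : ℝ)
    {η : ℝ} (hη : 0 < η) :
    ∃ ρ > 0, ∀ (A B Z : ℝ → ℝ) (s u : ℝ), 0 ≤ s → u - s ≤ ℓ → IsSlow g₁ g₂ R s u A B Z →
      ContinuousOn Z (Icc s u) → (∀ t ∈ Icc s u, c ≤ 3 * Z t ^ 2 + B t) →
      ∀ (e T : ℝ) (a b z : ℝ → ℝ), IsTraj g₁ g₂ g₃ R e T a b z → e ≤ ρ → s ≤ T →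
        Close a b z A B Z ρ s → ∀ t ∈ Icc s u, t ≤ T → Close a b z A B Z η t := by
  have hR := hb.one_le_R
  have hL := hb.one_le_L
  set C₁ := 6 * R ^ 2 + L + 2 * (R + 1) * L / c + 1 with hC₁
  set k := L * (3 + 2 * (R + 1) / c) with hk
  set C₂ := (1 + C₁) * Real.exp (k * ℓ) with hC₂
  set C := 2 / c * (C₁ + (R + 1) * C₂) + C₂ with hC
  have hC₁0 : 0 < C₁ := by positivity
  have hC₂0 : 0 < C₂ := by positivity
  have hC0 : 0 < C := by positivity
  set r := min (c / (16 * R)) η with hr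
  have hr0 : 0 < r := lt_min (by positivity) hη
  set ρ := min (r / 2) (r / (2 * C)) with hρ
  have hρ0 : 0 < ρ := lt_min (by positivity) (by positivity)
  refine ⟨ρ, hρ0, fun A B Z s u hs hℓ hsl hZ hl e T a b z h heρ hsT h0 t ht htT => ?_⟩
  have hCρ : C * ρ < r := by
    have : C * ρ ≤ C * (r / (2 * C)) := mul_le_mul_of_nonneg_left (min_le_right _ _) hC0.le
    have h2 : C * (r / (2 * C)) = r / 2 := by field_simp
    linarith
  have hρr : ρ < r := (min_le_left _ _).trans_lt (by linarith)
  have hrc : 8 * R * r ≤ c / 2 := by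
    have : 8 * R * r ≤ 8 * R * (c / (16 * R)) :=
      mul_le_mul_of_nonneg_left (min_le_left _ _) (by linarith)
    have h2 : 8 * R * (c / (16 * R)) = c / 2 := by field_simp; norm_num
    linarith
  have hsub : Icc s t ⊆ Icc 0 T := Icc_subset_Icc hs htT
  have hsub' : Icc s t ⊆ Icc s u := Icc_subset_Icc_right ht.2
  have hcont : ContinuousOn (fun x => max (max |a x - A x| |b x - B x|) |z x - Z x|) (Icc s t) := by
    have h1 := (h.contA.mono hsub).sub (hsl.contA.mono hsub')
    have h2 := (h.contB.mono hsub).sub (hsl.contB.mono hsub')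
    have h3 := (h.contZ.mono hsub).sub (hZ.mono hsub')
    exact ContinuousOn.sup (ContinuousOn.sup h1.abs h2.abs) h3.abs
  have key := lt_of_bootstrap hcont (r := r) (by
    exact (max_le (max_le h0.1 h0.2.1) h0.2.2).trans_lt hρr) (fun y hy hboot => by
      have hy' : Icc s y ⊆ Icc s u := Icc_subset_Icc_right (hy.2.trans ht.2)
      have hsl' : IsSlow g₁ g₂ R s y A B Z :=
        ⟨hsl.contA.mono hy', hsl.contB.mono hy',
          fun x hx => hsl.dA x ⟨hx.1, hx.2.trans_le (hy.2.trans ht.2)⟩,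
          fun x hx => hsl.dB x ⟨hx.1, hx.2.trans_le (hy.2.trans ht.2)⟩,
          fun x hx => hsl.mem x (hy' hx), fun x hx => hsl.box x (hy' hx)⟩
      have := h.track_step hb hs hy.1 (hy.2.trans htT) (ℓ := ℓ)
        (by linarith [hy.2, ht.2]) hc hsl' (fun x hx => hl x (hy' hx)) hrc hC₁ hk hC₂ heρ h0
        (fun x hx => by
          have := hboot x hx
          simp only [max_le_iff] at this
          exact ⟨this.1.1, this.1.2, this.2⟩)
      have h2 : 2 / c * (C₁ + (R + 1) * C₂) * ρ + C₂ * ρ = C * ρ := by rw [hC]; ring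
      rw [h2] at this
      exact (max_le (max_le this.1 this.2.1) this.2.2).trans_lt hCρ) t ⟨ht.1, le_rfl⟩
  have h3 := key.le.trans (min_le_right _ _)
  simp only [max_le_iff] at h3
  exact ⟨h3.1.1, h3.1.2, h3.2⟩

/-! ### Passage of a fold -/

theorem eventually_mul_lt (C : ℝ) {x : ℝ} (hx : 0 < x) : ∀ᶠ δ in 𝓝[>] (0 : ℝ), C * δ < x := by
  have : Tendsto (fun δ : ℝ => C * δ) (𝓝[>] 0) (𝓝 (C * 0)) :=
    Tendsto.mono_left (Continuous.tendsto (by fun_prop) 0) nhdsWithin_le_nhds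
  rw [mul_zero] at this
  exact this.eventually_lt_const hx

theorem eventually_lt_of_pos {x : ℝ} (hx : 0 < x) : ∀ᶠ δ in 𝓝[>] (0 : ℝ), δ < x := by
  simpa using eventually_mul_lt 1 hx

/-- The mean value inequality for an open interval: at the left end point, which may be a contact
time, only continuity is required. -/
theorem le_sub_of_le_deriv_Ioo {f f' : ℝ → ℝ} {s u c : ℝ} (hsu : s ≤ u)
    (hf : ContinuousOn f (Icc s u))
    (hf' : ∀ t ∈ Ioo s u, HasDerivWithinAt f (f' t) (Ici t) t)
    (hc : ∀ t ∈ Ioo s u, c ≤ f' t) : f s + c * (u - s) ≤ f u := by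
  rcases hsu.eq_or_lt with rfl | hlt
  · simp
  have h1 : Tendsto (fun x => f x + c * (u - x)) (𝓝[>] s) (𝓝 (f s + c * (u - s))) := by
    refine Tendsto.add ?_ (Tendsto.mono_left (Continuous.tendsto (by fun_prop) s)
      nhdsWithin_le_nhds)
    exact (hf s ⟨le_rfl, hsu⟩).mono_of_mem_nhdsWithin (Icc_mem_nhdsGT hlt)
  refine le_of_tendsto h1 ?_
  filter_upwards [Ioo_mem_nhdsGT hlt] with x hx
  exact le_sub_of_le_deriv (hf.mono (Icc_subset_Icc_left hx.1.le))
    (fun t ht => hf' t ⟨hx.1.trans_le ht.1, ht.2⟩) (fun t ht => hc t ⟨hx.1.trans_le ht.1, ht.2⟩)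
    u ⟨hx.2.le, le_rfl⟩

theorem sub_le_of_deriv_le_Ioo {f f' : ℝ → ℝ} {s u c : ℝ} (hsu : s ≤ u)
    (hf : ContinuousOn f (Icc s u))
    (hf' : ∀ t ∈ Ioo s u, HasDerivWithinAt f (f' t) (Ici t) t)
    (hc : ∀ t ∈ Ioo s u, f' t ≤ c) : f u ≤ f s + c * (u - s) := by
  have := le_sub_of_le_deriv_Ioo (f := fun t => -f t) (f' := fun t => -f' t) (c := -c) hsu hf.neg
    (fun t ht => (hf' t ht).neg) (fun t ht => by have := hc t ht; linarith)
  linarith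

theorem abs_sub_le_of_abs_deriv_le_Ioo {f f' : ℝ → ℝ} {s u c : ℝ} (hsu : s ≤ u)
    (hf : ContinuousOn f (Icc s u))
    (hf' : ∀ t ∈ Ioo s u, HasDerivWithinAt f (f' t) (Ici t) t)
    (hc : ∀ t ∈ Ioo s u, |f' t| ≤ c) : |f u - f s| ≤ c * (u - s) := by
  have h1 := sub_le_of_deriv_le_Ioo hsu hf hf' (fun t ht => (abs_le.1 (hc t ht)).2)
  have h2 := le_sub_of_le_deriv_Ioo hsu hf hf' (fun t ht => (abs_le.1 (hc t ht)).1)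
  rw [abs_le]; constructor <;> linarith

/-- A slow orbit near an isolated contact time `tc ∈ (s₀, u₁)`: it arrives at `z = ζ` with
`3ζ² + b = 0` and continues from `z = -2ζ`. -/
structure IsContact (g₁ g₂ : ℝ × ℝ × ℝ × ℝ → ℝ) (R s₀ tc u₁ : ℝ) (A B Z : ℝ → ℝ) (ζ : ℝ) :
    Prop where
  nonneg : 0 ≤ s₀
  lt_tc : s₀ < tc
  tc_lt : tc < u₁
  contA : ContinuousOn A (Icc s₀ u₁)
  contB : ContinuousOn B (Icc s₀ u₁)
  contZ : ContinuousOn Z (Ioc tc u₁)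
  dA : ∀ t ∈ Ico s₀ u₁, t ≠ tc → HasDerivWithinAt A (g₁ (A t, B t, Z t, 0)) (Ici t) t
  dB : ∀ t ∈ Ico s₀ u₁, t ≠ tc → HasDerivWithinAt B (g₂ (A t, B t, Z t, 0)) (Ici t) t
  mem : ∀ t ∈ Icc s₀ u₁, t ≠ tc → cubic (Z t) (A t) (B t) = 0
  box : ∀ t ∈ Icc s₀ u₁, t ≠ tc → InBox R (A t) (B t) (Z t)
  attr : ∀ t ∈ Icc s₀ u₁, t ≠ tc → 0 < 3 * Z t ^ 2 + B t
  left : Tendsto Z (𝓝[<] tc) (𝓝 ζ)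
  right : Tendsto Z (𝓝[>] tc) (𝓝 (-2 * ζ))
  fold : 3 * ζ ^ 2 + B tc = 0
  trans : g₁ (A tc, B tc, ζ, 0) + ζ * g₂ (A tc, B tc, ζ, 0) ≠ 0

namespace IsContact

variable {s₀ tc u₁ ζ : ℝ}

theorem tendsto_left (h : IsContact g₁ g₂ R s₀ tc u₁ A B Z ζ) :
    Tendsto A (𝓝[<] tc) (𝓝 (A tc)) ∧ Tendsto B (𝓝[<] tc) (𝓝 (B tc)) := by
  have hm : Icc s₀ u₁ ∈ 𝓝[<] tc := nhdsWithin_le_nhds (Icc_mem_nhds h.lt_tc h.tc_lt)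
  exact ⟨(h.contA tc ⟨h.lt_tc.le, h.tc_lt.le⟩).mono_of_mem_nhdsWithin hm,
    (h.contB tc ⟨h.lt_tc.le, h.tc_lt.le⟩).mono_of_mem_nhdsWithin hm⟩

theorem eventually_left (h : IsContact g₁ g₂ R s₀ tc u₁ A B Z ζ) :
    ∀ᶠ t in 𝓝[<] tc, t ∈ Icc s₀ u₁ ∧ t ≠ tc := by
  filter_upwards [Ioo_mem_nhdsLT h.lt_tc] with t ht
  exact ⟨⟨ht.1.le, ht.2.le.trans h.tc_lt.le⟩, ht.2.ne⟩

theorem B_tc (h : IsContact g₁ g₂ R s₀ tc u₁ A B Z ζ) : B tc = -3 * ζ ^ 2 := by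
  linarith [h.fold]

/-- The point of arrival lies on `S`, by continuity; with `b = -3ζ²` this gives `a = 2ζ³`. -/
theorem A_tc (h : IsContact g₁ g₂ R s₀ tc u₁ A B Z ζ) : A tc = 2 * ζ ^ 3 := by
  have h1 : Tendsto (fun t => cubic (Z t) (A t) (B t)) (𝓝[<] tc) (𝓝 (cubic ζ (A tc) (B tc))) :=
    ((h.left.pow 3).add (h.tendsto_left.2.mul h.left)).add h.tendsto_left.1
  have h2 : Tendsto (fun t => cubic (Z t) (A t) (B t)) (𝓝[<] tc) (𝓝 0) := by
    refine tendsto_const_nhds.congr' ?_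
    filter_upwards [h.eventually_left] with t ht
    exact (h.mem t ht.1 ht.2).symm
  have h3 := tendsto_nhds_unique h1 h2
  unfold cubic at h3
  have := h.fold
  linear_combination h3 - ζ * this

theorem box_tc (h : IsContact g₁ g₂ R s₀ tc u₁ A B Z ζ) : InBox R (A tc) (B tc) ζ := by
  refine ⟨le_of_tendsto h.tendsto_left.1.abs ?_, le_of_tendsto h.tendsto_left.2.abs ?_,
    le_of_tendsto h.left.abs ?_⟩ <;>
  filter_upwards [h.eventually_left] with t ht
  · exact (h.box t ht.1 ht.2).1
  · exact (h.box t ht.1 ht.2).2.1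
  · exact (h.box t ht.1 ht.2).2.2

/-- The slow variables are Lipschitz continuous across the contact time. -/
theorem drift (h : IsContact g₁ g₂ R s₀ tc u₁ A B Z ζ) (hb : IsBounded g₁ g₂ g₃ R L) {t : ℝ}
    (ht : t ∈ Icc s₀ u₁) : |A t - A tc| ≤ L * |t - tc| ∧ |B t - B tc| ≤ L * |t - tc| := by
  have key : ∀ (F : ℝ → ℝ) (g : ℝ × ℝ × ℝ × ℝ → ℝ), ContinuousOn F (Icc s₀ u₁) →
      (∀ t ∈ Ico s₀ u₁, t ≠ tc → HasDerivWithinAt F (g (A t, B t, Z t, 0)) (Ici t) t) →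
      (∀ t ∈ Icc s₀ u₁, t ≠ tc → |g (A t, B t, Z t, 0)| ≤ L) → |F t - F tc| ≤ L * |t - tc| := by
    intro F g hF hF' hg
    rcases le_total t tc with htc | htc
    · rw [abs_sub_comm, abs_of_nonpos (sub_nonpos.2 htc), neg_sub]
      exact abs_sub_le_of_abs_deriv_le_Ioo htc (hF.mono (Icc_subset_Icc ht.1 h.tc_lt.le))
        (fun x hx => hF' x ⟨ht.1.trans hx.1.le, hx.2.trans h.tc_lt⟩ hx.2.ne)
        (fun x hx => hg x ⟨ht.1.trans hx.1.le, (hx.2.trans h.tc_lt).le⟩ hx.2.ne)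
    · rw [abs_of_nonneg (sub_nonneg.2 htc)]
      exact abs_sub_le_of_abs_deriv_le_Ioo htc (hF.mono (Icc_subset_Icc h.lt_tc.le ht.2))
        (fun x hx => hF' x ⟨(h.lt_tc.trans hx.1).le, hx.2.trans_le ht.2⟩ hx.1.ne')
        (fun x hx => hg x ⟨(h.lt_tc.trans hx.1).le, hx.2.le.trans ht.2⟩ hx.1.ne')
  exact ⟨key A g₁ h.contA h.dA fun t ht htc =>
      hb.bound₁ _ _ _ _ (h.box t ht htc) le_rfl zero_le_one,
    key B g₂ h.contB h.dB fun t ht htc => hb.bound₂ _ _ _ _ (h.box t ht htc) le_rfl zero_le_one⟩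

/-- On a closed interval to the right of the contact time the orbit is a solution of the reduced
equations. -/
theorem isSlow (h : IsContact g₁ g₂ R s₀ tc u₁ A B Z ζ) {s u : ℝ} (hs : tc < s) (hu : u ≤ u₁) :
    IsSlow g₁ g₂ R s u A B Z := by
  have hsub : Icc s u ⊆ Icc s₀ u₁ := Icc_subset_Icc (h.lt_tc.trans hs).le hu
  exact ⟨h.contA.mono hsub, h.contB.mono hsub,
    fun t ht => h.dA t ⟨(h.lt_tc.trans hs).le.trans ht.1, ht.2.trans_le hu⟩ (hs.trans_le ht.1).ne',
    fun t ht => h.dB t ⟨(h.lt_tc.trans hs).le.trans ht.1, ht.2.trans_le hu⟩ (hs.trans_le ht.1).ne',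
    fun t ht => h.mem t (hsub ht) (hs.trans_le ht.1).ne',
    fun t ht => h.box t (hsub ht) (hs.trans_le ht.1).ne'⟩

end IsContact

/-- The speed of `a + ζ b` at a point near a given one differs little from the speed there at
`ε = 0`. -/
theorem IsBounded.speed_near (hb : IsBounded g₁ g₂ g₃ R L) {a b z a' b' z' e ζ κ : ℝ}
    (h : InBox R a b z) (h' : InBox R a' b' z') (he : 0 ≤ e) (he1 : e ≤ 1) (hζ : 0 ≤ ζ)
    (ha : |a - a'| ≤ κ) (hb' : |b - b'| ≤ κ) (hz : |z - z'| ≤ κ) (heκ : e ≤ κ) :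
    |(g₁ (a, b, z, e) + ζ * g₂ (a, b, z, e)) - (g₁ (a', b', z', 0) + ζ * g₂ (a', b', z', 0))|
      ≤ L * (1 + ζ) * (4 * κ) := by
  have h1 := hb.lip₁ a b z a' b' z' e h h' he he1
  have h2 := hb.lip₂ a b z a' b' z' e h h' he he1
  have h3 : L * (|a - a'| + |b - b'| + |z - z'| + e) ≤ L * (4 * κ) :=
    mul_le_mul_of_nonneg_left (by linarith) (zero_le_one.trans hb.one_le_L)
  calc _ = |(g₁ (a, b, z, e) - g₁ (a', b', z', 0)) + ζ * (g₂ (a, b, z, e) - g₂ (a', b', z', 0))| := by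
        congr 1; ring
    _ ≤ L * (4 * κ) + ζ * (L * (4 * κ)) := by
        refine (abs_add_le _ _).trans (add_le_add (h1.trans h3) ?_)
        rw [abs_mul, abs_of_nonneg hζ]
        exact mul_le_mul_of_nonneg_left (h2.trans h3) hζ
    _ = _ := by ring

/-- The cubic, expanded at the fold point `(2ζ³, -3ζ², ζ)`: the motion off the fold is governed by
the combination `a + ζ b` of the slow variables. -/
theorem cubic_eq_fold (z a b ζ : ℝ) :
    cubic z a b = (z - ζ) ^ 2 * (z + 2 * ζ) + ((a - 2 * ζ ^ 3) + ζ * (b - -3 * ζ ^ 2))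
      + (b - -3 * ζ ^ 2) * (z - ζ) := by
  unfold cubic; ring

/-- At a fold with `ζ > 0` the slow flow points out of the region over which the attracting sheet
`z > ζ` lies: the orbit arrives there from inside that region. -/
theorem IsContact.speed_pos {s₀ tc u₁ ζ : ℝ} (h : IsContact g₁ g₂ R s₀ tc u₁ A B Z ζ)
    (hb : IsBounded g₁ g₂ g₃ R L) (hζ : 0 < ζ) :
    0 < g₁ (A tc, B tc, ζ, 0) + ζ * g₂ (A tc, B tc, ζ, 0) := by
  by_contra! hneg
  set k := -(g₁ (A tc, B tc, ζ, 0) + ζ * g₂ (A tc, B tc, ζ, 0)) with hk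
  have hk0 : 0 < k := by
    have := h.trans
    rw [hk]; linarith [lt_of_le_of_ne hneg this]
  have hL := hb.one_le_L
  set r := min ζ (min (k / (8 * L * (1 + ζ))) (k / (4 * L))) with hr
  have hr0 : 0 < r := by positivity
  -- a time shortly before the contact
  have h1 : ∀ᶠ t in 𝓝[<] tc, |A t - A tc| < r ∧ |B t - B tc| < r ∧ |Z t - ζ| < r := by
    have e1 := (h.tendsto_left.1.sub_const (A tc)).abs
    have e2 := (h.tendsto_left.2.sub_const (B tc)).abs
    have e3 := (h.left.sub_const ζ).abs
    simp only [sub_self, abs_zero] at e1 e2 e3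
    exact (e1.eventually_lt_const hr0).and
      ((e2.eventually_lt_const hr0).and (e3.eventually_lt_const hr0))
  obtain ⟨t₁, ht₁, hnear⟩ := (mem_nhdsLT_iff_exists_Ioo_subset' h.lt_tc).1 h1
  obtain ⟨t, ht, htc⟩ : ∃ t, max t₁ s₀ < t ∧ t < tc := exists_between (max_lt ht₁ h.lt_tc)
  have hts : s₀ < t := (le_max_right _ _).trans_lt ht
  have htI : t ∈ Icc s₀ u₁ := ⟨hts.le, (htc.trans h.tc_lt).le⟩
  have hsub : Icc t tc ⊆ Icc s₀ u₁ := Icc_subset_Icc hts.le h.tc_lt.le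
  have hμ := sub_le_of_deriv_le_Ioo (f := fun t => A t + ζ * B t)
    (f' := fun t => g₁ (A t, B t, Z t, 0) + ζ * g₂ (A t, B t, Z t, 0)) (c := -(k / 2)) htc.le
    ((h.contA.mono hsub).add (continuousOn_const.mul (h.contB.mono hsub)))
    (fun x hx => (h.dA x ⟨hts.le.trans hx.1.le, hx.2.trans h.tc_lt⟩ hx.2.ne).add
      ((h.dB x ⟨hts.le.trans hx.1.le, hx.2.trans h.tc_lt⟩ hx.2.ne).const_mul ζ))
    (fun x hx => by
      obtain ⟨e1, e2, e3⟩ := hnear ⟨(le_max_left _ _).trans_lt (ht.trans hx.1), hx.2⟩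
      have e4 := hb.speed_near (h.box x (hsub ⟨hx.1.le, hx.2.le⟩) hx.2.ne) h.box_tc le_rfl
        zero_le_one hζ.le e1.le e2.le e3.le hr0.le
      have e5 : L * (1 + ζ) * (4 * r) ≤ L * (1 + ζ) * (4 * (k / (8 * L * (1 + ζ)))) := by
        gcongr
        exact (min_le_right _ _).trans (min_le_left _ _)
      have e6 : L * (1 + ζ) * (4 * (k / (8 * L * (1 + ζ)))) = k / 2 := by field_simp; norm_num
      have e7 := (abs_le.1 e4).2
      linarith)
  obtain ⟨-, -, e3⟩ := hnear ⟨(le_max_left _ _).trans_lt ht, htc⟩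
  have hB := (h.drift hb htI).2
  rw [abs_of_neg (sub_neg.2 htc)] at hB
  have hcub := h.mem t htI htc.ne
  rw [cubic_eq_fold _ _ _ ζ, ← h.A_tc, ← h.B_tc] at hcub
  have e3' := abs_lt.1 e3
  have h2 : 0 ≤ (Z t - ζ) ^ 2 * (Z t + 2 * ζ) := by
    have : r ≤ ζ := min_le_left _ _
    have : 0 ≤ Z t + 2 * ζ := by linarith
    positivity
  have h3 : |(B t - B tc) * (Z t - ζ)| ≤ L * -(t - tc) * (k / (4 * L)) := by
    rw [abs_mul]
    refine mul_le_mul hB (e3.le.trans ((min_le_right _ _).trans (min_le_right _ _)))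
      (abs_nonneg _) ?_
    nlinarith
  have h4 : L * -(t - tc) * (k / (4 * L)) = k / 4 * (tc - t) := by field_simp; ring
  have h5 := (abs_le.1 h3).1
  have h6 : 0 < k * (tc - t) := mul_pos hk0 (sub_pos.2 htc)
  nlinarith

/-- Near a contact point, `a + ζ b` grows at least at half of its speed at the contact point. -/
theorem IsTraj.le_comb (h : IsTraj g₁ g₂ g₃ R e T a b z) (hb : IsBounded g₁ g₂ g₃ R L)
    {Ac Bc ζ₀ ζ κ k s t : ℝ} (hc : InBox R Ac Bc ζ₀) (hζ : 0 ≤ ζ)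
    (hk : k ≤ g₁ (Ac, Bc, ζ₀, 0) + ζ * g₂ (Ac, Bc, ζ₀, 0))
    (hκ : L * (1 + ζ) * (4 * κ) ≤ k / 2) (he : e ≤ κ) (hs : 0 ≤ s) (hst : s ≤ t) (ht : t ≤ T)
    (hnear : ∀ x ∈ Ico s t, |a x - Ac| ≤ κ ∧ |b x - Bc| ≤ κ ∧ |z x - ζ₀| ≤ κ) :
    a s + ζ * b s + k / 2 * (t - s) ≤ a t + ζ * b t := by
  refine le_sub_of_le_deriv (f := fun t => a t + ζ * b t)
    (f' := fun t => g₁ (a t, b t, z t, e) + ζ * g₂ (a t, b t, z t, e)) (c := k / 2) (s := s)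
    (u := t) ((h.contA.mono (Icc_subset_Icc hs ht)).add
      (continuousOn_const.mul (h.contB.mono (Icc_subset_Icc hs ht))))
    (fun x hx => (h.da' ⟨hs.trans hx.1, hx.2.trans_le ht⟩).add
      ((h.db' ⟨hs.trans hx.1, hx.2.trans_le ht⟩).const_mul ζ)) (fun x hx => ?_) t ⟨hst, le_rfl⟩
  obtain ⟨h1, h2, h3⟩ := hnear x hx
  have := (abs_le.1 (hb.speed_near (h.box x ⟨hs.trans hx.1, hx.2.le.trans ht⟩) hc h.e_pos.le
    h.e_le hζ h1 h2 h3 he)).1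
  linarith

/-- Near a contact point the cubic differs little from the one at the contact point. -/
theorem abs_cubic_sub_fold_le {m a b ζ d : ℝ} (hm : |m| ≤ R) (ha : |a - 2 * ζ ^ 3| ≤ d)
    (hb : |b - -3 * ζ ^ 2| ≤ d) : |cubic m a b - (m - ζ) ^ 2 * (m + 2 * ζ)| ≤ (1 + R) * d := by
  have hd : 0 ≤ d := (abs_nonneg _).trans ha
  have hR : 0 ≤ R := (abs_nonneg _).trans hm
  rw [cubic_eq_fold _ _ _ ζ]
  calc _ = |(a - 2 * ζ ^ 3) + m * (b - -3 * ζ ^ 2)| := by congr 1; ring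
    _ ≤ d + R * d := by
      refine (abs_add_le _ _).trans (add_le_add ha ?_)
      rw [abs_mul]
      exact mul_le_mul hm hb (abs_nonneg _) hR
    _ = _ := by ring

/-- The passage of a fold: on `[s, s₁]` the slow variables are within `d` of the fold point. The
trajectory starts within `r` of the fold; after `t₂` the sum `a + ζ b` has grown so much that the
trajectory is pushed away from the fold, and it is on the way down at `t₃` at the latest. -/
theorem IsTraj.fold_land (ht : IsTraj g₁ g₂ g₃ R e T a b z) (hb : IsBounded g₁ g₂ g₃ R L)
    {s t₂ t₃ s₁ ζ r η w d c : ℝ} (hs : 0 ≤ s) (hst : s ≤ t₂) (ht₂ : t₂ ≤ t₃) (ht₃ : t₃ ≤ s₁)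
    (hs₁ : s₁ ≤ T) (hr : 0 < r) (hrζ : r ≤ ζ / 2) (hη : 0 < η) (hηζ : η ≤ ζ)
    (hw : w = r ^ 2 * η / 4) (hd : (1 + R) * d ≤ w) (hc : 0 < c) (hdr : d * r ≤ c)
    (heL : e * L < w) (heLc : e * L ≤ c)
    (he₁ : 2 * r * e ≤ c * (t₃ - t₂)) (he₂ : 3 * ζ * e ≤ w * (s₁ - t₃))
    (hzs : |z s - ζ| ≤ r)
    (hAB : ∀ t ∈ Icc s s₁, |a t - 2 * ζ ^ 3| ≤ d ∧ |b t - -3 * ζ ^ 2| ≤ d)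
    (hgrow : ∀ t ∈ Icc t₂ t₃, (∀ x ∈ Icc s t, |z x - ζ| ≤ r) →
      3 * c ≤ (a t - 2 * ζ ^ 3) + ζ * (b t - -3 * ζ ^ 2)) : |z s₁ + 2 * ζ| ≤ η := by
  have he := ht.e_pos
  have hr2 : 0 < r ^ 2 := by positivity
  have hw0 : 0 < w := by rw [hw]; positivity
  have hwη : 4 * w = r ^ 2 * η := by rw [hw]; ring
  have hwζ : 4 * w ≤ r ^ 2 * ζ := hwη.trans_le (mul_le_mul_of_nonneg_left hηζ hr2.le)
  have hss₁ : s ≤ s₁ := hst.trans (ht₂.trans ht₃)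
  have hbox : ∀ t ∈ Icc s s₁, |z t| ≤ R := fun t hts =>
    (ht.box t ⟨hs.trans hts.1, hts.2.trans hs₁⟩).2.2
  have hcub : ∀ t ∈ Icc s s₁, ∀ m, |m| ≤ R →
      |cubic m (a t) (b t) - (m - ζ) ^ 2 * (m + 2 * ζ)| ≤ w := fun t hts m hm =>
    (abs_cubic_sub_fold_le hm (hAB t hts).1 (hAB t hts).2).trans hd
  -- the levels that the fast variable cannot cross
  have hup : ∀ t ∈ Icc s s₁, z t ≤ ζ + r := by
    refine ht.z_le hb hs hs₁ (by linarith [(abs_le.1 hzs).2]) fun t hts htm => ?_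
    have hts' : t ∈ Icc s s₁ := ⟨hts.1, hts.2.le⟩
    have h1 := (abs_le.1 (hcub t hts' (ζ + r) (htm ▸ hbox t hts'))).1
    have h2 : r ^ 2 * ζ ≤ (ζ + r - ζ) ^ 2 * (ζ + r + 2 * ζ) := by
      rw [add_sub_cancel_left]; exact mul_le_mul_of_nonneg_left (by linarith) hr2.le
    linarith
  have hmid : ∀ t₀ ∈ Icc s s₁, z t₀ ≤ ζ - r → ∀ t ∈ Icc t₀ s₁, z t ≤ ζ - r := by
    intro t₀ ht₀ hzt₀
    refine ht.z_le hb (hs.trans ht₀.1) hs₁ hzt₀ fun t hts htm => ?_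
    have hts' : t ∈ Icc s s₁ := ⟨ht₀.1.trans hts.1, hts.2.le⟩
    have h1 := (abs_le.1 (hcub t hts' (ζ - r) (htm ▸ hbox t hts'))).1
    have h2 : r ^ 2 * ζ ≤ (ζ - r - ζ) ^ 2 * (ζ - r + 2 * ζ) := by
      have : (ζ - r - ζ) ^ 2 = r ^ 2 := by ring
      rw [this]; exact mul_le_mul_of_nonneg_left (by linarith) hr2.le
    linarith
  have hlow : ∀ t ∈ Icc s s₁, -2 * ζ - η ≤ z t := by
    refine ht.le_z hb hs hs₁ (by linarith [(abs_le.1 hzs).1]) fun t hts htm => ?_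
    have hts' : t ∈ Icc s s₁ := ⟨hts.1, hts.2.le⟩
    have h1 := (abs_le.1 (hcub t hts' (-2 * ζ - η) (htm ▸ hbox t hts'))).2
    have h2 : (-2 * ζ - η - ζ) ^ 2 * (-2 * ζ - η + 2 * ζ) = -((3 * ζ + η) ^ 2 * η) := by ring
    have h3 : 4 * w ≤ (3 * ζ + η) ^ 2 * η := by
      have : r ^ 2 ≤ (3 * ζ + η) ^ 2 := pow_le_pow_left₀ hr.le (by linarith) 2
      exact hwη.trans_le (mul_le_mul_of_nonneg_right this hη.le)
    linarith
  -- the trajectory leaves the neighbourhood of the fold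
  have hexit : ∃ t ∈ Icc s t₃, z t ≤ ζ - r := by
    by_contra! hstay
    have h1 : z t₃ ≤ ζ - r := by
      refine ht.z_exit hb (hs.trans hst) ht₂ (ht₃.trans hs₁) hc (fun t hts _ => ?_) ?_
      · have htI : t ∈ Icc s s₁ := ⟨hst.trans hts.1, hts.2.le.trans ht₃⟩
        have hnear : ∀ x ∈ Icc s t, |z x - ζ| ≤ r := fun x hx => by
          have h1 := hstay x ⟨hx.1, hx.2.trans hts.2.le⟩
          have h2 := hup x ⟨hx.1, hx.2.trans htI.2⟩
          rw [abs_le]; constructor <;> linarith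
        have h6 := hgrow t ⟨hts.1, hts.2.le⟩ hnear
        have hzt := hnear t ⟨htI.1, le_rfl⟩
        have h7 : |(b t - -3 * ζ ^ 2) * (z t - ζ)| ≤ c := by
          rw [abs_mul]
          exact (mul_le_mul (hAB t htI).2 hzt (abs_nonneg _)
            ((abs_nonneg _).trans (hAB t htI).2)).trans hdr
        have h9 : 0 ≤ (z t - ζ) ^ 2 * (z t + 2 * ζ) :=
          mul_nonneg (sq_nonneg _) (by linarith [(abs_le.1 hzt).1])
        rw [cubic_eq_fold _ _ _ ζ]
        have := (abs_le.1 h7).1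
        linarith
      · have h2 := hup t₂ ⟨hst, ht₂.trans ht₃⟩
        have h3 : 2 * r ≤ c / e * (t₃ - t₂) := by
          rw [div_mul_eq_mul_div, le_div_iff₀ he]
          exact he₁
        linarith
    exact absurd h1 (not_le.2 (hstay _ ⟨hst.trans ht₂, le_rfl⟩))
  obtain ⟨t₀, ht₀, hzt₀⟩ := hexit
  have hafter := hmid t₀ ⟨ht₀.1, ht₀.2.trans ht₃⟩ hzt₀
  -- and comes down to the other sheet
  have hland : z s₁ ≤ -2 * ζ + η := by
    refine ht.z_exit hb (hs.trans (hst.trans ht₂)) ht₃ hs₁ hw0 (fun t hts hm => ?_) ?_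
    · have hts' : t ∈ Icc s s₁ := ⟨(hst.trans ht₂).trans hts.1, hts.2.le⟩
      have h1 := (abs_le.1 (hcub t hts' (z t) (hbox t hts'))).1
      have h2 := hafter t ⟨ht₀.2.trans hts.1, hts.2.le⟩
      have h3 : r ^ 2 * η ≤ (z t - ζ) ^ 2 * (z t + 2 * ζ) := by
        refine mul_le_mul ?_ (by linarith) hη.le (sq_nonneg _)
        rw [← sq_abs (z t - ζ), abs_sub_comm]
        exact pow_le_pow_left₀ hr.le (le_trans (by linarith) (le_abs_self _)) 2
      linarith
    · have h2 := hafter t₃ ⟨ht₀.2, ht₃⟩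
      have h3 : 3 * ζ ≤ w / e * (s₁ - t₃) := by
        rw [div_mul_eq_mul_div, le_div_iff₀ he]
        exact he₂
      linarith
  have := hlow s₁ ⟨hss₁, le_rfl⟩
  rw [abs_le]; constructor <;> linarith

theorem tendsto_sub_nhdsLT (tc : ℝ) : Tendsto (fun δ : ℝ => tc - δ) (𝓝[>] 0) (𝓝[<] tc) := by
  refine tendsto_nhdsWithin_iff.2 ⟨?_, ?_⟩
  · have : Tendsto (fun δ : ℝ => tc - δ) (𝓝[>] 0) (𝓝 (tc - 0)) :=
      Tendsto.mono_left (Continuous.tendsto (by fun_prop) 0) nhdsWithin_le_nhds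
    simpa using this
  · filter_upwards [self_mem_nhdsWithin] with δ hδ
    simpa using hδ

theorem IsContact.eventually_Z_near {s₀ tc u₁ ζ r : ℝ} (h : IsContact g₁ g₂ R s₀ tc u₁ A B Z ζ)
    (hr : 0 < r) : ∀ᶠ δ in 𝓝[>] (0 : ℝ), |Z (tc - δ) - ζ| < r := by
  have e1 := (h.left.sub_const ζ).abs
  simp only [sub_self, abs_zero] at e1
  exact (tendsto_sub_nhdsLT tc).eventually (e1.eventually_lt_const hr)

/-- In a window around the contact time, trajectories that are `δ`-close to the slow orbit at
the beginning have slow variables near those of the contact point. -/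
theorem IsContact.traj_near {s₀ tc u₁ ζ δ ρ : ℝ} (h : IsContact g₁ g₂ R s₀ tc u₁ A B Z ζ)
    (hb : IsBounded g₁ g₂ g₃ R L) (ht : IsTraj g₁ g₂ g₃ R e T a b z) (hδ : 0 < δ)
    (hδs : δ < tc - s₀) (hρ : ρ ≤ δ) (hclose : Close a b z A B Z ρ (tc - δ)) :
    ∀ t, tc - δ ≤ t → t ≤ T → |a t - A tc| ≤ (1 + L) * δ + L * (t - (tc - δ)) ∧
      |b t - B tc| ≤ (1 + L) * δ + L * (t - (tc - δ)) := by
  have hsI : tc - δ ∈ Icc s₀ u₁ := ⟨by linarith, by linarith [h.tc_lt]⟩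
  have hdr := h.drift hb hsI
  rw [sub_sub_cancel_left, abs_neg, abs_of_pos hδ] at hdr
  intro t hts htT
  have h1 := ht.drift hb (h.nonneg.trans hsI.1) hts htT
  constructor
  · linarith [abs_sub_le (a t) (a (tc - δ)) (A tc), abs_sub_le (a (tc - δ)) (A (tc - δ)) (A tc),
      hclose.1]
  · linarith [abs_sub_le (b t) (b (tc - δ)) (B tc), abs_sub_le (b (tc - δ)) (B (tc - δ)) (B tc),
      hclose.2.1]

set_option maxHeartbeats 400000 in
/-- The passage of a fold with `ζ > 0` up to the landing near `z = -2ζ`. -/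
theorem IsContact.fold_window {s₀ tc u₁ ζ : ℝ} (h : IsContact g₁ g₂ R s₀ tc u₁ A B Z ζ)
    (hb : IsBounded g₁ g₂ g₃ R L) (hζ : 0 < ζ) {η : ℝ} (hη : 0 < η) :
    ∃ s ∈ Ioo s₀ tc, tc - s < η ∧ ∃ s₁ ∈ Ioo tc u₁, s₁ - tc < η ∧ ∃ ρ > 0, ∀ (e T : ℝ)
      (a b z : ℝ → ℝ),
      IsTraj g₁ g₂ g₃ R e T a b z → e ≤ ρ → s ≤ T → Close a b z A B Z ρ s →
      (∀ t ∈ Icc s s₁, t ≤ T → |a t - A tc| ≤ η ∧ |b t - B tc| ≤ η) ∧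
      (s₁ ≤ T → |z s₁ + 2 * ζ| ≤ η) := by
  have hL := hb.one_le_L
  have hR := hb.one_le_R
  obtain ⟨k, hk⟩ : ∃ k, k = g₁ (A tc, B tc, ζ, 0) + ζ * g₂ (A tc, B tc, ζ, 0) := ⟨_, rfl⟩
  have hk0 : 0 < k := hk ▸ h.speed_pos hb hζ
  obtain ⟨κ, hκ0, hκk⟩ : ∃ κ : ℝ, 0 < κ ∧ L * (1 + ζ) * (4 * κ) ≤ k / 2 :=
    ⟨k / (8 * L * (1 + ζ)), by positivity, le_of_eq (by field_simp; norm_num)⟩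
  -- at the start of the window of half-width `δ`, `a + ζ b` is at most `3 c δ` below its fold value;
  -- at the speed `k / 2` it is `3 c δ` above that value after the time `M δ`
  obtain ⟨c, hc0, hc⟩ : ∃ c : ℝ, 0 < c ∧ (1 + ζ) * (1 + L) = 3 * c :=
    ⟨(1 + ζ) * (1 + L) / 3, by positivity, by ring⟩
  obtain ⟨M, hM0, hMk⟩ : ∃ M : ℝ, 0 < M ∧ k / 2 * M = 6 * c :=
    ⟨12 * c / k, by positivity, by field_simp; norm_num⟩
  -- in the window the slow variables are within `C₂ δ` of the fold point
  obtain ⟨C₂, hC₂0, hC₂⟩ : ∃ C₂ : ℝ, 0 < C₂ ∧ (1 + L) * (M + 4) = C₂ :=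
    ⟨_, by positivity, rfl⟩
  obtain ⟨r, hr0, hrκ, hrζ, hrC⟩ : ∃ r : ℝ, 0 < r ∧ r ≤ κ ∧ r ≤ ζ / 2 ∧ C₂ * r ≤ c := by
    refine ⟨min κ (min (ζ / 2) (c / C₂)), by positivity, min_le_left _ _,
      (min_le_right _ _).trans (min_le_left _ _), ?_⟩
    rw [mul_comm, ← le_div_iff₀ hC₂0]
    exact (min_le_right _ _).trans (min_le_right _ _)
  obtain ⟨η', hη'0, hη'η, hη'ζ⟩ : ∃ η' : ℝ, 0 < η' ∧ η' ≤ η ∧ η' ≤ ζ :=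
    ⟨min η ζ, lt_min hη hζ, min_le_left _ _, min_le_right _ _⟩
  obtain ⟨w, hw0, hw⟩ : ∃ w : ℝ, 0 < w ∧ w = r ^ 2 * η' / 4 := ⟨_, by positivity, rfl⟩
  -- the half-width `δ` of the window
  obtain ⟨δ, ⟨hδZ, hδs, hδη⟩, ⟨hδM, hδMη, hδκ⟩, hδη', hδw, hδ0⟩ :=
    (((h.eventually_Z_near (half_pos hr0)).and ((eventually_lt_of_pos (sub_pos.2 h.lt_tc)).and
      (eventually_lt_of_pos hη))).and
      (((eventually_mul_lt (M + 2) (sub_pos.2 h.tc_lt)).and ((eventually_mul_lt (M + 2) hη).and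
        (eventually_mul_lt C₂ hκ0))).and ((eventually_mul_lt C₂ hη).and
        ((eventually_mul_lt ((1 + R) * C₂) hw0).and self_mem_nhdsWithin)))).exists
  have hδ0 : 0 < δ := hδ0
  have hMδ : 0 < M * δ := by positivity
  -- for `e ≤ ρ` the fast motions take less time than `δ`
  obtain ⟨ρ, ⟨hρδ, hρκ, hρr⟩, ⟨hρw, hρC⟩, hρe1, hρe2, hρ0⟩ :=
    (((eventually_lt_of_pos hδ0).and ((eventually_lt_of_pos hκ0).and
      (eventually_lt_of_pos (half_pos hr0)))).and
      (((eventually_mul_lt L hw0).and (eventually_mul_lt L (show 0 < c * δ by positivity))).and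
      ((eventually_mul_lt (2 * r) (show 0 < c * δ * δ by positivity)).and
      ((eventually_mul_lt (3 * ζ) (show 0 < w * δ by positivity)).and
        self_mem_nhdsWithin)))).exists
  have hρ0 : 0 < ρ := hρ0
  refine ⟨tc - δ, ⟨by linarith, by linarith⟩, by linarith, tc + (M + 2) * δ,
    ⟨by linarith, by linarith⟩, by linarith, ρ, hρ0, fun e T a b z ht heρ hsT hclose => ?_⟩
  have hs0 : 0 ≤ tc - δ := by linarith [h.nonneg]
  have he := ht.e_pos
  have hnear := h.traj_near hb ht hδ0 hδs hρδ.le hclose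
  have hs := hnear (tc - δ) le_rfl hsT
  rw [sub_self, mul_zero, add_zero] at hs
  have hAB : ∀ t ∈ Icc (tc - δ) (tc + (M + 2) * δ), t ≤ T →
      |a t - A tc| ≤ C₂ * δ ∧ |b t - B tc| ≤ C₂ * δ := by
    intro t hts htT
    have h1 := hnear t hts.1 htT
    have h2 : L * (t - (tc - δ)) ≤ L * ((M + 3) * δ) :=
      mul_le_mul_of_nonneg_left (by linarith [hts.2]) (by linarith)
    have h3 : (1 + L) * δ + L * ((M + 3) * δ) ≤ C₂ * δ := by
      have : C₂ * δ = (1 + L) * δ + L * ((M + 3) * δ) + (M + 3) * δ := by rw [← hC₂]; ring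
      have : 0 < (M + 3) * δ := by positivity
      linarith
    exact ⟨by linarith, by linarith⟩
  refine ⟨fun t hts htT => ⟨(hAB t hts htT).1.trans hδη'.le, (hAB t hts htT).2.trans hδη'.le⟩,
    fun hs₁T => ?_⟩
  have heL : e * L ≤ L * ρ := by
    rw [mul_comm]; exact mul_le_mul_of_nonneg_left heρ (by linarith)
  refine (ht.fold_land hb (s := tc - δ) (t₂ := tc + M * δ) (t₃ := tc + (M + 1) * δ) (r := r)
    (d := C₂ * δ) (c := c * δ) (w := w) hs0 (by linarith) (by linarith) (by linarith) hs₁T hr0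
    hrζ hη'0 hη'ζ hw ?_ (by positivity) ?_ (by linarith) (by linarith) ?_ ?_ ?_ ?_ ?_).trans hη'η
  · linarith
  · rw [mul_right_comm]; exact mul_le_mul_of_nonneg_right hrC hδ0.le
  · have h1 : tc + (M + 1) * δ - (tc + M * δ) = δ := by ring
    rw [h1]
    exact (mul_le_mul_of_nonneg_left heρ (by positivity)).trans hρe1.le
  · have h1 : tc + (M + 2) * δ - (tc + (M + 1) * δ) = δ := by ring
    rw [h1]
    exact (mul_le_mul_of_nonneg_left heρ (by positivity)).trans hρe2.le
  · linarith [abs_sub_le (z (tc - δ)) (Z (tc - δ)) ζ, hclose.2.2]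
  · intro t hts
    rw [← h.A_tc, ← h.B_tc]
    exact hAB t hts (hts.2.trans hs₁T)
  · intro t hts hzt
    rw [← h.A_tc, ← h.B_tc]
    have htI : t ≤ tc + (M + 2) * δ := by linarith [hts.2]
    have h2 := ht.le_comb hb (s := tc - δ) (t := t) h.box_tc hζ.le hk.le hκk
      (heρ.trans hρκ.le) hs0 (by linarith [hts.1]) (htI.trans hs₁T) (fun x hx => by
        have hx2 := hAB x ⟨hx.1, hx.2.le.trans htI⟩ ((hx.2.le.trans htI).trans hs₁T)
        exact ⟨hx2.1.trans hδκ.le, hx2.2.trans hδκ.le, (hzt x ⟨hx.1, hx.2.le⟩).trans hrκ⟩)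
    have h3 := (abs_le.1 hs.1).1
    have h4 := mul_le_mul_of_nonneg_left (abs_le.1 hs.2).1 hζ.le
    have h5 : k / 2 * (M * δ) ≤ k / 2 * (t - (tc - δ)) :=
      mul_le_mul_of_nonneg_left (by linarith [hts.1]) (by linarith)
    have h6 : k / 2 * (M * δ) = 6 * (c * δ) := by rw [← mul_assoc, hMk]; ring
    have h7 : (1 + L) * δ + ζ * ((1 + L) * δ) = 3 * (c * δ) := by
      rw [← mul_assoc 3 c δ, ← hc]; ring
    linarith

/-- Trajectories that start close to the slow orbit before the contact time `tc` stay close to it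
(in the slow variables) up to the time `u > tc`, and are close to it at `u`. -/
def Passes (g₁ g₂ g₃ : ℝ × ℝ × ℝ × ℝ → ℝ) (R s₀ tc u : ℝ) (A B Z : ℝ → ℝ) : Prop :=
  ∀ η > 0, ∃ s ∈ Ioo s₀ tc, ∃ ρ > 0, ∀ (e T : ℝ) (a b z : ℝ → ℝ),
    IsTraj g₁ g₂ g₃ R e T a b z → e ≤ ρ → s ≤ T → Close a b z A B Z ρ s →
    (∀ t ∈ Icc s u, t ≤ T → |a t - A t| ≤ η ∧ |b t - B t| ≤ η) ∧ (u ≤ T → |z u - Z u| ≤ η)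

/-- After the landing near `z = -2ζ ≠ 0` the orbit is uniformly attracting. -/
theorem IsContact.passes_of_fold {s₀ tc u₁ ζ : ℝ} (h : IsContact g₁ g₂ R s₀ tc u₁ A B Z ζ)
    (hb : IsBounded g₁ g₂ g₃ R L) (hζ : 0 < ζ) {u : ℝ} (hu : u ∈ Ioo tc u₁) :
    Passes g₁ g₂ g₃ R s₀ tc u A B Z := by
  have hL := hb.one_le_L
  -- a lower bound for the rate on `(tc, u]`, where it tends to `9 ζ²` at `tc`
  obtain ⟨c, hc0, hc⟩ : ∃ c > 0, ∀ t ∈ Ioc tc u, c ≤ 3 * Z t ^ 2 + B t := by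
    have hcontB : ContinuousWithinAt B (Ici tc) tc :=
      (h.contB tc ⟨h.lt_tc.le, h.tc_lt.le⟩).mono_of_mem_nhdsWithin
        (mem_nhdsWithin_of_mem_nhds (Icc_mem_nhds h.lt_tc h.tc_lt))
    have h1 : Tendsto (fun t => 3 * Z t ^ 2 + B t) (𝓝[>] tc) (𝓝 (3 * (-2 * ζ) ^ 2 + B tc)) :=
      ((h.right.pow 2).const_mul 3).add (hcontB.mono Ioi_subset_Ici_self)
    have h2 : 0 < 3 * (-2 * ζ) ^ 2 + B tc := by rw [h.B_tc]; nlinarith [sq_pos_of_pos hζ]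
    obtain ⟨v, hv, hvt⟩ := (mem_nhdsGT_iff_exists_Ioo_subset' h.tc_lt).1
      (h1.eventually_const_lt (half_lt_self h2))
    obtain ⟨v', hv', hv'v⟩ : ∃ v', tc < v' ∧ v' < v := exists_between hv
    have h3 : ContinuousOn (fun t => 3 * Z t ^ 2 + B t) (Icc v' u) := by
      have e1 : ContinuousOn Z (Icc v' u) :=
        h.contZ.mono fun t ht => ⟨hv'.trans_le ht.1, ht.2.trans hu.2.le⟩
      have e2 : ContinuousOn B (Icc v' u) :=
        h.contB.mono (Icc_subset_Icc (h.lt_tc.trans hv').le hu.2.le)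
      fun_prop
    rcases (Icc v' u).eq_empty_or_nonempty with hem | hne
    · refine ⟨_, half_pos h2, fun t ht => ?_⟩
      refine (hvt ⟨ht.1, ?_⟩).le
      by_contra! hlt
      exact absurd hem (Set.Nonempty.ne_empty ⟨t, by linarith, ht.2⟩)
    · obtain ⟨m, hm, hmin⟩ := isCompact_Icc.exists_isMinOn hne h3
      have hmpos : 0 < 3 * Z m ^ 2 + B m :=
        h.attr m ⟨(h.lt_tc.trans hv').le.trans hm.1, hm.2.trans hu.2.le⟩ (hv'.trans_le hm.1).ne'
      refine ⟨min _ _, lt_min (half_pos h2) hmpos, fun t ht => ?_⟩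
      rcases lt_or_ge t v with hlt | hge
      · exact (min_le_left _ _).trans (hvt ⟨ht.1, hlt⟩).le
      · exact (min_le_right _ _).trans (hmin ⟨(hv'v.trans_le hge).le, ht.2⟩)
  intro η hη
  obtain ⟨ρ₁, hρ₁, htrack⟩ := hb.exists_track hc0 (u - tc) hη
  obtain ⟨η₁, hη₁0, hη₁⟩ : ∃ η₁ : ℝ, 0 < η₁ ∧ (1 + L) * η₁ ≤ min ρ₁ η :=
    ⟨min ρ₁ η / (1 + L), by positivity, le_of_eq (by field_simp)⟩
  -- shrink the window so that the slow orbit itself moves little in it and has landed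
  have hright : ∀ᶠ t in 𝓝[>] tc, |Z t - -2 * ζ| < η₁ := by
    have e1 := (h.right.sub_const (-2 * ζ)).abs
    simp only [sub_self, abs_zero] at e1
    exact e1.eventually_lt_const hη₁0
  obtain ⟨v, hv, hvZ⟩ := (mem_nhdsGT_iff_exists_Ioo_subset' h.tc_lt).1 hright
  obtain ⟨η₂, hη₂0, hη₂1, hη₂v, hη₂u, hη₂3⟩ : ∃ η₂ : ℝ, 0 < η₂ ∧ η₂ ≤ η₁ ∧ η₂ ≤ v - tc ∧
      η₂ ≤ u - tc ∧ η₂ + η₁ ≤ ρ₁ := by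
    have h1 : 2 * η₁ ≤ (1 + L) * η₁ := mul_le_mul_of_nonneg_right (by linarith) hη₁0.le
    exact ⟨min η₁ (min (v - tc) (u - tc)),
      lt_min hη₁0 (lt_min (sub_pos.2 hv) (sub_pos.2 hu.1)), min_le_left _ _,
      (min_le_right _ _).trans (min_le_left _ _), (min_le_right _ _).trans (min_le_right _ _), by
      linarith [min_le_left η₁ (min (v - tc) (u - tc)), min_le_left ρ₁ η]⟩
  obtain ⟨s, hs, hsη, s₁, hs₁, hs₁η, ρ₂, hρ₂, hwin⟩ := h.fold_window hb hζ hη₂0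
  refine ⟨s, hs, min ρ₁ ρ₂, lt_min hρ₁ hρ₂, fun e T a b z ht heρ hsT hclose => ?_⟩
  have hclose₂ : Close a b z A B Z ρ₂ s :=
    ⟨hclose.1.trans (min_le_right _ _), hclose.2.1.trans (min_le_right _ _),
      hclose.2.2.trans (min_le_right _ _)⟩
  obtain ⟨hw1, hw2⟩ := hwin e T a b z ht (heρ.trans (min_le_right _ _)) hsT hclose₂
  have hs₁u : s₁ ≤ u := by linarith
  have hAB : ∀ t ∈ Icc s s₁, t ≤ T →
      |a t - A t| ≤ min ρ₁ η ∧ |b t - B t| ≤ min ρ₁ η := by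
    intro t hts htT
    have h1 := hw1 t hts htT
    have h2 := h.drift hb (t := t) ⟨hs.1.le.trans hts.1, hts.2.trans hs₁.2.le⟩
    have h3 : L * |t - tc| ≤ L * η₁ :=
      mul_le_mul_of_nonneg_left (by rw [abs_le]; constructor <;> linarith [hts.1, hts.2])
        (by linarith)
    have e1 := abs_sub_le (a t) (A tc) (A t)
    have e2 := abs_sub_le (b t) (B tc) (B t)
    rw [abs_sub_comm (A tc)] at e1
    rw [abs_sub_comm (B tc)] at e2
    exact ⟨by linarith, by linarith⟩
  have hland : s₁ ≤ T → ∀ t ∈ Icc s₁ u, t ≤ T → Close a b z A B Z η t := by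
    intro hs₁T
    refine htrack A B Z s₁ u (h.nonneg.trans (h.lt_tc.trans hs₁.1).le) (by linarith [hs₁.1])
      (h.isSlow hs₁.1 hu.2.le) (h.contZ.mono fun t ht => ⟨hs₁.1.trans_le ht.1, ht.2.trans hu.2.le⟩)
      (fun t ht => hc t ⟨hs₁.1.trans_le ht.1, ht.2⟩) e T a b z ht
      (heρ.trans (min_le_left _ _)) hs₁T ?_
    obtain ⟨h1, h2⟩ := hAB s₁ ⟨(hs.2.trans hs₁.1).le, le_rfl⟩ hs₁T
    refine ⟨h1.trans (min_le_left _ _), h2.trans (min_le_left _ _), ?_⟩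
    have h3 := hw2 hs₁T
    have h4 : |Z s₁ - -2 * ζ| < η₁ := hvZ ⟨hs₁.1, by linarith⟩
    have h5 := abs_sub_le (z s₁) (-2 * ζ) (Z s₁)
    rw [abs_sub_comm (-2 * ζ)] at h5
    have h6 : z s₁ - -2 * ζ = z s₁ + 2 * ζ := by ring
    rw [h6] at h5
    linarith
  refine ⟨fun t hts htT => ?_, fun huT => (hland (hs₁u.trans huT) u ⟨hs₁u, le_rfl⟩ huT).2.2⟩
  rcases le_total t s₁ with hle | hle
  · obtain ⟨h1, h2⟩ := hAB t ⟨hts.1, hle⟩ htT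
    exact ⟨h1.trans (min_le_right _ _), h2.trans (min_le_right _ _)⟩
  · have := hland (hle.trans htT) t ⟨hle, hts.2⟩ htT
    exact ⟨this.1, this.2.1⟩

/-! ### Passage of the cusp -/

/-- Real cube roots, with their derivative. -/
theorem exists_cube_root : ∃ v : ℝ → ℝ, (∀ x > 0, 0 < v x ∧ v x ^ 3 = x ∧
    HasDerivAt v (1 / (3 * v x ^ 2)) x) := by
  refine ⟨fun x => x ^ (1 / 3 : ℝ), fun x hx => ⟨Real.rpow_pos_of_pos hx _, ?_, ?_⟩⟩
  · rw [← Real.rpow_natCast, ← Real.rpow_mul hx.le]; norm_num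
  · have h1 := Real.hasDerivAt_rpow_const (p := 1 / 3) (Or.inl hx.ne')
    refine h1.congr_deriv ?_
    have h2 : (x ^ (1 / 3 : ℝ)) ^ 2 = x ^ (2 / 3 : ℝ) := by
      rw [← Real.rpow_natCast, ← Real.rpow_mul hx.le]; norm_num
    rw [h2, show (1 / 3 - 1 : ℝ) = -(2 / 3) by norm_num, Real.rpow_neg hx.le]
    field_simp

/-- Once `a` has grown, the cubic is positive above the level `-c v`, where `v` is about the cube
root of the time `τ` since the cusp. -/
theorem cubic_pos_of_cusp {z a b k C c κ τ v : ℝ} (hτ : 0 ≤ τ) (hC : C * κ ≤ k / 32)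
    (hc0 : 0 ≤ c) (hc : 2 * c ^ 3 ≤ k / 32) (hv : v ^ 3 ≤ 2 * τ)
    (ha : k / 4 * τ ≤ a) (hb : |b| ≤ C * τ) (hz : |z| ≤ κ) (hzv : -(c * v) ≤ z) :
    k / 8 * τ ≤ cubic z a b := by
  have h1 : -(k / 32 * τ) ≤ z ^ 3 := by
    have h2 : (-(c * v)) ^ 3 ≤ z ^ 3 := (Odd.strictMono_pow (by decide)).monotone hzv
    have h3 : (-(c * v)) ^ 3 = -(c ^ 3 * v ^ 3) := by ring
    have h4 : c ^ 3 * v ^ 3 ≤ c ^ 3 * (2 * τ) := mul_le_mul_of_nonneg_left hv (by positivity)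
    have h5 : 2 * c ^ 3 * τ ≤ k / 32 * τ := mul_le_mul_of_nonneg_right hc hτ
    linarith
  have h2 : |b * z| ≤ k / 32 * τ := by
    rw [abs_mul]
    calc |b| * |z| ≤ C * τ * κ := mul_le_mul hb hz (abs_nonneg _) ((abs_nonneg _).trans hb)
      _ = C * κ * τ := by ring
      _ ≤ _ := mul_le_mul_of_nonneg_right hC hτ
  have h3 := (abs_le.1 h2).1
  have h4 : 0 ≤ k * τ := by
    have : 0 ≤ k := by
      have : 0 ≤ 2 * c ^ 3 := by positivity
      linarith
    positivity
  unfold cubic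
  linarith

/-- The defect `z³ + b z + a` decays to the level `p` if `3z² + b ≥ c` for long enough. -/
theorem IsTraj.abs_cubic_exit (h : IsTraj g₁ g₂ g₃ R e T a b z) (hb : IsBounded g₁ g₂ g₃ R L)
    {s u c p : ℝ} (hs : 0 ≤ s) (hsu : s ≤ u) (hu : u ≤ T) (hc : 0 < c) (hp : 0 < p)
    (hl : ∀ t ∈ Ico s u, c ≤ 3 * z t ^ 2 + b t)
    (hpL : e * L ≤ p / 2) (hpc : e * ((R + 1) * L) ≤ c * p / 4)
    (hlong : 12 * R ^ 3 * e ≤ c * p * (u - s)) : |cubic (z u) (a u) (b u)| ≤ p := by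
  have he := h.e_pos
  have hR := hb.one_le_R
  have hL := hb.one_le_L
  have hcont := h.contCubic.mono (Icc_subset_Icc hs hu)
  have hbound : |cubic (z s) (a s) (b s)| ≤ 3 * R ^ 3 := by
    obtain ⟨h1, h2, h3⟩ := h.box s ⟨hs, hsu.trans hu⟩
    have e1 : |z s ^ 3| ≤ R ^ 3 := by rw [abs_pow]; gcongr
    have e2 : |b s * z s| ≤ R * R := by
      rw [abs_mul]; exact mul_le_mul h2 h3 (abs_nonneg _) (by linarith)
    have e3 : R * R ≤ R ^ 3 := by nlinarith
    have e4 : R ≤ R ^ 3 := by nlinarith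
    unfold cubic
    linarith [abs_add_le (z s ^ 3 + b s * z s) (a s), abs_add_le (z s ^ 3) (b s * z s)]
  have hlong' : 3 * R ^ 3 ≤ c * p / (4 * e) * (u - s) := by
    rw [div_mul_eq_mul_div, le_div_iff₀ (by positivity)]
    linarith
  have hrate : (R + 1) * L ≤ c * p / (4 * e) := by
    rw [le_div_iff₀ (by positivity)]; linarith
  -- at distance at least `p` from zero the defect moves towards zero at this speed
  have key : ∀ t ∈ Ico s u, |z t * g₂ (a t, b t, z t, e) + g₁ (a t, b t, z t, e)| ≤ (R + 1) * L ∧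
      (∀ q, p ≤ q →
        c * p / (2 * e) ≤ (3 * z t ^ 2 + b t) * (q + e * g₃ (a t, b t, z t, e)) / e ∧
        c * p / (2 * e) ≤ (3 * z t ^ 2 + b t) * (q - e * g₃ (a t, b t, z t, e)) / e) := by
    intro t ht
    have hbox := h.box t ⟨hs.trans ht.1, ht.2.le.trans hu⟩
    have h1 := hb.bound₁ _ _ _ _ hbox he.le h.e_le
    have h2 := hb.bound₂ _ _ _ _ hbox he.le h.e_le
    have h3 := abs_le.1 (hb.bound₃ _ _ _ _ hbox he.le h.e_le)
    refine ⟨?_, fun q hq => ?_⟩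
    · calc _ ≤ |z t * g₂ (a t, b t, z t, e)| + |g₁ (a t, b t, z t, e)| := abs_add_le _ _
        _ ≤ R * L + L := by
          rw [abs_mul]
          exact add_le_add (mul_le_mul hbox.2.2 h2 (abs_nonneg _) (by linarith)) h1
        _ = _ := by ring
    · have e1 : c * p / (2 * e) = c * (p / 2) / e := by field_simp
      have e2 : p / 2 ≤ q + e * g₃ (a t, b t, z t, e) := by nlinarith
      have e3 : p / 2 ≤ q - e * g₃ (a t, b t, z t, e) := by nlinarith
      rw [e1]
      constructor <;> refine div_le_div_of_nonneg_right (mul_le_mul (hl t ht) ?_ ?_ ?_) he.le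
      · exact e2
      · positivity
      · linarith [hl t ht]
      · exact e3
      · positivity
      · linarith [hl t ht]
  have hsplit : c * p / (2 * e) = c * p / (4 * e) + c * p / (4 * e) := by field_simp; norm_num
  have hpos : 0 < c * p / (4 * e) := by positivity
  rw [abs_le]
  constructor
  · have := le_of_exit (f := fun t => -cubic (z t) (a t) (b t)) hsu hpos hcont.neg
      (fun t ht => (h.dcubic ⟨hs.trans ht.1, ht.2.trans_le hu⟩).neg) (m := p)
      (fun t ht hpt => by
        obtain ⟨k1, k2⟩ := key t ht
        have k3 := (k2 _ hpt).2
        have k4 : (3 * z t ^ 2 + b t) * (-cubic (z t) (a t) (b t) - e * g₃ (a t, b t, z t, e)) / e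
          = -((3 * z t ^ 2 + b t) * (cubic (z t) (a t) (b t) + e * g₃ (a t, b t, z t, e))) / e := by
          ring
        rw [k4] at k3
        linarith [(abs_le.1 k1).1])
      (by linarith [(abs_le.1 hbound).1])
    linarith
  · refine le_of_exit (f := fun t => cubic (z t) (a t) (b t)) hsu hpos hcont
      (fun t ht => h.dcubic ⟨hs.trans ht.1, ht.2.trans_le hu⟩) (m := p)
      (fun t ht hpt => ?_) (by linarith [(abs_le.1 hbound).2])
    obtain ⟨k1, k2⟩ := key t ht
    have k3 := (k2 _ hpt).1
    have k4 : -((3 * z t ^ 2 + b t) * (cubic (z t) (a t) (b t) + e * g₃ (a t, b t, z t, e))) / e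
      = -((3 * z t ^ 2 + b t) * (cubic (z t) (a t) (b t) + e * g₃ (a t, b t, z t, e)) / e) := by
      ring
    rw [k4]
    linarith [(abs_le.1 k1).2]

/-- The descent of the fast variable after the cusp: `a` grows at least linearly in the time since
the cusp, and `z` is below a negative multiple of the cube root `v` of that time from `t₃` on. -/
theorem IsTraj.cusp_descend (ht : IsTraj g₁ g₂ g₃ R e T a b z) (hb : IsBounded g₁ g₂ g₃ R L)
    {s tc t₂ t₃ u k C c κ d α p : ℝ} {v : ℝ → ℝ}
    (hv : ∀ x > 0, 0 < v x ∧ v x ^ 3 = x ∧ HasDerivAt v (1 / (3 * v x ^ 2)) x)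
    (hs : 0 ≤ s) (hst : s ≤ t₂) (htc : tc < t₂) (ht₂ : t₂ ≤ t₃) (ht₃ : t₃ ≤ u) (hu : u ≤ T)
    (hk : k ≤ g₁ (0, 0, 0, 0)) (hκ : L * (4 * κ) ≤ k / 2) (heκ : e ≤ κ) (hκR : κ ≤ R)
    (hC : C * κ ≤ k / 32) (hc0 : 0 < c) (hc : 2 * c ^ 3 ≤ k / 32)
    (hd : ∀ t ∈ Icc s u, |a t| ≤ d ∧ |b t| ≤ d) (hdκ : d ≤ κ) (hdL : (1 + κ) * d + e * L < κ ^ 3)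
    (hzs : |z s| ≤ κ) (has : -α ≤ a s)
    (hα : ∀ t ∈ Icc t₂ u, k / 4 * (t - tc) ≤ -α + k / 2 * (t - s))
    (hbτ : ∀ t ∈ Icc t₂ u, |b t| ≤ C * (t - tc))
    (hCv : ∀ t ∈ Icc t₃ u, C * v (t - tc) ≤ c ^ 2)
    (hp : p = k / 16 * (t₂ - tc)) (ht₃' : t₃ - tc ≤ 2 * (t₂ - tc)) (hpL : e * L ≤ p)
    (hlong : (κ + c * v (t₃ - tc)) * e ≤ p * (t₃ - t₂)) (hmove : c * e < 3 * p * v (t₃ - tc) ^ 2) :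
    ∀ t ∈ Icc t₃ u, z t ≤ -(c * v (t - tc)) ∧
      2 * c ^ 2 * v (t - tc) ^ 2 ≤ 3 * z t ^ 2 + b t := by
  have he := ht.e_pos
  have hL := hb.one_le_L
  have hκ0 : 0 < κ := he.trans_le heκ
  have hsu : s ≤ u := hst.trans (ht₂.trans ht₃)
  have hk0 : 0 < k := by
    have : 0 < 2 * c ^ 3 := by positivity
    linarith
  have hp0 : 0 < p := by
    have : 0 < t₂ - tc := sub_pos.2 htc
    rw [hp]; positivity
  have hz : ∀ t ∈ Icc s u, |z t| ≤ κ := by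
    intro t hts
    rw [abs_le]
    constructor
    · refine ht.le_z hb hs hu (abs_le.1 hzs).1 (fun x hx _ => ?_) t hts
      obtain ⟨h1, h2⟩ := hd x ⟨hx.1, hx.2.le⟩
      have h3 : -κ * b x ≤ κ * d := by nlinarith [(abs_le.1 h2).1]
      unfold cubic
      nlinarith [(abs_le.1 h1).2]
    · refine ht.z_le hb hs hu (abs_le.1 hzs).2 (fun x hx _ => ?_) t hts
      obtain ⟨h1, h2⟩ := hd x ⟨hx.1, hx.2.le⟩
      have h3 : -(κ * d) ≤ κ * b x := by nlinarith [(abs_le.1 h2).1]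
      unfold cubic
      nlinarith [(abs_le.1 h1).1]
  have hbox0 : InBox R 0 0 0 := by
    simp [InBox, hκ0.le.trans hκR]
  have ha : ∀ t ∈ Icc t₂ u, k / 4 * (t - tc) ≤ a t := by
    intro t hts
    have := ht.le_comb hb (s := s) (t := t) (ζ := 0) (κ := κ) hbox0 le_rfl (by simpa using hk)
      (by simpa using hκ) heκ hs (hst.trans hts.1) (hts.2.trans hu) (fun x hx => by
        obtain ⟨h1, h2⟩ := hd x ⟨hx.1, hx.2.le.trans hts.2⟩
        have h3 := hz x ⟨hx.1, hx.2.le.trans hts.2⟩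
        simp only [sub_zero]
        exact ⟨h1.trans hdκ, h2.trans hdκ, h3⟩)
    simp only [zero_mul, add_zero] at this
    linarith [hα t hts]
  have hpos : ∀ t ∈ Icc t₂ u, ∀ x : ℝ, x ^ 3 ≤ 2 * (t - tc) → -(c * x) ≤ z t →
      2 * p ≤ cubic (z t) (a t) (b t) := by
    intro t hts x hx hzx
    have h1 : 0 ≤ t - tc := by linarith [hts.1]
    have h2 := cubic_pos_of_cusp h1 hC hc0.le hc hx (ha t hts) (hbτ t hts)
      (hz t ⟨hst.trans hts.1, hts.2⟩) hzx
    have h3 : k / 8 * (t₂ - tc) ≤ k / 8 * (t - tc) :=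
      mul_le_mul_of_nonneg_left (by linarith [hts.1]) (by positivity)
    rw [hp]; linarith
  have hv₃ := hv (t₃ - tc) (by linarith)
  -- first the fast variable comes down to the level for the time `t₃`, then it follows the level
  have hz₃ : z t₃ ≤ -(c * v (t₃ - tc)) := by
    refine ht.z_exit hb (hs.trans hst) ht₂ (ht₃.trans hu) hp0 (fun t hts hm => ?_) ?_
    · have := hpos t ⟨hts.1, hts.2.le.trans ht₃⟩ (v (t₃ - tc))
        (by rw [hv₃.2.1]; linarith [hts.1]) hm
      linarith
    · have h1 := (abs_le.1 (hz t₂ ⟨hst, ht₂.trans ht₃⟩)).2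
      have h2 : κ + c * v (t₃ - tc) ≤ p / e * (t₃ - t₂) := by
        rw [div_mul_eq_mul_div, le_div_iff₀ he]; exact hlong
      linarith
  have hmono : ∀ t ∈ Icc t₃ u, v (t₃ - tc) ≤ v (t - tc) := by
    intro t hts
    have h1 := hv (t - tc) (by linarith [hts.1])
    refine le_of_pow_le_pow_left₀ (n := 3) (by norm_num) h1.1.le ?_
    rw [h1.2.1, hv₃.2.1]; linarith [hts.1]
  have hdv : ∀ t ∈ Icc t₃ u, HasDerivAt (fun x => -(c * v (x - tc)))
      (-(c * (1 / (3 * v (t - tc) ^ 2)))) t := by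
    intro t hts
    have h1 := (hv (t - tc) (by linarith [hts.1])).2.2
    have h2 := HasDerivAt.comp_sub_const t tc h1
    exact (h2.const_mul c).neg
  have hzv : ∀ t ∈ Icc t₃ u, z t ≤ -(c * v (t - tc)) := by
    have ht₃0 : 0 ≤ t₃ := hs.trans (hst.trans ht₂)
    intro t hts
    refine image_le_of_deriv_right_lt_deriv_boundary' (ht.contZ.mono (Icc_subset_Icc ht₃0 hu))
      (fun x hx => ht.dz' ⟨ht₃0.trans hx.1, hx.2.trans_le hu⟩) hz₃
      (fun x hx => (hdv x hx).continuousAt.continuousWithinAt)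
      (fun x hx => (hdv x ⟨hx.1, hx.2.le⟩).hasDerivWithinAt) (fun x hx heq => ?_) hts
    have hx' : x ∈ Icc t₂ u := ⟨ht₂.trans hx.1, hx.2.le⟩
    have hvx := hv (x - tc) (by linarith [hx'.1])
    have h1 := hpos x hx' (v (x - tc)) (by rw [hvx.2.1]; linarith [hx'.1]) heq.ge
    have h2 := (abs_le.1 (hb.bound₃ _ _ _ _ (ht.box x ⟨ht₃0.trans hx.1, hx.2.le.trans hu⟩) he.le
      ht.e_le)).1
    have h3 : -(cubic (z x) (a x) (b x) + e * g₃ (a x, b x, z x, e)) / e ≤ -p / e := by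
      refine div_le_div_of_nonneg_right ?_ he.le
      nlinarith
    have h4 : c * (1 / (3 * v (x - tc) ^ 2)) ≤ c * (1 / (3 * v (t₃ - tc) ^ 2)) := by
      refine mul_le_mul_of_nonneg_left ?_ hc0.le
      refine one_div_le_one_div_of_le (by have := hv₃.1; positivity) ?_
      have := pow_le_pow_left₀ hv₃.1.le (hmono x ⟨hx.1, hx.2.le⟩) 2
      linarith
    have h5 : c * (1 / (3 * v (t₃ - tc) ^ 2)) < p / e := by
      have := hv₃.1
      rw [mul_one_div, div_lt_div_iff₀ (by positivity) he]
      linarith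
    have h6 : -p / e = -(p / e) := by ring
    linarith
  refine fun t hts => ⟨hzv t hts, ?_⟩
  have hvt := hv (t - tc) (by linarith [hts.1])
  have h1 := hzv t hts
  have h2 : (c * v (t - tc)) ^ 2 ≤ z t ^ 2 := by
    rw [← neg_sq (z t)]
    exact pow_le_pow_left₀ (mul_pos hc0 hvt.1).le (by linarith) 2
  have h3 := (abs_le.1 (hbτ t ⟨ht₂.trans hts.1, hts.2⟩)).1
  have h4 : C * (t - tc) ≤ c ^ 2 * v (t - tc) ^ 2 := by
    have : C * (t - tc) = C * v (t - tc) * v (t - tc) ^ 2 := by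
      rw [mul_assoc, ← pow_succ', hvt.2.1]
    rw [this]
    exact mul_le_mul_of_nonneg_right (hCv t hts) (sq_nonneg _)
  have h5 : (c * v (t - tc)) ^ 2 = c ^ 2 * v (t - tc) ^ 2 := by ring
  linarith

/-- After the cusp the distance to the slow orbit grows by a bounded factor only: the rate of the
slow difference is at most a multiple of `v⁻²`, which is integrable. -/
theorem IsTraj.cusp_track (ht : IsTraj g₁ g₂ g₃ R e T a b z) (hb : IsBounded g₁ g₂ g₃ R L)
    {tc t₄ u C c π π' q : ℝ} {v : ℝ → ℝ}
    (hv : ∀ x > 0, 0 < v x ∧ v x ^ 3 = x ∧ HasDerivAt v (1 / (3 * v x ^ 2)) x)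
    (ht₄ : 0 ≤ t₄) (htc : tc < t₄) (hu1 : u - tc ≤ 1) (hu : u ≤ T) (hc0 : 0 < c)
    (hsl : IsSlow g₁ g₂ R t₄ u A B Z) (hπ : 0 < π) (hππ : π + e ≤ π')
    (hbτ : ∀ t ∈ Icc t₄ u, |b t| ≤ C * (t - tc)) (hCv : ∀ t ∈ Icc t₄ u, C * v (t - tc) ≤ c ^ 2)
    (hz : ∀ t ∈ Icc t₄ u, z t ≤ -(c * v (t - tc))) (hZ : ∀ t ∈ Icc t₄ u, Z t ≤ -(c * v (t - tc)))
    (hcub : ∀ t ∈ Icc t₄ u, |cubic (z t) (a t) (b t)| ≤ π)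
    (hq : q = L * (3 + (R + 1) / (2 * c ^ 2))) (htu : t₄ ≤ u) :
    max |a u - A u| |b u - B u| ≤ (max |a t₄ - A t₄| |b t₄ - B t₄| + π') * Real.exp (3 * q) ∧
    |z u - Z u| * (2 * c ^ 2 * v (u - tc) ^ 2) ≤ π + (R + 1) * max |a u - A u| |b u - B u| := by
  have he := ht.e_pos
  have hL := hb.one_le_L
  have hR := hb.one_le_R
  have hv1 : ∀ t ∈ Icc t₄ u, v (t - tc) ≤ 1 := by
    intro t hts
    have h1 := hv (t - tc) (by linarith [hts.1])
    refine le_of_pow_le_pow_left₀ (n := 3) (by norm_num) zero_le_one ?_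
    rw [h1.2.1, one_pow]; linarith [hts.2]
  have hquot : ∀ t ∈ Icc t₄ u,
      2 * c ^ 2 * v (t - tc) ^ 2 ≤ z t ^ 2 + z t * Z t + Z t ^ 2 + b t := by
    intro t hts
    have hvt := hv (t - tc) (by linarith [hts.1])
    have h1 := hz t hts
    have h2 := hZ t hts
    have hcv := mul_pos hc0 hvt.1
    have h3 := (abs_le.1 (hbτ t hts)).1
    have h4 : C * (t - tc) ≤ c ^ 2 * v (t - tc) ^ 2 := by
      have : C * (t - tc) = C * v (t - tc) * v (t - tc) ^ 2 := by
        rw [mul_assoc, ← pow_succ', hvt.2.1]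
      rw [this]
      exact mul_le_mul_of_nonneg_right (hCv t hts) (sq_nonneg _)
    have h5 : (c * v (t - tc)) ^ 2 = c ^ 2 * v (t - tc) ^ 2 := by ring
    nlinarith [mul_self_le_mul_self hcv.le (show c * v (t - tc) ≤ -z t by linarith),
      mul_self_le_mul_self hcv.le (show c * v (t - tc) ≤ -Z t by linarith),
      mul_le_mul (show c * v (t - tc) ≤ -z t by linarith)
        (show c * v (t - tc) ≤ -Z t by linarith) hcv.le (by linarith)]
  have hw : ∀ t ∈ Icc t₄ u, |z t - Z t| * (2 * c ^ 2 * v (t - tc) ^ 2) ≤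
      π + (R + 1) * max |a t - A t| |b t - B t| := fun t hts =>
    (abs_sub_mul_le (hsl.box t hts).2.2 (hsl.mem t hts) (hquot t hts)).trans
      (add_le_add_left (hcub t hts) _)
  have hdv : ∀ t ∈ Icc t₄ u, HasDerivAt (fun x => 3 * q * v (x - tc))
      (q / v (t - tc) ^ 2) t := by
    intro t hts
    have h1 := (hv (t - tc) (by linarith [hts.1])).2.2
    have h2 := HasDerivAt.comp_sub_const t tc h1
    refine (h2.const_mul (3 * q)).congr_deriv ?_
    have := (hv (t - tc) (by linarith [hts.1])).1
    field_simp
  have hq0 : 0 < q := by rw [hq]; positivity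
  have hD := ht.slow_dist_le hb (π := π') ht₄ hu hsl
    (fun t hts => (hdv t hts).continuousAt.continuousWithinAt)
    (fun t hts => (hdv t ⟨hts.1, hts.2.le⟩).hasDerivWithinAt) (by linarith) (fun t hts => by
      have hts' : t ∈ Icc t₄ u := ⟨hts.1, hts.2.le⟩
      have hvt := (hv (t - tc) (by linarith [hts.1])).1
      have h1 := hw t hts'
      have h2 : 0 ≤ max |a t - A t| |b t - B t| := le_max_of_le_left (abs_nonneg _)
      set D := max |a t - A t| |b t - B t|
      have h3 : |z t - Z t| * v (t - tc) ^ 2 ≤ (R + 1) / (2 * c ^ 2) * (D + π') := by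
        rw [div_mul_eq_mul_div, le_div_iff₀ (by positivity)]
        have : (R + 1) * (D + π') ≥ π + (R + 1) * D := by nlinarith
        linarith
      have h4 : v (t - tc) ^ 2 ≤ 1 := pow_le_one₀ hvt.le (hv1 t hts')
      rw [div_mul_eq_mul_div, le_div_iff₀ (by positivity), hq, mul_assoc, mul_assoc]
      refine mul_le_mul_of_nonneg_left ?_ (by linarith)
      have h5 : (2 * D + e) * v (t - tc) ^ 2 ≤ 2 * D + e :=
        mul_le_of_le_one_right (by linarith) h4
      nlinarith) u ⟨htu, le_rfl⟩
  refine ⟨hD.trans ?_, hw u ⟨htu, le_rfl⟩⟩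
  refine mul_le_mul_of_nonneg_left (Real.exp_le_exp.2 ?_)
    (add_nonneg (le_max_of_le_left (abs_nonneg _)) (by linarith))
  have h1 := (hv (t₄ - tc) (by linarith)).1
  have h2 := hv1 u ⟨htu, le_rfl⟩
  have h3 : 0 ≤ 3 * q * v (t₄ - tc) := by positivity
  have h4 : 3 * q * v (u - tc) ≤ 3 * q := mul_le_of_le_one_right (by linarith) h2
  linarith

/-- The slow orbit itself obeys the cube root bound after the cusp. -/
theorem IsContact.cusp_slow {s₀ tc u₁ u : ℝ} (h : IsContact g₁ g₂ R s₀ tc u₁ A B Z 0)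
    (hb : IsBounded g₁ g₂ g₃ R L) {k C c κ : ℝ} {v : ℝ → ℝ}
    (hv : ∀ x > 0, 0 < v x ∧ v x ^ 3 = x ∧ HasDerivAt v (1 / (3 * v x ^ 2)) x)
    (hk : k ≤ g₁ (0, 0, 0, 0)) (hκ0 : 0 ≤ κ) (hκ : L * (4 * κ) ≤ k / 2)
    (hC : C * κ ≤ k / 32) (hc0 : 0 < c) (hc : 2 * c ^ 3 ≤ k / 32)
    (hLC : L ≤ C) (huκ : L * (u - tc) ≤ κ) (hu : u ≤ u₁) (hZ : ∀ t ∈ Ioc tc u, |Z t| ≤ κ) :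
    ∀ t ∈ Ioc tc u, Z t ≤ -(c * v (t - tc)) := by
  intro t hts
  have hL := hb.one_le_L
  have hA0 : A tc = 0 := by rw [h.A_tc]; norm_num
  have hB0 : B tc = 0 := by rw [h.B_tc]; norm_num
  have hbox0 : InBox R 0 0 0 := by have := h.box_tc; rwa [hA0, hB0] at this
  have hk0 : 0 < k := by
    have : 0 < 2 * c ^ 3 := by positivity
    linarith
  have hI : ∀ x ∈ Ioc tc u, x ∈ Icc s₀ u₁ := fun x hx => ⟨(h.lt_tc.trans hx.1).le, hx.2.trans hu⟩
  have hAB : ∀ x ∈ Ioc tc u, |A x| ≤ L * (x - tc) ∧ |B x| ≤ L * (x - tc) := by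
    intro x hx
    have := h.drift hb (hI x hx)
    rwa [hA0, hB0, sub_zero, sub_zero, abs_of_pos (sub_pos.2 hx.1)] at this
  have hA : k / 2 * (t - tc) ≤ A t := by
    have h1 := le_sub_of_le_deriv_Ioo (f := A) (c := k / 2) hts.1.le
      (h.contA.mono (Icc_subset_Icc h.lt_tc.le (hts.2.trans hu)))
      (fun x hx => h.dA x ⟨(h.lt_tc.trans hx.1).le, hx.2.trans_le (hts.2.trans hu)⟩ hx.1.ne')
      (fun x hx => by
        have hx' : x ∈ Ioc tc u := ⟨hx.1, hx.2.le.trans hts.2⟩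
        obtain ⟨h1, h2⟩ := hAB x hx'
        have h3 : L * (x - tc) ≤ κ := le_trans
          (mul_le_mul_of_nonneg_left (by linarith [hx'.2]) (by linarith)) huκ
        have h4 := hb.speed_near (ζ := 0) (κ := κ) (h.box x (hI x hx') hx.1.ne') hbox0 le_rfl
          zero_le_one le_rfl (by simpa using h1.trans h3) (by simpa using h2.trans h3)
          (by simpa using hZ x hx') hκ0
        simp only [zero_mul, add_zero, mul_one] at h4
        linarith [(abs_le.1 h4).1])
    rw [hA0, zero_add] at h1
    exact h1
  by_contra! hlt
  have hτ : 0 < t - tc := sub_pos.2 hts.1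
  have h1 := cubic_pos_of_cusp (k := k) hτ.le hC hc0.le hc
    (by rw [(hv _ hτ).2.1]; linarith) (a := A t) (b := B t)
    (le_trans (mul_le_mul_of_nonneg_right (by linarith) hτ.le) hA)
    ((hAB t hts).2.trans (mul_le_mul_of_nonneg_right hLC hτ.le)) (hZ t hts) hlt.le
  rw [h.mem t (hI t hts) hts.1.ne'] at h1
  have : 0 < k / 8 * (t - tc) := by positivity
  linarith

set_option maxHeartbeats 800000 in
/-- The passage of the cusp in the direction of increasing `a`. -/
theorem IsContact.passes_of_cusp {s₀ tc u₁ : ℝ} (h : IsContact g₁ g₂ R s₀ tc u₁ A B Z 0)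
    (hb : IsBounded g₁ g₂ g₃ R L) (hpos : 0 < g₁ (0, 0, 0, 0)) :
    ∃ u₂ > tc, ∀ u ∈ Ioo tc u₂, Passes g₁ g₂ g₃ R s₀ tc u A B Z := by
  have hL := hb.one_le_L
  have hR := hb.one_le_R
  obtain ⟨v, hv⟩ := exists_cube_root
  -- the speed `k` of `a` at the cusp, a bound `C (t - tc)` for `b` after it, the factor `c` of the
  -- barrier `-c v` for `z`, and the size `κ` of a neighbourhood in which `a` has half of its speed
  obtain ⟨k, hk, hk0⟩ : ∃ k, k ≤ g₁ (0, 0, 0, 0) ∧ 0 < k := ⟨_, le_rfl, hpos⟩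
  obtain ⟨C, hC⟩ : ∃ C, C = 3 * (1 + L) := ⟨_, rfl⟩
  have hC0 : 0 < C := by rw [hC]; positivity
  obtain ⟨c, hc0, hc1, hc⟩ : ∃ c : ℝ, 0 < c ∧ c ≤ 1 ∧ 2 * c ^ 3 ≤ k / 32 := by
    refine ⟨min 1 (k / 64), by positivity, min_le_left _ _, ?_⟩
    have h1 : min 1 (k / 64) ^ 3 ≤ min 1 (k / 64) :=
      pow_le_of_le_one (by positivity) (min_le_left _ _) (by norm_num)
    linarith [min_le_right 1 (k / 64)]
  obtain ⟨κ, hκ0, hκ1, hκ, hCκ⟩ : ∃ κ : ℝ, 0 < κ ∧ κ ≤ 1 ∧ L * (4 * κ) ≤ k / 2 ∧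
      C * κ ≤ k / 32 := by
    refine ⟨min 1 (min (k / (8 * L)) (k / (32 * C))), by positivity, min_le_left _ _, ?_, ?_⟩
    · have h1 : min 1 (min (k / (8 * L)) (k / (32 * C))) ≤ k / (8 * L) :=
        (min_le_right _ _).trans (min_le_left _ _)
      rw [le_div_iff₀ (by positivity)] at h1
      linarith
    · have h1 : min 1 (min (k / (8 * L)) (k / (32 * C))) ≤ k / (32 * C) :=
        (min_le_right _ _).trans (min_le_right _ _)
      rw [le_div_iff₀ (by positivity)] at h1
      linarith
  have hA0 : A tc = 0 := by rw [h.A_tc]; norm_num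
  have hB0 : B tc = 0 := by rw [h.B_tc]; norm_num
  -- the size `δ₁` of the neighbourhood of the cusp
  have hright : ∀ᶠ t in 𝓝[>] tc, |Z t| < κ := by
    have e1 := h.right.abs
    simp only [mul_zero, abs_zero] at e1
    exact e1.eventually_lt_const hκ0
  obtain ⟨w, hw, hwZ⟩ := (mem_nhdsGT_iff_exists_Ioo_subset' h.tc_lt).1 hright
  obtain ⟨δ₁, ⟨hδ₁C, hδ₁κ, hδ₁c⟩, ⟨hδ₁1, hδ₁u, hδ₁s⟩, hδ₁w, hδ₁0⟩ :=
    (((eventually_mul_lt C hκ0).and ((eventually_mul_lt ((1 + κ) * C)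
      (show 0 < κ ^ 3 / 2 by positivity)).and (eventually_mul_lt (C ^ 3)
      (show 0 < c ^ 6 by positivity)))).and
      (((eventually_lt_of_pos one_pos).and ((eventually_lt_of_pos (sub_pos.2 h.tc_lt)).and
      (eventually_lt_of_pos (sub_pos.2 h.lt_tc)))).and
      ((eventually_lt_of_pos (sub_pos.2 hw)).and self_mem_nhdsWithin))).exists
  have hδ₁0 : 0 < δ₁ := hδ₁0
  have hCv : ∀ t, tc < t → t ≤ tc + δ₁ → C * v (t - tc) ≤ c ^ 2 := by
    intro t h1 h2
    have h3 := hv (t - tc) (sub_pos.2 h1)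
    refine le_of_pow_le_pow_left₀ (n := 3) (by norm_num) (by positivity) ?_
    rw [mul_pow, h3.2.1]
    have h4 : C ^ 3 * (t - tc) ≤ C ^ 3 * δ₁ :=
      mul_le_mul_of_nonneg_left (by linarith) (by positivity)
    have h5 : (c ^ 2) ^ 3 = c ^ 6 := by ring
    linarith
  refine ⟨tc + δ₁, by linarith, fun u hu η hη => ?_⟩
  have huτ : 0 < u - tc := sub_pos.2 hu.1
  have hLC : L ≤ C := by rw [hC]; linarith
  have hZslow := h.cusp_slow hb (u := u) hv hk hκ0.le hκ hCκ hc0 hc hLC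
    ((mul_le_mul hLC (by linarith [hu.2]) huτ.le hC0.le).trans hδ₁C.le) (by linarith [hu.2])
    (fun t ht => (hwZ ⟨ht.1, by linarith [ht.2, hu.2]⟩).le)
  -- after the time `M δ` the growth of `a` has made up for the initial error
  obtain ⟨M, hM1, hM⟩ : ∃ M : ℝ, 1 ≤ M ∧ 1 + L ≤ k / 4 * M := by
    refine ⟨1 + 4 * (1 + L) / k, by linarith [show 0 < 4 * (1 + L) / k by positivity], ?_⟩
    have : k / 4 * (1 + 4 * (1 + L) / k) = k / 4 + (1 + L) := by field_simp
    linarith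
  obtain ⟨C₅, hC₅, hC₅0⟩ : ∃ C₅ : ℝ, C₅ = 2 * (1 + L) * (M + 4) ∧ 0 < C₅ :=
    ⟨_, rfl, by positivity⟩
  obtain ⟨q, hq⟩ : ∃ q, q = L * (3 + (R + 1) / (2 * c ^ 2)) := ⟨_, rfl⟩
  obtain ⟨E, hE, hE1⟩ : ∃ E, E = Real.exp (3 * q) ∧ 0 < E := ⟨_, rfl, Real.exp_pos _⟩
  have hvu := (hv (u - tc) huτ).1
  -- the half-width `δ` of the window
  obtain ⟨δ, ⟨hδZ, hδδ₁, hδM⟩, ⟨hδη₁, hδη₂⟩, hδη₃, hδ0⟩ :=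
    (((h.eventually_Z_near (half_pos hκ0)).and ((eventually_lt_of_pos hδ₁0).and
      (eventually_mul_lt (M + 2) huτ))).and
      (((eventually_mul_lt C₅ hη).and (eventually_mul_lt ((C₅ + 2) * E) hη)).and
      ((eventually_mul_lt (1 + (R + 1) * ((C₅ + 2) * E))
        (show 0 < η * (2 * c ^ 2 * v (u - tc) ^ 2) by positivity)).and
        self_mem_nhdsWithin))).exists
  have hδ0 : 0 < δ := hδ0
  rw [sub_zero] at hδZ
  have hMδ : δ ≤ M * δ := le_mul_of_one_le_left hδ0.le hM1
  obtain ⟨p, hp, hp0⟩ : ∃ p, p = k / 16 * (M * δ) ∧ 0 < p := ⟨_, rfl, by positivity⟩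
  have hv₃ : 0 < v ((M + 1) * δ) := (hv ((M + 1) * δ) (by positivity)).1
  -- `2 p` is a lower bound for the cubic during the descent, `l` a lower bound for the rate after it
  obtain ⟨l, hl, hl0⟩ : ∃ l, l = 2 * c ^ 2 * v ((M + 1) * δ) ^ 2 ∧ 0 < l :=
    ⟨_, rfl, by positivity⟩
  obtain ⟨ρ, ⟨⟨hρδ, hρκ⟩, hρL, hρp⟩, ⟨hρ1, hρ2⟩, ⟨hρ3, hρ4⟩, hρ5, hρ0⟩ :=
    ((((eventually_lt_of_pos hδ0).and (eventually_lt_of_pos (half_pos hκ0))).and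
      ((eventually_mul_lt L (show 0 < κ ^ 3 / 2 by positivity)).and (eventually_mul_lt L hp0))).and
      (((eventually_mul_lt (κ + c * v ((M + 1) * δ)) (show 0 < p * δ by positivity)).and
        (eventually_mul_lt c (show 0 < 3 * p * v ((M + 1) * δ) ^ 2 by positivity))).and
      (((eventually_mul_lt L (half_pos hδ0)).and
        (eventually_mul_lt ((R + 1) * L) (show 0 < l * δ / 4 by positivity))).and
      ((eventually_mul_lt (12 * R ^ 3) (show 0 < l * δ * δ by positivity)).and
        self_mem_nhdsWithin)))).exists
  have hρ0 : 0 < ρ := hρ0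
  refine ⟨tc - δ, ⟨by linarith, by linarith⟩, ρ, hρ0, fun e T a b z ht heρ hsT hclose => ?_⟩
  have hs0 : 0 ≤ tc - δ := by linarith [h.nonneg]
  have he := ht.e_pos
  have hnear := h.traj_near hb ht hδ0 (by linarith) hρδ.le hclose
  rw [hA0, hB0] at hnear
  simp only [sub_zero] at hnear
  have hs := hnear (tc - δ) le_rfl hsT
  rw [sub_self, mul_zero, add_zero] at hs
  have hsmall : ∀ t ∈ Icc (tc - δ) u, t ≤ T → |a t| ≤ (1 + L) * (2 * δ + (t - tc)) ∧
      |b t| ≤ (1 + L) * (2 * δ + (t - tc)) := by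
    intro t hts htT
    have h1 := hnear t hts.1 htT
    have h2 : (1 + L) * δ + L * (t - (tc - δ)) ≤ (1 + L) * (2 * δ + (t - tc)) := by
      have : 0 ≤ t - (tc - δ) := by linarith [hts.1]
      nlinarith
    exact ⟨h1.1.trans h2, h1.2.trans h2⟩
  -- up to the time `tc + (M + 2) δ` both orbits are within `O(δ)` of the cusp
  have hearly : ∀ t ∈ Icc (tc - δ) (tc + (M + 2) * δ), t ≤ T →
      max |a t - A t| |b t - B t| ≤ C₅ * δ := by
    intro t hts htT
    have htu : t ≤ u := by linarith [hts.2]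
    have h1 := hsmall t ⟨hts.1, htu⟩ htT
    have h2 := h.drift hb (t := t) ⟨by linarith [hts.1], by linarith [hu.2]⟩
    rw [hA0, hB0, sub_zero, sub_zero] at h2
    have h3 : |t - tc| ≤ (M + 4) * δ := by
      rw [abs_le]; constructor <;> linarith [hts.1, hts.2]
    have h4 : L * |t - tc| ≤ (1 + L) * ((M + 4) * δ) :=
      mul_le_mul (by linarith) h3 (abs_nonneg _) (by linarith)
    have h5 : (1 + L) * (2 * δ + (t - tc)) ≤ (1 + L) * ((M + 4) * δ) :=
      mul_le_mul_of_nonneg_left (by linarith [hts.2]) (by linarith)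
    have h6 : C₅ * δ = (1 + L) * ((M + 4) * δ) + (1 + L) * ((M + 4) * δ) := by rw [hC₅]; ring
    rw [h6]
    exact max_le (by linarith [abs_sub (a t) (A t)]) (by linarith [abs_sub (b t) (B t)])
  have heL : e * L ≤ L * ρ := by
    rw [mul_comm]; exact mul_le_mul_of_nonneg_left heρ (by linarith)
  -- the fast variable comes down during the first of the two intervals of length `δ` that end at
  -- `t₄ = tc + (M + 2) δ`, and the defect decays during the second one; after that both are tracked
  have hlate : ∀ t ∈ Icc (tc + (M + 2) * δ) u, t ≤ T →
      max |a t - A t| |b t - B t| ≤ (C₅ + 2) * E * δ ∧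
      |z t - Z t| * (2 * c ^ 2 * v (t - tc) ^ 2) ≤
        δ + (R + 1) * max |a t - A t| |b t - B t| := by
    intro t hts htT
    have hbτ : ∀ x ∈ Icc (tc + M * δ) t, |b x| ≤ C * (x - tc) := by
      intro x hx
      have h1 := (hsmall x ⟨by linarith [hx.1], hx.2.trans hts.2⟩ (hx.2.trans htT)).2
      refine h1.trans ?_
      rw [hC, mul_comm 3, mul_assoc]
      exact mul_le_mul_of_nonneg_left (by linarith [hx.1]) (by linarith)
    have e₂ : tc + M * δ - tc = M * δ := by ring
    have e₃ : tc + (M + 1) * δ - tc = (M + 1) * δ := by ring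
    have e₄ : tc + (M + 1) * δ - (tc + M * δ) = δ := by ring
    have hdesc := ht.cusp_descend hb (s := tc - δ) (t₂ := tc + M * δ) (t₃ := tc + (M + 1) * δ)
      (u := t) (d := C * δ₁) (α := (1 + L) * δ) (p := p) (κ := κ) (C := C) (k := k) (c := c) hv hs0
      (by linarith) (by linarith) (by linarith) (by linarith [hts.1]) htT hk hκ (by linarith)
      (hκ1.trans hR) hCκ hc0 hc
      (fun x hx => by
        have h1 := hsmall x ⟨hx.1, hx.2.trans hts.2⟩ (hx.2.trans htT)
        have h2 : (1 + L) * (2 * δ + (x - tc)) ≤ C * δ₁ := by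
          rw [hC, mul_comm 3, mul_assoc]
          exact mul_le_mul_of_nonneg_left (by linarith [hx.2, hts.2, hu.2]) (by linarith)
        exact ⟨h1.1.trans h2, h1.2.trans h2⟩) hδ₁C.le (by linarith)
      (by
        have h1 := abs_sub_abs_le_abs_sub (z (tc - δ)) (Z (tc - δ))
        linarith [hclose.2.2]) (by linarith [(abs_le.1 hs.1).1])
      (fun x hx => by
        have h1 : k / 4 * (M * δ) ≤ k / 4 * (x - tc) :=
          mul_le_mul_of_nonneg_left (by linarith [hx.1]) (by linarith)
        have h2 : (1 + L) * δ ≤ k / 4 * (M * δ) := by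
          rw [← mul_assoc]; exact mul_le_mul_of_nonneg_right hM hδ0.le
        have h3 : 0 < k * δ := by positivity
        linarith) hbτ
      (fun x hx => hCv x (by linarith [hx.1]) (by linarith [hx.2, hts.2, hu.2]))
      (by rw [e₂, hp]) (by rw [e₂, e₃]; linarith) (by linarith)
      (by
        rw [e₃, e₄]
        exact (mul_le_mul_of_nonneg_left heρ (by positivity)).trans hρ1.le)
      (by
        rw [e₃]
        exact (mul_le_mul_of_nonneg_left heρ hc0.le).trans_lt hρ2)
    have hrate : ∀ x ∈ Icc (tc + (M + 1) * δ) t, l ≤ 3 * z x ^ 2 + b x := by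
      intro x hx
      refine le_trans ?_ (hdesc x hx).2
      rw [hl]
      refine mul_le_mul_of_nonneg_left (pow_le_pow_left₀ hv₃.le ?_ 2) (by positivity)
      have h1 := hv (x - tc) (by linarith [hx.1])
      refine le_of_pow_le_pow_left₀ (n := 3) (by norm_num) h1.1.le ?_
      rw [h1.2.1, (hv ((M + 1) * δ) (by positivity)).2.1]; linarith [hx.1]
    have h0₃ : 0 ≤ tc + (M + 1) * δ := by linarith
    have heRL : e * ((R + 1) * L) ≤ l * δ / 4 := by
      rw [mul_comm]
      exact (mul_le_mul_of_nonneg_left heρ (by positivity)).trans hρ4.le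
    have hcub₄ := ht.abs_cubic_exit hb (s := tc + (M + 1) * δ) (u := tc + (M + 2) * δ) h0₃
      (by linarith) (hts.1.trans htT) hl0 hδ0
      (fun x hx => hrate x ⟨hx.1, hx.2.le.trans hts.1⟩) (by linarith) heRL
      (by
        have : tc + (M + 2) * δ - (tc + (M + 1) * δ) = δ := by ring
        rw [this]
        exact (mul_le_mul_of_nonneg_left heρ (by positivity)).trans hρ5.le)
    have hcub := ht.abs_cubic_le hb (s := tc + (M + 2) * δ) (u := t) (by linarith) htT hl0
      (fun x hx => hrate x ⟨by linarith [hx.1], hx.2.le⟩)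
      (by
        have h1 : l * (δ / 2) ≤ l * (δ - e * L) := mul_le_mul_of_nonneg_left (by linarith) hl0.le
        have h2 : 0 < l * δ := by positivity
        linarith) hcub₄
    have htrack := ht.cusp_track hb (t₄ := tc + (M + 2) * δ) (u := t) (π := δ) (π' := 2 * δ)
      (c := c) (C := C) hv (by linarith) (by linarith) (by linarith [hts.2, hu.2]) htT hc0
      (h.isSlow (by linarith) (by linarith [hts.2, hu.2])) hδ0 (by linarith)
      (fun x hx => hbτ x ⟨by linarith [hx.1], hx.2⟩)
      (fun x hx => hCv x (by linarith [hx.1]) (by linarith [hx.2, hts.2, hu.2]))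
      (fun x hx => (hdesc x ⟨by linarith [hx.1], hx.2⟩).1)
      (fun x hx => hZslow x ⟨by linarith [hx.1], hx.2.trans hts.2⟩) hcub hq hts.1
    refine ⟨htrack.1.trans ?_, htrack.2⟩
    rw [← hE]
    have h1 := hearly (tc + (M + 2) * δ) ⟨by linarith, le_rfl⟩ (hts.1.trans htT)
    have h2 : (C₅ + 2) * E * δ = (C₅ * δ + 2 * δ) * E := by ring
    rw [h2]
    exact mul_le_mul_of_nonneg_right (by linarith) hE1.le
  refine ⟨fun t hts htT => ?_, fun huT => ?_⟩
  · have h1 : max |a t - A t| |b t - B t| ≤ η := by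
      rcases le_total t (tc + (M + 2) * δ) with hle | hle
      · exact (hearly t ⟨hts.1, hle⟩ htT).trans hδη₁.le
      · exact (hlate t ⟨hle, hts.2⟩ htT).1.trans hδη₂.le
    exact ⟨(le_max_left _ _).trans h1, (le_max_right _ _).trans h1⟩
  · obtain ⟨h1, h2⟩ := hlate u ⟨by linarith, le_rfl⟩ huT
    have h3 : (R + 1) * max |a u - A u| |b u - B u| ≤ (R + 1) * ((C₅ + 2) * E * δ) :=
      mul_le_mul_of_nonneg_left h1 (by linarith)
    refine le_of_mul_le_mul_right (a := 2 * c ^ 2 * v (u - tc) ^ 2) ?_ (by positivity)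
    linarith

/-! ### The symmetry `(a, b, z) ↦ (-a, b, -z)` -/

/-- The transform of the right-hand sides for `a` and `z` under `(a, b, z) ↦ (-a, b, -z)`. -/
def flipOdd (g : ℝ × ℝ × ℝ × ℝ → ℝ) : ℝ × ℝ × ℝ × ℝ → ℝ :=
  fun p => -g (-p.1, p.2.1, -p.2.2.1, p.2.2.2)

/-- The transform of the right-hand side for `b` under `(a, b, z) ↦ (-a, b, -z)`. -/
def flipEven (g : ℝ × ℝ × ℝ × ℝ → ℝ) : ℝ × ℝ × ℝ × ℝ → ℝ :=
  fun p => g (-p.1, p.2.1, -p.2.2.1, p.2.2.2)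

theorem InBox.flip {a b z : ℝ} (h : InBox R a b z) : InBox R (-a) b (-z) := by
  simpa [InBox] using h

theorem cubic_neg (z a b : ℝ) : cubic (-z) (-a) b = -cubic z a b := by
  unfold cubic; ring

theorem IsBounded.flip (hb : IsBounded g₁ g₂ g₃ R L) :
    IsBounded (flipOdd g₁) (flipEven g₂) (flipOdd g₃) R L where
  one_le_R := hb.one_le_R
  one_le_L := hb.one_le_L
  bound₁ a b z e h he he1 := by
    simpa [flipOdd] using hb.bound₁ _ _ _ e h.flip he he1
  bound₂ a b z e h he he1 := hb.bound₂ _ _ _ e h.flip he he1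
  bound₃ a b z e h he he1 := by
    simpa [flipOdd] using hb.bound₃ _ _ _ e h.flip he he1
  lip₁ a b z a' b' z' e h h' he he1 := by
    have := hb.lip₁ _ _ _ _ _ _ e h.flip h'.flip he he1
    simp only [flipOdd]
    rw [← abs_neg, neg_sub_neg, neg_sub, ← abs_sub_comm a' a, ← abs_sub_comm z' z]
    simpa only [neg_sub_neg] using this
  lip₂ a b z a' b' z' e h h' he he1 := by
    have := hb.lip₂ _ _ _ _ _ _ e h.flip h'.flip he he1
    simp only [flipEven]
    rw [← abs_sub_comm a' a, ← abs_sub_comm z' z]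
    simpa only [neg_sub_neg] using this

theorem IsTraj.flip (h : IsTraj g₁ g₂ g₃ R e T a b z) :
    IsTraj (flipOdd g₁) (flipEven g₂) (flipOdd g₃) R e T (fun t => -a t) b (fun t => -z t) where
  e_pos := h.e_pos
  e_le := h.e_le
  box t ht := (h.box t ht).flip
  da t ht := by simp only [flipOdd, neg_neg]; exact (h.da t ht).neg
  db t ht := by simpa [flipEven] using h.db t ht
  dz t ht := by
    refine (h.dz t ht).neg.congr_deriv ?_
    rw [cubic_neg]
    simp only [flipOdd, neg_neg]
    ring

theorem IsContact.flip {s₀ tc u₁ ζ : ℝ} (h : IsContact g₁ g₂ R s₀ tc u₁ A B Z ζ) :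
    IsContact (flipOdd g₁) (flipEven g₂) R s₀ tc u₁ (fun t => -A t) B (fun t => -Z t) (-ζ) where
  nonneg := h.nonneg
  lt_tc := h.lt_tc
  tc_lt := h.tc_lt
  contA := h.contA.neg
  contB := h.contB
  contZ := h.contZ.neg
  dA t ht htc := by simp only [flipOdd, neg_neg]; exact (h.dA t ht htc).neg
  dB t ht htc := by simpa [flipEven] using h.dB t ht htc
  mem t ht htc := by rw [cubic_neg, h.mem t ht htc, neg_zero]
  box t ht htc := (h.box t ht htc).flip
  attr t ht htc := by rw [neg_sq]; exact h.attr t ht htc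
  left := h.left.neg
  right := by simpa using h.right.neg
  fold := by rw [neg_sq]; exact h.fold
  trans := by
    have := h.trans
    simp only [flipOdd, flipEven, neg_neg]
    intro h0
    apply this
    linarith

theorem Passes.of_flip {s₀ tc u : ℝ}
    (h : Passes (flipOdd g₁) (flipEven g₂) (flipOdd g₃) R s₀ tc u (fun t => -A t) B
      (fun t => -Z t)) : Passes g₁ g₂ g₃ R s₀ tc u A B Z := by
  intro η hη
  obtain ⟨s, hs, ρ, hρ, H⟩ := h η hη
  refine ⟨s, hs, ρ, hρ, fun e T a b z ht heρ hsT hclose => ?_⟩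
  have key : ∀ x y : ℝ, |-x - -y| = |x - y| := fun x y => by rw [neg_sub_neg, abs_sub_comm]
  have := H e T _ _ _ ht.flip heρ hsT ⟨by rw [key]; exact hclose.1, hclose.2.1,
    by rw [key]; exact hclose.2.2⟩
  simpa only [key] using this

/-- Trajectories pass every contact point together with the slow orbit. -/
theorem IsContact.exists_passes {s₀ tc u₁ ζ : ℝ} (h : IsContact g₁ g₂ R s₀ tc u₁ A B Z ζ)
    (hb : IsBounded g₁ g₂ g₃ R L) : ∃ u₂ > tc, ∀ u ∈ Ioo tc u₂, Passes g₁ g₂ g₃ R s₀ tc u A B Z := by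
  rcases lt_trichotomy ζ 0 with hζ | rfl | hζ
  · exact ⟨u₁, h.tc_lt, fun u hu => (h.flip.passes_of_fold hb.flip (neg_pos.2 hζ) hu).of_flip⟩
  · have htr := h.trans
    rw [h.A_tc, h.B_tc] at htr
    norm_num at htr
    rcases lt_or_gt_of_ne htr with hneg | hpos
    · have hf := h.flip
      rw [neg_zero] at hf
      obtain ⟨u₂, hu₂, H⟩ := hf.passes_of_cusp hb.flip (by simpa [flipOdd] using hneg)
      exact ⟨u₂, hu₂, fun u hu => (H u hu).of_flip⟩
    · exact h.passes_of_cusp hb hpos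
  · exact ⟨u₁, h.tc_lt, fun u hu => h.passes_of_fold hb hζ hu⟩

/-! ### Tracking along a whole slow orbit -/

section Global

variable {f₁ f₂ f₃ : ℝ × ℝ × ℝ × ℝ → ℝ} {am ap : ℝ}

/-- Trajectories that start close to the start of the slow orbit are close to it in the slow
variables up to the time `s`. -/
def TracksTo (f₁ f₂ f₃ : ℝ × ℝ × ℝ × ℝ → ℝ) (R : ℝ) (A B Z : ℝ → ℝ) (s : ℝ) : Prop :=
  ∀ η > 0, ∃ ρ > 0, ∀ (e T : ℝ) (a b z : ℝ → ℝ),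
    IsTraj (fun p => 1 + f₁ p) f₂ f₃ R e T a b z → e ≤ ρ → 0 ≤ T → Close a b z A B Z ρ 0 →
    ∀ t ∈ Icc 0 s, t ≤ T → |a t - A t| ≤ η ∧ |b t - B t| ≤ η

/-- Trajectories that start close to the start of the slow orbit are close to it in the fast
variable during the interval `[s, u]`. -/
def TracksOn (f₁ f₂ f₃ : ℝ × ℝ × ℝ × ℝ → ℝ) (R : ℝ) (A B Z : ℝ → ℝ) (s u : ℝ) : Prop :=
  ∀ η > 0, ∃ ρ > 0, ∀ (e T : ℝ) (a b z : ℝ → ℝ),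
    IsTraj (fun p => 1 + f₁ p) f₂ f₃ R e T a b z → e ≤ ρ → 0 ≤ T → Close a b z A B Z ρ 0 →
    ∀ t ∈ Icc s u, t ≤ T → |z t - Z t| ≤ η

theorem TracksTo.mono {s s' : ℝ} (h : TracksTo f₁ f₂ f₃ R A B Z s) (hs : s' ≤ s) :
    TracksTo f₁ f₂ f₃ R A B Z s' := fun η hη => by
  obtain ⟨ρ, hρ, H⟩ := h η hη
  exact ⟨ρ, hρ, fun e T a b z ht he hT hc t hts htT =>
    H e T a b z ht he hT hc t ⟨hts.1, hts.2.trans hs⟩ htT⟩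

/-- Both kinds of closeness at a single time. -/
theorem TracksTo.close {s : ℝ} (h : TracksTo f₁ f₂ f₃ R A B Z s)
    (hz : TracksOn f₁ f₂ f₃ R A B Z s s) (hs : 0 ≤ s) {η : ℝ} (hη : 0 < η) :
    ∃ ρ > 0, ∀ (e T : ℝ) (a b z : ℝ → ℝ),
      IsTraj (fun p => 1 + f₁ p) f₂ f₃ R e T a b z → e ≤ ρ → 0 ≤ T → Close a b z A B Z ρ 0 →
      s ≤ T → Close a b z A B Z η s := by
  obtain ⟨ρ₁, hρ₁, H₁⟩ := h η hη
  obtain ⟨ρ₂, hρ₂, H₂⟩ := hz η hη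
  refine ⟨min ρ₁ ρ₂, lt_min hρ₁ hρ₂, fun e T a b z ht he hT hc hsT => ?_⟩
  have h1 := H₁ e T a b z ht (he.trans (min_le_left _ _)) hT
    ⟨hc.1.trans (min_le_left _ _), hc.2.1.trans (min_le_left _ _), hc.2.2.trans (min_le_left _ _)⟩
    s ⟨hs, le_rfl⟩ hsT
  have h2 := H₂ e T a b z ht (he.trans (min_le_right _ _)) hT
    ⟨hc.1.trans (min_le_right _ _), hc.2.1.trans (min_le_right _ _),
      hc.2.2.trans (min_le_right _ _)⟩ s ⟨le_rfl, le_rfl⟩ hsT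
  exact ⟨h1.1, h1.2, h2⟩

/-- Tracking up to `s`, including the fast variable outside the contact times. -/
def Good (f₃ : ℝ × ℝ × ℝ × ℝ → ℝ) (R : ℝ) (γ : SlowOrbit f₁ f₂ am ap) (s : ℝ) : Prop :=
  TracksTo f₁ f₂ f₃ R γ.a γ.b γ.z s ∧
    ∀ t ∈ Icc 0 s, t ∉ γ.contact → TracksOn f₁ f₂ f₃ R γ.a γ.b γ.z t t

theorem Good.mono {γ : SlowOrbit f₁ f₂ am ap} {s s' : ℝ} (h : Good f₃ R γ s) (hs : s' ≤ s) :
    Good f₃ R γ s' :=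
  ⟨h.1.mono hs, fun t ht htc => h.2 t ⟨ht.1, ht.2.trans hs⟩ htc⟩

theorem SlowOrbit.isSlow (γ : SlowOrbit f₁ f₂ am ap)
    (hbox : ∀ t ∈ Icc 0 γ.T, t ∉ γ.contact → InBox R (γ.a t) (γ.b t) (γ.z t)) {s u : ℝ}
    (hs : 0 ≤ s) (hu : u ≤ γ.T) (hc : ∀ t ∈ Icc s u, t ∉ γ.contact) :
    IsSlow (fun p => 1 + f₁ p) f₂ R s u γ.a γ.b γ.z := by
  have hsub : Icc s u ⊆ Icc 0 γ.T := Icc_subset_Icc hs hu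
  refine ⟨γ.a_cont.mono hsub, γ.b_cont.mono hsub, fun t ht => ?_, fun t ht => ?_,
    fun t ht => γ.mem_slowManifold t (hsub ht) (hc t ht), fun t ht => hbox t (hsub ht) (hc t ht)⟩
  · exact hasDerivWithinAt_Ici_of_Icc (γ.a_deriv t (hsub ⟨ht.1, ht.2.le⟩) (hc t ⟨ht.1, ht.2.le⟩))
      ⟨hs.trans ht.1, ht.2.trans_le hu⟩
  · exact hasDerivWithinAt_Ici_of_Icc (γ.b_deriv t (hsub ⟨ht.1, ht.2.le⟩) (hc t ⟨ht.1, ht.2.le⟩))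
      ⟨hs.trans ht.1, ht.2.trans_le hu⟩

/-- On a closed interval without contact times the rate has a positive minimum. -/
theorem SlowOrbit.exists_track_regular (γ : SlowOrbit f₁ f₂ am ap)
    (hb : IsBounded (fun p => 1 + f₁ p) f₂ f₃ R L)
    (hbox : ∀ t ∈ Icc 0 γ.T, t ∉ γ.contact → InBox R (γ.a t) (γ.b t) (γ.z t)) {s u : ℝ}
    (hs : 0 ≤ s) (hsu : s ≤ u) (hu : u ≤ γ.T) (hc : ∀ t ∈ Icc s u, t ∉ γ.contact)
    {η : ℝ} (hη : 0 < η) :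
    ∃ ρ > 0, ∀ (e T : ℝ) (a b z : ℝ → ℝ), IsTraj (fun p => 1 + f₁ p) f₂ f₃ R e T a b z → e ≤ ρ →
      s ≤ T → Close a b z γ.a γ.b γ.z ρ s →
      ∀ t ∈ Icc s u, t ≤ T → Close a b z γ.a γ.b γ.z η t := by
  have hsub : Icc s u ⊆ Icc 0 γ.T := Icc_subset_Icc hs hu
  have hZ : ContinuousOn γ.z (Icc s u) := fun t ht =>
    (γ.z_cont t (hsub ht) (hc t ht)).mono hsub
  have hcont : ContinuousOn (fun t => 3 * γ.z t ^ 2 + γ.b t) (Icc s u) := by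
    have := γ.b_cont.mono hsub
    fun_prop
  obtain ⟨m, hm, hmin⟩ := isCompact_Icc.exists_isMinOn ⟨s, le_rfl, hsu⟩ hcont
  obtain ⟨ρ, hρ, H⟩ := hb.exists_track (γ.attracting m (hsub hm) (hc m hm)) (u - s) hη
  exact ⟨ρ, hρ, fun e T a b z ht he hsT hcl => H γ.a γ.b γ.z s u hs le_rfl
    (γ.isSlow hbox hs hu hc) hZ (fun t ht => hmin ht) e T a b z ht he hsT hcl⟩

/-- Tracking extends over an interval without contact times, uniformly in the fast variable. -/
theorem Good.extend {γ : SlowOrbit f₁ f₂ am ap}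
    (hb : IsBounded (fun p => 1 + f₁ p) f₂ f₃ R L)
    (hbox : ∀ t ∈ Icc 0 γ.T, t ∉ γ.contact → InBox R (γ.a t) (γ.b t) (γ.z t)) {s u : ℝ}
    (h : Good f₃ R γ s) (hs : 0 ≤ s) (hsu : s ≤ u) (hu : u ≤ γ.T)
    (hc : ∀ t ∈ Icc s u, t ∉ γ.contact) :
    Good f₃ R γ u ∧ TracksOn f₁ f₂ f₃ R γ.a γ.b γ.z s u := by
  have key : ∀ η > 0, ∃ ρ > 0, ∀ (e T : ℝ) (a b z : ℝ → ℝ),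
      IsTraj (fun p => 1 + f₁ p) f₂ f₃ R e T a b z → e ≤ ρ → 0 ≤ T →
      Close a b z γ.a γ.b γ.z ρ 0 →
      ∀ t ∈ Icc s u, t ≤ T → Close a b z γ.a γ.b γ.z η t := by
    intro η hη
    obtain ⟨ρ, hρ, H⟩ := γ.exists_track_regular hb hbox hs hsu hu hc hη
    obtain ⟨ρ', hρ', H'⟩ := h.1.close (h.2 s ⟨hs, le_rfl⟩ (hc s ⟨le_rfl, hsu⟩)) hs hρ
    refine ⟨min ρ ρ', lt_min hρ hρ', fun e T a b z ht he hT hcl t hts htT => ?_⟩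
    refine H e T a b z ht (he.trans (min_le_left _ _)) (hts.1.trans htT) ?_ t hts htT
    exact H' e T a b z ht (he.trans (min_le_right _ _)) hT ⟨hcl.1.trans (min_le_right _ _),
      hcl.2.1.trans (min_le_right _ _), hcl.2.2.trans (min_le_right _ _)⟩ (hts.1.trans htT)
  refine ⟨⟨fun η hη => ?_, fun t ht htc => ?_⟩, fun η hη => ?_⟩
  · obtain ⟨ρ, hρ, H⟩ := h.1 η hη
    obtain ⟨ρ', hρ', H'⟩ := key η hη
    refine ⟨min ρ ρ', lt_min hρ hρ', fun e T a b z ht he hT hcl t hts htT => ?_⟩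
    rcases le_total t s with hle | hle
    · exact H e T a b z ht (he.trans (min_le_left _ _)) hT ⟨hcl.1.trans (min_le_left _ _),
        hcl.2.1.trans (min_le_left _ _), hcl.2.2.trans (min_le_left _ _)⟩ t ⟨hts.1, hle⟩ htT
    · have := H' e T a b z ht (he.trans (min_le_right _ _)) hT ⟨hcl.1.trans (min_le_right _ _),
        hcl.2.1.trans (min_le_right _ _), hcl.2.2.trans (min_le_right _ _)⟩ t ⟨hle, hts.2⟩ htT
      exact ⟨this.1, this.2.1⟩
  · rcases le_total t s with hle | hle
    · exact h.2 t ⟨ht.1, hle⟩ htc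
    · intro η hη
      obtain ⟨ρ, hρ, H⟩ := key η hη
      refine ⟨ρ, hρ, fun e T a b z htr he hT hcl x hx hxT => ?_⟩
      exact (H e T a b z htr he hT hcl x ⟨hle.trans hx.1, hx.2.trans ht.2⟩ hxT).2.2
  · obtain ⟨ρ, hρ, H⟩ := key η hη
    exact ⟨ρ, hρ, fun e T a b z htr he hT hcl x hx hxT =>
      (H e T a b z htr he hT hcl x hx hxT).2.2⟩

/-- A slow orbit near an isolated contact time. -/
theorem SlowOrbit.isContact (γ : SlowOrbit f₁ f₂ am ap)
    (hbox : ∀ t ∈ Icc 0 γ.T, t ∉ γ.contact → InBox R (γ.a t) (γ.b t) (γ.z t)) {s₀ tc u₁ : ℝ}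
    (htc : tc ∈ γ.contact) (hs₀ : 0 ≤ s₀) (hs₀tc : s₀ < tc) (hu₁tc : tc < u₁) (hu₁ : u₁ ≤ γ.T)
    (hc : ∀ t ∈ Icc s₀ u₁, t ≠ tc → t ∉ γ.contact) :
    ∃ ζ, IsContact (fun p => 1 + f₁ p) f₂ R s₀ tc u₁ γ.a γ.b γ.z ζ := by
  obtain ⟨ζ, hl, hr, hf, htr⟩ := γ.jump tc htc
  have hsub : Icc s₀ u₁ ⊆ Icc 0 γ.T := Icc_subset_Icc hs₀ hu₁
  refine ⟨ζ, hs₀, hs₀tc, hu₁tc, γ.a_cont.mono hsub, γ.b_cont.mono hsub, fun t ht => ?_,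
    fun t ht htc => ?_, fun t ht htc => ?_, fun t ht htc => ?_, fun t ht htc => ?_,
    fun t ht htc => ?_, hl, hr, hf, htr⟩
  · have htI : t ∈ Icc s₀ u₁ := ⟨hs₀tc.le.trans ht.1.le, ht.2⟩
    exact (γ.z_cont t (hsub htI) (hc t htI ht.1.ne')).mono
      fun x hx => hsub ⟨hs₀tc.le.trans hx.1.le, hx.2⟩
  · have htI : t ∈ Icc s₀ u₁ := ⟨ht.1, ht.2.le⟩
    exact hasDerivWithinAt_Ici_of_Icc (γ.a_deriv t (hsub htI) (hc t htI htc))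
      ⟨hs₀.trans ht.1, ht.2.trans_le hu₁⟩
  · have htI : t ∈ Icc s₀ u₁ := ⟨ht.1, ht.2.le⟩
    exact hasDerivWithinAt_Ici_of_Icc (γ.b_deriv t (hsub htI) (hc t htI htc))
      ⟨hs₀.trans ht.1, ht.2.trans_le hu₁⟩
  · exact γ.mem_slowManifold t (hsub ht) (hc t ht htc)
  · exact hbox t (hsub ht) (hc t ht htc)
  · exact γ.attracting t (hsub ht) (hc t ht htc)

/-- Tracking extends beyond a contact time. -/
theorem SlowOrbit.exists_good_of_contact (γ : SlowOrbit f₁ f₂ am ap)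
    (hb : IsBounded (fun p => 1 + f₁ p) f₂ f₃ R L)
    (hbox : ∀ t ∈ Icc 0 γ.T, t ∉ γ.contact → InBox R (γ.a t) (γ.b t) (γ.z t)) {s₀ tc u₁ : ℝ}
    (htc : tc ∈ γ.contact) (hs₀ : 0 ≤ s₀) (hs₀tc : s₀ < tc) (hu₁tc : tc < u₁) (hu₁ : u₁ ≤ γ.T)
    (hc : ∀ t ∈ Icc s₀ u₁, t ≠ tc → t ∉ γ.contact) (hgood : ∀ s ∈ Ico s₀ tc, Good f₃ R γ s) :
    ∃ u ∈ Ioo tc u₁, Good f₃ R γ u := by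
  obtain ⟨ζ, hζ⟩ := γ.isContact hbox htc hs₀ hs₀tc hu₁tc hu₁ hc
  obtain ⟨u₂, hu₂, hpass⟩ := hζ.exists_passes hb
  obtain ⟨u, htu, hu⟩ := exists_between (lt_min hu₂ hu₁tc)
  have key : ∀ x ∈ Ioc tc u, ∀ η > 0, ∃ ρ > 0, ∀ (e T : ℝ) (a b z : ℝ → ℝ),
      IsTraj (fun p => 1 + f₁ p) f₂ f₃ R e T a b z → e ≤ ρ → 0 ≤ T →
      Close a b z γ.a γ.b γ.z ρ 0 →
      (∀ t ∈ Icc 0 x, t ≤ T → |a t - γ.a t| ≤ η ∧ |b t - γ.b t| ≤ η) ∧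
      (x ≤ T → |z x - γ.z x| ≤ η) := by
    intro x hx η hη
    obtain ⟨s, hs, ρ, hρ, H⟩ := hpass x ⟨hx.1, hx.2.trans_lt (hu.trans_le (min_le_left _ _))⟩ η hη
    have hs0 : 0 ≤ s := hs₀.trans hs.1.le
    obtain ⟨hto, hon⟩ := hgood s ⟨hs.1.le, hs.2⟩
    have hsc : s ∉ γ.contact := hc s ⟨hs.1.le, (hs.2.trans hu₁tc).le⟩ hs.2.ne
    obtain ⟨ρ', hρ', H'⟩ := hto.close (hon s ⟨hs0, le_rfl⟩ hsc) hs0 hρ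
    obtain ⟨ρ₂, hρ₂, H₂⟩ := hto η hη
    refine ⟨min ρ (min ρ' ρ₂), by positivity, fun e T a b z ht he hT hcl => ?_⟩
    have hcl' : ∀ ρ'', min ρ (min ρ' ρ₂) ≤ ρ'' → Close a b z γ.a γ.b γ.z ρ'' 0 := fun ρ'' h =>
      ⟨hcl.1.trans h, hcl.2.1.trans h, hcl.2.2.trans h⟩
    have hm' : min ρ (min ρ' ρ₂) ≤ ρ' := (min_le_right _ _).trans (min_le_left _ _)
    have hm₂ : min ρ (min ρ' ρ₂) ≤ ρ₂ := (min_le_right _ _).trans (min_le_right _ _)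
    have h1 : s ≤ T → _ := fun hsT => H e T a b z ht (he.trans (min_le_left _ _)) hsT
      (H' e T a b z ht (he.trans hm') hT (hcl' _ hm') hsT)
    refine ⟨fun t hts htT => ?_, fun hxT => (h1 ((hs.2.trans hx.1).le.trans hxT)).2 hxT⟩
    rcases le_total t s with hle | hle
    · exact H₂ e T a b z ht (he.trans hm₂) hT (hcl' _ hm₂) t ⟨hts.1, hle⟩ htT
    · exact (h1 (hle.trans htT)).1 t ⟨hle, hts.2⟩ htT
  refine ⟨u, ⟨htu, hu.trans_le (min_le_right _ _)⟩, fun η hη => ?_, fun t ht htc' => ?_⟩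
  · obtain ⟨ρ, hρ, H⟩ := key u ⟨htu, le_rfl⟩ η hη
    exact ⟨ρ, hρ, fun e T a b z ht he hT hcl => (H e T a b z ht he hT hcl).1⟩
  · have hne : t ≠ tc := fun h => htc' (h ▸ htc)
    rcases lt_or_gt_of_ne hne with hlt | hgt
    · exact (hgood (max s₀ t) ⟨le_max_left _ _, max_lt hs₀tc hlt⟩).2 t
        ⟨ht.1, le_max_right _ _⟩ htc'
    · intro η hη
      obtain ⟨ρ, hρ, H⟩ := key t ⟨hgt, ht.2⟩ η hη
      refine ⟨ρ, hρ, fun e T a b z htr he hT hcl x hx hxT => ?_⟩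
      obtain rfl : x = t := le_antisymm hx.2 hx.1
      exact (H e T a b z htr he hT hcl).2 hxT

/-- Around any time there is an open interval without other contact times. -/
theorem SlowOrbit.exists_isolating (γ : SlowOrbit f₁ f₂ am ap) (t : ℝ) :
    ∃ δ > 0, ∀ x, |x - t| < δ → x ≠ t → x ∉ γ.contact := by
  have h1 : ((γ.contact.erase t : Finset ℝ) : Set ℝ)ᶜ ∈ 𝓝 t :=
    (Finset.isClosed _).isOpen_compl.mem_nhds (by simp)
  obtain ⟨δ, hδ, H⟩ := Metric.mem_nhds_iff.1 h1
  refine ⟨δ, hδ, fun x hx hne hxc => ?_⟩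
  have := H (show x ∈ Metric.ball t δ by rwa [Metric.mem_ball, Real.dist_eq])
  simp [hne, hxc] at this

/-- Trajectories track a slow orbit up to its end. -/
theorem SlowOrbit.good (γ : SlowOrbit f₁ f₂ am ap)
    (hb : IsBounded (fun p => 1 + f₁ p) f₂ f₃ R L)
    (hbox : ∀ t ∈ Icc 0 γ.T, t ∉ γ.contact → InBox R (γ.a t) (γ.b t) (γ.z t)) :
    Good f₃ R γ γ.T := by
  have hc0 : (0 : ℝ) ∉ γ.contact := fun h => lt_irrefl _ (γ.contact_mem 0 h).1
  have h0 : Good f₃ R γ 0 := by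
    refine ⟨fun η hη => ⟨η, hη, fun e T a b z _ _ _ hcl t ht _ => ?_⟩, fun t ht _ η hη =>
      ⟨η, hη, fun e T a b z _ _ _ hcl x hx _ => ?_⟩⟩
    · obtain rfl : t = 0 := le_antisymm ht.2 ht.1
      exact ⟨hcl.1, hcl.2.1⟩
    · obtain rfl : t = 0 := le_antisymm ht.2 ht.1
      obtain rfl : x = 0 := le_antisymm hx.2 hx.1
      exact hcl.2.2
  -- consider the supremum of the times up to which tracking holds
  set S := {s | s ∈ Icc 0 γ.T ∧ Good f₃ R γ s} with hS
  have h0S : (0 : ℝ) ∈ S := ⟨⟨le_rfl, γ.T_pos.le⟩, h0⟩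
  have hbdd : BddAbove S := ⟨γ.T, fun s hs => hs.1.2⟩
  set m := sSup S with hm
  have hm0 : 0 ≤ m := le_csSup hbdd h0S
  have hmT : m ≤ γ.T := csSup_le ⟨0, h0S⟩ fun s hs => hs.1.2
  obtain ⟨δ, hδ, hiso⟩ := γ.exists_isolating m
  by_cases hmc : m ∈ γ.contact
  · exfalso
    obtain ⟨hm0', hmT'⟩ := γ.contact_mem m hmc
    have hs₀ : max 0 (m - δ / 2) < m := max_lt hm0' (by linarith)
    have hu₁ : m < min γ.T (m + δ / 2) := lt_min hmT' (by linarith)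
    obtain ⟨u, hu, hgood⟩ := γ.exists_good_of_contact (f₃ := f₃) hb hbox hmc (le_max_left _ _) hs₀
      hu₁ (min_le_left _ _) (fun t ht hne => hiso t (by
        rw [abs_lt]
        constructor <;> linarith [ht.1, ht.2, le_max_right 0 (m - δ / 2),
          min_le_right γ.T (m + δ / 2)]) hne)
      (fun s hs => by
        obtain ⟨s', hs', hlt⟩ := exists_lt_of_lt_csSup ⟨0, h0S⟩ hs.2
        exact hs'.2.mono hlt.le)
    have := le_csSup hbdd (show u ∈ S from ⟨⟨(hm0'.trans hu.1).le,
      (hu.2.trans_le (min_le_left _ _)).le⟩, hgood⟩)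
    linarith [hu.1]
  · obtain ⟨s, hs, hlt⟩ := exists_lt_of_lt_csSup ⟨0, h0S⟩ (show m - δ < m by linarith)
    have hsm : s ≤ m := le_csSup hbdd hs
    have hu : m ≤ min γ.T (m + δ / 2) := le_min hmT (by linarith)
    have hgood := (hs.2.extend hb hbox hs.1.1 (hsm.trans hu) (min_le_left _ _) (fun t ht => by
      by_cases hne : t = m
      · rwa [hne]
      · refine hiso t ?_ hne
        rw [abs_lt]
        constructor <;> linarith [ht.1, ht.2, min_le_right γ.T (m + δ / 2)])).1
    have hle := le_csSup hbdd (show min γ.T (m + δ / 2) ∈ S from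
      ⟨⟨hm0.trans hu, min_le_left _ _⟩, hgood⟩)
    rcases min_le_iff.1 hle with h | h
    · exact hgood.mono (le_min le_rfl (by linarith))
    · linarith

end Global

/-! ### Arrival at `Σ⁺` -/

variable {f₁ f₂ f₃ : ℝ × ℝ × ℝ × ℝ → ℝ} {am ap : ℝ}

/-- A smooth function is bounded and Lipschitz on a box. -/
theorem exists_bound_and_lipschitz {f : ℝ × ℝ × ℝ × ℝ → ℝ} (hf : ContDiff ℝ ∞ f) (R : ℝ) :
    ∃ L, 0 ≤ L ∧ (∀ a b z e, InBox R a b z → 0 ≤ e → e ≤ 1 → |f (a, b, z, e)| ≤ L) ∧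
      ∀ a b z a' b' z' e, InBox R a b z → InBox R a' b' z' → 0 ≤ e → e ≤ 1 →
        |f (a, b, z, e) - f (a', b', z', 0)| ≤ L * (|a - a'| + |b - b'| + |z - z'| + e) := by
  set K : Set (ℝ × ℝ × ℝ × ℝ) := Icc (-R) R ×ˢ Icc (-R) R ×ˢ Icc (-R) R ×ˢ Icc 0 1 with hK
  have hKc : IsCompact K :=
    isCompact_Icc.prod (isCompact_Icc.prod (isCompact_Icc.prod isCompact_Icc))
  have hKv : Convex ℝ K := (convex_Icc _ _).prod
    ((convex_Icc _ _).prod ((convex_Icc _ _).prod (convex_Icc _ _)))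
  obtain ⟨C₁, hC₁⟩ := hKc.exists_bound_of_continuousOn hf.continuous.continuousOn
  obtain ⟨C₂, hC₂⟩ := hKc.exists_bound_of_continuousOn
    (hf.continuous_fderiv (by simp)).continuousOn
  have hmem : ∀ a b z e, InBox R a b z → 0 ≤ e → e ≤ 1 → (a, b, z, e) ∈ K :=
    fun a b z e h h0 h1 => ⟨abs_le.1 h.1, abs_le.1 h.2.1, abs_le.1 h.2.2, h0, h1⟩
  refine ⟨max 0 (max C₁ C₂), le_max_left _ _, fun a b z e h h0 h1 => ?_,
    fun a b z a' b' z' e h h' h0 h1 => ?_⟩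
  · exact (hC₁ _ (hmem a b z e h h0 h1)).trans ((le_max_left _ _).trans (le_max_right _ _))
  · have h2 := hKv.norm_image_sub_le_of_norm_fderiv_le
      (fun x _ => (hf.differentiable (by simp)).differentiableAt (x := x)) hC₂
      (hmem a' b' z' 0 h' le_rfl zero_le_one) (hmem a b z e h h0 h1)
    rw [Real.norm_eq_abs] at h2
    refine h2.trans (mul_le_mul ((le_max_right _ _).trans (le_max_right _ _)) ?_ (norm_nonneg _)
      (le_max_left _ _))
    have e1 := abs_nonneg (a - a')
    have e2 := abs_nonneg (b - b')
    have e3 := abs_nonneg (z - z')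
    simp only [Prod.norm_def, Prod.fst_sub, Prod.snd_sub, Real.norm_eq_abs, sub_zero,
      abs_of_nonneg h0]
    exact max_le (by linarith) (max_le (by linarith) (max_le (by linarith) (by linarith)))

theorem exists_isBounded (hf₁ : ContDiff ℝ ∞ f₁) (hf₂ : ContDiff ℝ ∞ f₂) (hf₃ : ContDiff ℝ ∞ f₃)
    {R : ℝ} (hR : 1 ≤ R) : ∃ L, IsBounded (fun p => 1 + f₁ p) f₂ f₃ R L := by
  obtain ⟨L₁, h₁0, h₁, h₁'⟩ := exists_bound_and_lipschitz (contDiff_const.add hf₁ :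
    ContDiff ℝ ∞ fun p => 1 + f₁ p) R
  obtain ⟨L₂, h₂0, h₂, h₂'⟩ := exists_bound_and_lipschitz hf₂ R
  obtain ⟨L₃, h₃0, h₃, -⟩ := exists_bound_and_lipschitz hf₃ R
  refine ⟨1 + L₁ + L₂ + L₃, hR, by linarith, fun a b z e h h0 h1 => ?_,
    fun a b z e h h0 h1 => ?_, fun a b z e h h0 h1 => ?_, fun a b z a' b' z' e h h' h0 h1 => ?_,
    fun a b z a' b' z' e h h' h0 h1 => ?_⟩
  · linarith [h₁ a b z e h h0 h1]
  · linarith [h₂ a b z e h h0 h1]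
  · linarith [h₃ a b z e h h0 h1]
  · exact (h₁' a b z a' b' z' e h h' h0 h1).trans
      (mul_le_mul_of_nonneg_right (by linarith) (by positivity))
  · exact (h₂' a b z a' b' z' e h h' h0 h1).trans
      (mul_le_mul_of_nonneg_right (by linarith) (by positivity))

theorem abs_le_of_cubic_eq_zero {z a b r : ℝ} (hr : 0 ≤ r) (ha : |a| ≤ r) (hb : |b| ≤ r)
    (h : cubic z a b = 0) : |z| ≤ r + 1 := by
  by_contra! hlt
  have h1 : |z| ^ 3 ≤ r * |z| + r := by
    have : z ^ 3 = -(b * z) - a := by unfold cubic at h; linarith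
    rw [← abs_pow, this]
    refine (abs_sub _ _).trans (add_le_add ?_ ha)
    rw [abs_neg, abs_mul]
    exact mul_le_mul_of_nonneg_right hb (abs_nonneg _)
  nlinarith [mul_pos (show 0 < |z| by linarith) (show 0 < |z| by linarith)]

/-- Near its end, the slow orbit captures the trajectories: up to a time `δ` after the end they stay
within `κ` of the end point. -/
theorem SlowOrbit.exists_end_near (γ : SlowOrbit f₁ f₂ am ap)
    (hb : IsBounded (fun p => 1 + f₁ p) f₂ f₃ R L)
    (hbox : ∀ t ∈ Icc 0 γ.T, t ∉ γ.contact → InBox R (γ.a t) (γ.b t) (γ.z t)) {κ : ℝ}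
    (hκ : 0 < κ) :
    ∃ t₀, 0 ≤ t₀ ∧ t₀ < γ.T ∧ ∃ δ₀ > 0, ∀ δ, 0 < δ → δ ≤ δ₀ → ∃ ρ > 0, ∀ (e T : ℝ) (a b z : ℝ → ℝ),
      IsTraj (fun p => 1 + f₁ p) f₂ f₃ R e T a b z → e ≤ ρ → 0 ≤ T → T ≤ γ.T + δ →
      Close a b z γ.a γ.b γ.z ρ 0 →
      ∀ t ∈ Icc t₀ T, |a t - ap| ≤ κ ∧ |b t - γ.b γ.T| ≤ κ ∧ |z t - γ.z γ.T| ≤ κ := by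
  have hL := hb.one_le_L
  have hR := hb.one_le_R
  have hT := γ.T_pos
  have hTc : γ.T ∉ γ.contact := fun h => lt_irrefl _ (γ.contact_mem _ h).2
  have hTI : γ.T ∈ Icc 0 γ.T := ⟨hT.le, le_rfl⟩
  have haT : γ.a γ.T = ap := γ.end_mem.1
  have hzT : γ.z γ.T < 0 := γ.end_mem.2
  have hlam := γ.attracting γ.T hTI hTc
  have hS : cubic (γ.z γ.T) ap (γ.b γ.T) = 0 := by
    have : cubic (γ.z γ.T) (γ.a γ.T) (γ.b γ.T) = 0 := γ.mem_slowManifold γ.T hTI hTc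
    rwa [haT] at this
  obtain ⟨l, hl⟩ : ∃ l, l = 3 * γ.z γ.T ^ 2 + γ.b γ.T := ⟨_, rfl⟩
  rw [← hl] at hlam
  obtain ⟨zE, hzE⟩ : ∃ zE, zE = γ.z γ.T := ⟨_, rfl⟩
  obtain ⟨bE, hbE⟩ : ∃ bE, bE = γ.b γ.T := ⟨_, rfl⟩
  rw [← hzE, ← hbE] at hl hS
  rw [← hzE] at hzT
  -- the half-width `r` of the tube in the fast direction
  obtain ⟨r, hr0, hrκ, hrl⟩ : ∃ r : ℝ, 0 < r ∧ r ≤ κ ∧ -(3 * zE * r) ≤ l / 2 := by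
    have h3 : 0 < -(6 * zE) := by linarith
    refine ⟨min κ (l / -(6 * zE)), by positivity, min_le_left _ _, ?_⟩
    have := min_le_right κ (l / -(6 * zE))
    rw [le_div_iff₀ h3] at this
    linarith
  have hup : r * (l / 2) ≤ cubic (zE + r) ap bE := by
    have : cubic (zE + r) ap bE = cubic zE ap bE + r * (l + 3 * zE * r + r ^ 2) := by
      rw [hl]; unfold cubic; ring
    rw [this, hS, zero_add]
    exact mul_le_mul_of_nonneg_left (by nlinarith) hr0.le
  have hlow : cubic (zE - r) ap bE ≤ -(r * (l / 2)) := by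
    have : cubic (zE - r) ap bE = cubic zE ap bE - r * (l - 3 * zE * r + r ^ 2) := by
      rw [hl]; unfold cubic; ring
    rw [this, hS, zero_sub]
    refine neg_le_neg (mul_le_mul_of_nonneg_left ?_ hr0.le)
    nlinarith
  obtain ⟨w, hw0, hw⟩ : ∃ w : ℝ, 0 < w ∧ w = r * (l / 2) := ⟨_, by positivity, rfl⟩
  rw [← hw] at hup hlow
  obtain ⟨d, hd0, hdκ, hdw⟩ : ∃ d : ℝ, 0 < d ∧ d ≤ κ ∧ (1 + R) * d ≤ w / 2 := by
    refine ⟨min κ (w / (2 * (1 + R))), by positivity, min_le_left _ _, ?_⟩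
    have := min_le_right κ (w / (2 * (1 + R)))
    rw [le_div_iff₀ (by positivity)] at this
    linarith
  -- the time `t₀` from which the slow orbit itself is near its end point
  obtain ⟨δ', hδ', hiso⟩ := γ.exists_isolating γ.T
  have hnearT : ∀ᶠ t in 𝓝[Icc 0 γ.T] γ.T,
      |γ.a t - ap| < d / 2 ∧ |γ.b t - bE| < d / 2 ∧ |γ.z t - zE| < r / 2 := by
    have e1 := ((γ.a_cont γ.T hTI).sub_const ap).abs
    have e2 := ((γ.b_cont γ.T hTI).sub_const bE).abs
    have e3 := ((γ.z_cont γ.T hTI hTc).sub_const zE).abs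
    rw [haT, sub_self, abs_zero] at e1
    rw [← hbE, sub_self, abs_zero] at e2
    rw [← hzE, sub_self, abs_zero] at e3
    exact (e1.eventually_lt_const (half_pos hd0)).and
      ((e2.eventually_lt_const (half_pos hd0)).and (e3.eventually_lt_const (half_pos hr0)))
  obtain ⟨δ'', hδ'', hball⟩ := Metric.mem_nhdsWithin_iff.1 hnearT
  obtain ⟨t₀, ht₀, ht₀T⟩ := exists_between
    (show max 0 (max (γ.T - δ') (γ.T - δ'')) < γ.T from max_lt hT (max_lt (by linarith)
      (by linarith)))
  have ht₀0 : 0 ≤ t₀ := (le_max_left _ _).trans ht₀.le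
  have ht₀1 : γ.T - δ' < t₀ := ((le_max_left _ _).trans (le_max_right _ _)).trans_lt ht₀
  have ht₀2 : γ.T - δ'' < t₀ := ((le_max_right _ _).trans (le_max_right _ _)).trans_lt ht₀
  have hslow : ∀ t ∈ Icc t₀ γ.T,
      |γ.a t - ap| < d / 2 ∧ |γ.b t - bE| < d / 2 ∧ |γ.z t - zE| < r / 2 := fun t ht =>
    hball ⟨by rw [Metric.mem_ball, Real.dist_eq, abs_lt]; constructor <;> linarith [ht.1, ht.2],
      ht₀0.trans ht.1, ht.2⟩
  have hgood := γ.good (f₃ := f₃) hb hbox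
  have hon := ((hgood.mono ht₀T.le).extend hb hbox ht₀0 ht₀T.le le_rfl (fun t ht => by
    by_cases hne : t = γ.T
    · rwa [hne]
    · exact hiso t (by rw [abs_lt]; constructor <;> linarith [ht.1, ht.2]) hne)).2
  refine ⟨t₀, ht₀0, ht₀T, d / (4 * L), by positivity, fun δ hδ hδd => ?_⟩
  have hLδ : L * δ ≤ d / 4 := by
    rw [le_div_iff₀ (by positivity)] at hδd
    linarith
  obtain ⟨ρ₁, hρ₁, H₁⟩ := hgood.1 (d / 4) (by positivity)
  obtain ⟨ρ₂, hρ₂, H₂⟩ := hon (r / 2) (half_pos hr0)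
  refine ⟨min (min ρ₁ ρ₂) (w / (4 * L)), by positivity,
    fun e T a b z ht heρ hT0 hTδ hcl t hts => ?_⟩
  have hρm₁ : min (min ρ₁ ρ₂) (w / (4 * L)) ≤ ρ₁ := (min_le_left _ _).trans (min_le_left _ _)
  have hρm₂ : min (min ρ₁ ρ₂) (w / (4 * L)) ≤ ρ₂ := (min_le_left _ _).trans (min_le_right _ _)
  have heL : e * L ≤ w / 4 := by
    have := heρ.trans (min_le_right _ _)
    rw [le_div_iff₀ (by positivity)] at this
    linarith
  have k1 := H₁ e T a b z ht (heρ.trans hρm₁) hT0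
    ⟨hcl.1.trans hρm₁, hcl.2.1.trans hρm₁, hcl.2.2.trans hρm₁⟩
  have k2 := H₂ e T a b z ht (heρ.trans hρm₂) hT0
    ⟨hcl.1.trans hρm₂, hcl.2.1.trans hρm₂, hcl.2.2.trans hρm₂⟩
  have hbefore : ∀ x ∈ Icc t₀ γ.T, x ≤ T → |a x - ap| ≤ d ∧ |b x - bE| ≤ d ∧ |z x - zE| ≤ r := by
    intro x hx hxT
    obtain ⟨s1, s2, s3⟩ := hslow x hx
    obtain ⟨q1, q2⟩ := k1 x ⟨ht₀0.trans hx.1, hx.2⟩ hxT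
    have q3 := k2 x hx hxT
    exact ⟨by linarith [abs_sub_le (a x) (γ.a x) ap], by linarith [abs_sub_le (b x) (γ.b x) bE],
      by linarith [abs_sub_le (z x) (γ.z x) zE]⟩
  rw [← hbE, ← hzE]
  rcases le_total t γ.T with hle | hle
  · obtain ⟨q1, q2, q3⟩ := hbefore t ⟨hts.1, hle⟩ hts.2
    exact ⟨q1.trans hdκ, q2.trans hdκ, q3.trans hrκ⟩
  · have hTT : γ.T ≤ T := hle.trans hts.2
    obtain ⟨-, -, q3⟩ := hbefore γ.T ⟨ht₀T.le, le_rfl⟩ hTT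
    have q12 := k1 γ.T hTI hTT
    rw [haT, ← hbE] at q12
    have hab : ∀ x ∈ Icc γ.T T, |a x - ap| ≤ d ∧ |b x - bE| ≤ d := by
      intro x hx
      have h1 := ht.drift hb hT.le hx.1 hx.2
      have h2 : L * (x - γ.T) ≤ L * δ :=
        mul_le_mul_of_nonneg_left (by linarith [hx.2]) (by linarith)
      exact ⟨by linarith [abs_sub_le (a x) (a γ.T) ap], by linarith [abs_sub_le (b x) (b γ.T) bE]⟩
    have hcub : ∀ x ∈ Icc γ.T T, ∀ m, |m| ≤ R → |cubic m (a x) (b x) - cubic m ap bE| ≤ w / 2 := by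
      intro x hx m hm
      obtain ⟨h1, h2⟩ := hab x hx
      have h3 : cubic m (a x) (b x) - cubic m ap bE = m * (b x - bE) + (a x - ap) := by
        unfold cubic; ring
      rw [h3]
      refine (abs_add_le _ _).trans (le_trans ?_ hdw)
      rw [abs_mul]
      have := mul_le_mul hm h2 (abs_nonneg _) (by linarith)
      linarith
    have hbz : ∀ x ∈ Ico γ.T T, |z x| ≤ R := fun x hx =>
      (ht.box x ⟨hT.le.trans hx.1, hx.2.le⟩).2.2
    have hzup := ht.z_le hb (s := γ.T) (u := T) (m := zE + r) hT.le le_rfl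
      (by linarith [(abs_le.1 q3).2]) (fun x hx hxm => by
        have := (abs_le.1 (hcub x ⟨hx.1, hx.2.le⟩ _ (hxm ▸ hbz x hx))).1
        linarith) t ⟨hle, hts.2⟩
    have hzlow := ht.le_z hb (s := γ.T) (u := T) (m := zE - r) hT.le le_rfl
      (by linarith [(abs_le.1 q3).1]) (fun x hx hxm => by
        have := (abs_le.1 (hcub x ⟨hx.1, hx.2.le⟩ _ (hxm ▸ hbz x hx))).2
        linarith) t ⟨hle, hts.2⟩
    obtain ⟨h1, h2⟩ := hab t ⟨hle, hts.2⟩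
    exact ⟨h1.trans hdκ, h2.trans hdκ, abs_le.2 ⟨by linarith, by linarith⟩⟩

/-- A trajectory in the slow time on `[0, T]` that meets `Σ⁺` for the first time at `T`. -/
structure IsTransit (f₁ f₂ f₃ : ℝ × ℝ × ℝ × ℝ → ℝ) (ap e T : ℝ) (a b z : ℝ → ℝ) : Prop where
  e_pos : 0 < e
  T_pos : 0 < T
  da : ∀ t ∈ Icc 0 T, HasDerivWithinAt a (1 + f₁ (a t, b t, z t, e)) (Icc 0 T) t
  db : ∀ t ∈ Icc 0 T, HasDerivWithinAt b (f₂ (a t, b t, z t, e)) (Icc 0 T) t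
  dz : ∀ t ∈ Icc 0 T, HasDerivWithinAt z
    (-(cubic (z t) (a t) (b t) + e * f₃ (a t, b t, z t, e)) / e) (Icc 0 T) t
  a_end : a T = ap
  z_end : z T < 0
  first : ∀ t ∈ Ico 0 T, ¬ (a t = ap ∧ z t < 0)

theorem IsTransit.isTraj (h : IsTransit f₁ f₂ f₃ ap e T a b z) (he : e ≤ 1) {u : ℝ} (hu : u ≤ T)
    (hbox : ∀ t ∈ Icc 0 u, InBox R (a t) (b t) (z t)) :
    IsTraj (fun p => 1 + f₁ p) f₂ f₃ R e u a b z where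
  e_pos := h.e_pos
  e_le := he
  box := hbox
  da t ht := (h.da t ⟨ht.1, ht.2.trans hu⟩).mono (Icc_subset_Icc_right hu)
  db t ht := (h.db t ⟨ht.1, ht.2.trans hu⟩).mono (Icc_subset_Icc_right hu)
  dz t ht := (h.dz t ⟨ht.1, ht.2.trans hu⟩).mono (Icc_subset_Icc_right hu)

/-- The trajectories of the transition map that start near a slow orbit to `Σ⁺` stay in a fixed
box, have nearly the same duration and end near the end point of the slow orbit. -/
theorem SlowOrbit.exists_capture (γ : SlowOrbit f₁ f₂ am ap) (hf₁ : ContDiff ℝ ∞ f₁)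
    (hf₂ : ContDiff ℝ ∞ f₂) (hf₃ : ContDiff ℝ ∞ f₃) :
    ∃ R L, IsBounded (fun p => 1 + f₁ p) f₂ f₃ R L ∧
      (∀ t ∈ Icc 0 γ.T, t ∉ γ.contact → InBox R (γ.a t) (γ.b t) (γ.z t)) ∧
      ∀ κ > 0, ∃ t₀, 0 ≤ t₀ ∧ t₀ < γ.T ∧ ∃ ρ > 0, ∀ (e T : ℝ) (a b z : ℝ → ℝ),
        IsTransit f₁ f₂ f₃ ap e T a b z → e ≤ ρ → Close a b z γ.a γ.b γ.z ρ 0 →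
        IsTraj (fun p => 1 + f₁ p) f₂ f₃ R e T a b z ∧ t₀ ≤ T ∧ |T - γ.T| ≤ κ ∧
        ∀ t ∈ Icc t₀ T, |a t - ap| ≤ κ ∧ |b t - γ.b γ.T| ≤ κ ∧ |z t - γ.z γ.T| ≤ κ := by
  have hT := γ.T_pos
  obtain ⟨C₁, hC₁⟩ := isCompact_Icc.exists_bound_of_continuousOn γ.a_cont
  obtain ⟨C₂, hC₂⟩ := isCompact_Icc.exists_bound_of_continuousOn γ.b_cont
  obtain ⟨r, hr1, hrC₁, hrC₂⟩ : ∃ r : ℝ, 1 ≤ r ∧ C₁ ≤ r ∧ C₂ ≤ r :=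
    ⟨max 1 (max C₁ C₂), le_max_left _ _, (le_max_left _ _).trans (le_max_right _ _),
      (le_max_right _ _).trans (le_max_right _ _)⟩
  have hA : ∀ t ∈ Icc 0 γ.T, |γ.a t| ≤ r ∧ |γ.b t| ≤ r := fun t ht =>
    ⟨(hC₁ t ht).trans hrC₁, (hC₂ t ht).trans hrC₂⟩
  have hZ : ∀ t ∈ Icc 0 γ.T, t ∉ γ.contact → |γ.z t| ≤ r + 1 := fun t ht htc =>
    abs_le_of_cubic_eq_zero (by linarith) (hA t ht).1 (hA t ht).2 (γ.mem_slowManifold t ht htc)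
  obtain ⟨L, hb⟩ := exists_isBounded hf₁ hf₂ hf₃ (show 1 ≤ r + 4 by linarith)
  have hL := hb.one_le_L
  have hbox : ∀ t ∈ Icc 0 γ.T, t ∉ γ.contact → InBox (r + 4) (γ.a t) (γ.b t) (γ.z t) :=
    fun t ht htc => ⟨by linarith [(hA t ht).1], by linarith [(hA t ht).2],
      by linarith [hZ t ht htc]⟩
  have hTc : γ.T ∉ γ.contact := fun h => lt_irrefl _ (γ.contact_mem _ h).2
  have h0c : (0 : ℝ) ∉ γ.contact := fun h => lt_irrefl _ (γ.contact_mem _ h).1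
  have hTI : γ.T ∈ Icc 0 γ.T := ⟨hT.le, le_rfl⟩
  have h0I : (0 : ℝ) ∈ Icc 0 γ.T := ⟨le_rfl, hT.le⟩
  have hgood := γ.good (f₃ := f₃) hb hbox
  have haT : γ.a γ.T = ap := γ.end_mem.1
  refine ⟨r + 4, L, hb, hbox, fun κ hκ => ?_⟩
  -- close to the end point the slow flow crosses `Σ⁺` at a definite speed
  obtain ⟨k, hk0, hk⟩ : ∃ k, 0 < k ∧ k = 1 + f₁ (ap, γ.b γ.T, γ.z γ.T, 0) :=
    ⟨_, by have := γ.end_transversal; rwa [haT] at this, rfl⟩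
  have hzT : γ.z γ.T < 0 := γ.end_mem.2
  obtain ⟨κ', hκ'0, hκ'κ, hκ'1, hκ'k, hκ'z⟩ : ∃ κ' : ℝ, 0 < κ' ∧ κ' ≤ κ ∧ κ' ≤ 1 ∧
      L * (4 * κ') ≤ k / 2 ∧ κ' < -γ.z γ.T := by
    have h1 : 0 < -γ.z γ.T / 2 := by linarith
    refine ⟨min (min κ 1) (min (k / (8 * L)) (-γ.z γ.T / 2)), by positivity,
      (min_le_left _ _).trans (min_le_left _ _), (min_le_left _ _).trans (min_le_right _ _), ?_, ?_⟩
    · have : min (min κ 1) (min (k / (8 * L)) (-γ.z γ.T / 2)) ≤ k / (8 * L) :=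
        (min_le_right _ _).trans (min_le_left _ _)
      rw [le_div_iff₀ (by positivity)] at this
      linarith
    · have : min (min κ 1) (min (k / (8 * L)) (-γ.z γ.T / 2)) ≤ -γ.z γ.T / 2 :=
        (min_le_right _ _).trans (min_le_right _ _)
      linarith
  obtain ⟨t₀, ht₀0, ht₀T, δ₀, hδ₀, hend⟩ := γ.exists_end_near (f₃ := f₃) hb hbox hκ'0
  obtain ⟨δ, hδ0, hδδ₀, hδκ⟩ : ∃ δ : ℝ, 0 < δ ∧ δ ≤ δ₀ ∧ δ ≤ κ :=
    ⟨min δ₀ κ, lt_min hδ₀ hκ, min_le_left _ _, min_le_right _ _⟩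
  obtain ⟨ρ₁, hρ₁, hend⟩ := hend δ hδ0 hδδ₀
  -- a time `t₁` up to which the trajectories have not reached `Σ⁺`
  obtain ⟨t₁, ht₁, ht₁T⟩ := exists_between
    (show max t₀ (γ.T - κ) < γ.T from max_lt ht₀T (by linarith))
  have ht₁0 : t₀ < t₁ := (le_max_left _ _).trans_lt ht₁
  have ht₁κ : γ.T - κ < t₁ := (le_max_right _ _).trans_lt ht₁
  obtain ⟨c, hc0, hc⟩ : ∃ c > 0, ∀ t ∈ Icc 0 t₁, γ.a t ≤ ap - c := by
    obtain ⟨m, hm, hmax⟩ := isCompact_Icc.exists_isMaxOn ⟨0, le_rfl, ht₀0.trans ht₁0.le⟩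
      (γ.a_cont.mono (Icc_subset_Icc_right ht₁T.le))
    have := γ.a_lt m ⟨hm.1, hm.2.trans_lt ht₁T⟩
    exact ⟨ap - γ.a m, by linarith, fun t ht => by
      have : γ.a t ≤ γ.a m := hmax ht
      linarith⟩
  obtain ⟨η, hη0, hηc, hη1, hηk⟩ : ∃ η : ℝ, 0 < η ∧ η < c ∧ η ≤ 1 ∧ η < k / 2 * δ := by
    refine ⟨min (c / 2) (min 1 (k / 4 * δ)), by positivity,
      (min_le_left _ _).trans_lt (by linarith), (min_le_right _ _).trans (min_le_left _ _), ?_⟩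
    have h1 : min (c / 2) (min 1 (k / 4 * δ)) ≤ k / 4 * δ :=
      (min_le_right _ _).trans (min_le_right _ _)
    have h2 : 0 < k * δ := by positivity
    linarith
  obtain ⟨ρ₂, hρ₂, hto⟩ := hgood.1 η hη0
  obtain ⟨ρ, hρ0, hρρ₁, hρρ₂, hρ1, hρL, hρκ⟩ : ∃ ρ : ℝ, 0 < ρ ∧ ρ ≤ ρ₁ ∧ ρ ≤ ρ₂ ∧ ρ ≤ 1 ∧
      ρ * L ≤ 1 ∧ ρ ≤ κ' := by
    refine ⟨min (min ρ₁ ρ₂) (min (1 / L) κ'), by positivity,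
      (min_le_left _ _).trans (min_le_left _ _), (min_le_left _ _).trans (min_le_right _ _),
      ?_, ?_, (min_le_right _ _).trans (min_le_right _ _)⟩
    · refine ((min_le_right _ _).trans (min_le_left _ _)).trans ?_
      rw [div_le_one (by linarith)]; exact hL
    · rw [← le_div_iff₀ (by linarith)]
      exact (min_le_right _ _).trans (min_le_left _ _)
  -- trajectories in the box are strictly inside of it
  have hinside : ∀ (e T : ℝ) (a b z : ℝ → ℝ),
      IsTraj (fun p => 1 + f₁ p) f₂ f₃ (r + 4) e T a b z → e ≤ ρ → 0 ≤ T → T ≤ γ.T + δ →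
      Close a b z γ.a γ.b γ.z ρ 0 → |a T| < r + 4 ∧ |b T| < r + 4 ∧ |z T| < r + 4 := by
    intro e T a b z ht heρ hT0 hTδ hcl
    have k1 := hend e T a b z ht (heρ.trans hρρ₁) hT0 hTδ
      ⟨hcl.1.trans hρρ₁, hcl.2.1.trans hρρ₁, hcl.2.2.trans hρρ₁⟩
    have k2 := hto e T a b z ht (heρ.trans hρρ₂) hT0
      ⟨hcl.1.trans hρρ₂, hcl.2.1.trans hρρ₂, hcl.2.2.trans hρρ₂⟩
    have hab : ∀ t ∈ Icc 0 T, |a t| ≤ r + 1 ∧ |b t| ≤ r + 1 := by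
      intro t hts
      rcases le_total t γ.T with hle | hle
      · obtain ⟨q1, q2⟩ := k2 t ⟨hts.1, hle⟩ hts.2
        obtain ⟨s1, s2⟩ := hA t ⟨hts.1, hle⟩
        exact ⟨by linarith [abs_sub_abs_le_abs_sub (a t) (γ.a t)],
          by linarith [abs_sub_abs_le_abs_sub (b t) (γ.b t)]⟩
      · obtain ⟨q1, q2, -⟩ := k1 t ⟨ht₀T.le.trans hle, hts.2⟩
        obtain ⟨s1, s2⟩ := hA γ.T hTI
        rw [haT] at s1
        exact ⟨by linarith [abs_sub_abs_le_abs_sub (a t) ap],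
          by linarith [abs_sub_abs_le_abs_sub (b t) (γ.b γ.T)]⟩
    have heL : e * L ≤ 1 := (mul_le_mul_of_nonneg_right heρ (by linarith)).trans hρL
    have hz0 : |z 0| ≤ r + 3 := by
      linarith [abs_sub_abs_le_abs_sub (z 0) (γ.z 0), hZ 0 h0I h0c, hcl.2.2]
    have hr3 : (r + 1) * (r + 3) + (r + 1) + 1 < (r + 3) ^ 3 := by
      have h1 : 0 < r ^ 3 := by positivity
      have h2 : 0 < r ^ 2 := by positivity
      linarith [show (r + 3) ^ 3 - ((r + 1) * (r + 3) + (r + 1) + 1) = r ^ 3 + 8 * r ^ 2 + 22 * r + 22 by ring]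
    have hzup := ht.z_le hb (s := 0) (u := T) le_rfl le_rfl (abs_le.1 hz0).2 (fun t hts _ => by
      obtain ⟨q1, q2⟩ := hab t ⟨hts.1, hts.2.le⟩
      have := mul_le_mul_of_nonneg_right (abs_le.1 q2).1 (show 0 ≤ r + 3 by linarith)
      unfold cubic
      linarith [(abs_le.1 q1).1]) T ⟨hT0, le_rfl⟩
    have hzlow := ht.le_z hb (s := 0) (u := T) le_rfl le_rfl (abs_le.1 hz0).1 (fun t hts _ => by
      obtain ⟨q1, q2⟩ := hab t ⟨hts.1, hts.2.le⟩
      have := mul_le_mul_of_nonneg_right (abs_le.1 q2).1 (show 0 ≤ r + 3 by linarith)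
      have h3 : cubic (-(r + 3)) (a t) (b t) = -((r + 3) ^ 3) - b t * (r + 3) + a t := by
        unfold cubic; ring
      rw [h3]
      linarith [(abs_le.1 q1).2]) T ⟨hT0, le_rfl⟩
    obtain ⟨q1, q2⟩ := hab T ⟨hT0, le_rfl⟩
    exact ⟨by linarith, by linarith, by rw [abs_lt]; constructor <;> linarith⟩
  refine ⟨t₀, ht₀0, ht₀T, ρ, hρ0, fun e T a b z ht heρ hcl => ?_⟩
  have he := ht.e_pos
  have ha : ContinuousOn a (Icc 0 T) := fun t h => (ht.da t h).continuousWithinAt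
  have hbc : ContinuousOn b (Icc 0 T) := fun t h => (ht.db t h).continuousWithinAt
  have hz : ContinuousOn z (Icc 0 T) := fun t h => (ht.dz t h).continuousWithinAt
  -- hence they stay in the box
  have hboxed : ∀ u, 0 ≤ u → u ≤ T → u ≤ γ.T + δ →
      IsTraj (fun p => 1 + f₁ p) f₂ f₃ (r + 4) e u a b z := by
    intro u hu0 huT huδ
    have hsub : Icc 0 u ⊆ Icc 0 T := Icc_subset_Icc_right huT
    have hcont : ContinuousOn (fun t => max (max |a t| |b t|) |z t|) (Icc 0 u) :=
      ContinuousOn.sup (ContinuousOn.sup (ha.mono hsub).abs (hbc.mono hsub).abs) (hz.mono hsub).abs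
    have key := lt_of_bootstrap hcont (r := r + 4) (by
        refine max_lt (max_lt ?_ ?_) ?_
        · linarith [abs_sub_abs_le_abs_sub (a 0) (γ.a 0), (hA 0 h0I).1, hcl.1]
        · linarith [abs_sub_abs_le_abs_sub (b 0) (γ.b 0), (hA 0 h0I).2, hcl.2.1]
        · linarith [abs_sub_abs_le_abs_sub (z 0) (γ.z 0), hZ 0 h0I h0c, hcl.2.2])
      (fun t hts hboot => by
        have h1 := hinside e t a b z (ht.isTraj (heρ.trans hρ1) (hts.2.trans huT)
          (fun x hx => by
            have := hboot x hx
            simp only [max_le_iff] at this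
            exact ⟨this.1.1, this.1.2, this.2⟩)) heρ hts.1 (hts.2.trans huδ) hcl
        exact max_lt (max_lt h1.1 h1.2.1) h1.2.2)
    refine ht.isTraj (heρ.trans hρ1) huT fun t hts => ?_
    have := (key t hts).le
    simp only [max_le_iff] at this
    exact ⟨this.1.1, this.1.2, this.2⟩
  have hspeed : ∀ u, IsTraj (fun p => 1 + f₁ p) f₂ f₃ (r + 4) e u a b z → ∀ t ∈ Icc 0 u,
      |a t - ap| ≤ κ' → |b t - γ.b γ.T| ≤ κ' → |z t - γ.z γ.T| ≤ κ' →
      k / 2 ≤ 1 + f₁ (a t, b t, z t, e) := by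
    intro u hu t hts h1 h2 h3
    have hbT := hbox γ.T hTI hTc
    rw [haT] at hbT
    have := hb.speed_near (ζ := 0) (hu.box t hts) hbT he.le hu.e_le le_rfl h1 h2 h3
      (heρ.trans hρκ)
    simp only [zero_mul, add_zero, mul_one] at this
    linarith [(abs_le.1 this).1]
  -- the transition takes place before the time `γ.T + δ`
  have hTδ : T ≤ γ.T + δ := by
    by_contra! hlt
    have htr := hboxed (γ.T + δ) (by linarith) hlt.le le_rfl
    have k1 := hend e (γ.T + δ) a b z htr (heρ.trans hρρ₁) (by linarith) le_rfl
      ⟨hcl.1.trans hρρ₁, hcl.2.1.trans hρρ₁, hcl.2.2.trans hρρ₁⟩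
    have k2 := hto e (γ.T + δ) a b z htr (heρ.trans hρρ₂) (by linarith)
      ⟨hcl.1.trans hρρ₂, hcl.2.1.trans hρρ₂, hcl.2.2.trans hρρ₂⟩
    have h1 : a t₁ ≤ ap := by
      have h2 := (k2 t₁ ⟨ht₀0.trans ht₁0.le, ht₁T.le⟩ (by linarith)).1
      linarith [(abs_le.1 h2).2, hc t₁ ⟨ht₀0.trans ht₁0.le, le_rfl⟩]
    have h2 : ap ≤ a (γ.T + δ) := by
      have h3 := le_sub_of_le_deriv (c := k / 2) (s := γ.T) (u := γ.T + δ)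
        (htr.contA.mono (Icc_subset_Icc_left hT.le))
        (fun t hts => htr.da' ⟨hT.le.trans hts.1, hts.2⟩)
        (fun t hts => by
          obtain ⟨q1, q2, q3⟩ := k1 t ⟨ht₀T.le.trans hts.1, hts.2.le⟩
          exact hspeed _ htr t ⟨hT.le.trans hts.1, hts.2.le⟩ q1 q2 q3) (γ.T + δ)
        ⟨by linarith, le_rfl⟩
      have h4 := (k2 γ.T hTI (by linarith)).1
      rw [haT] at h4
      rw [add_sub_cancel_left] at h3
      linarith [(abs_le.1 h4).1]
    obtain ⟨t, hts, hta⟩ := intermediate_value_Icc (show t₁ ≤ γ.T + δ by linarith)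
      (ha.mono (Icc_subset_Icc (ht₀0.trans ht₁0.le) hlt.le)) ⟨h1, h2⟩
    refine ht.first t ⟨(ht₀0.trans ht₁0.le).trans hts.1, hts.2.trans_lt hlt⟩ ⟨hta, ?_⟩
    have := (k1 t ⟨ht₁0.le.trans hts.1, hts.2⟩).2.2
    linarith [(abs_le.1 this).2]
  have htr := hboxed T ht.T_pos.le le_rfl hTδ
  -- and after the time `t₁`
  have hTt₁ : t₁ ≤ T := by
    by_contra! hlt
    have h2 := (hto e T a b z htr (heρ.trans hρρ₂) ht.T_pos.le
      ⟨hcl.1.trans hρρ₂, hcl.2.1.trans hρρ₂, hcl.2.2.trans hρρ₂⟩ T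
      ⟨ht.T_pos.le, hlt.le.trans ht₁T.le⟩ le_rfl).1
    rw [ht.a_end] at h2
    linarith [(abs_le.1 h2).2, hc T ⟨ht.T_pos.le, hlt.le⟩]
  refine ⟨htr, ht₁0.le.trans hTt₁, by rw [abs_le]; constructor <;> linarith, fun t hts => ?_⟩
  obtain ⟨q1, q2, q3⟩ := hend e T a b z htr (heρ.trans hρρ₁) ht.T_pos.le hTδ
    ⟨hcl.1.trans hρρ₁, hcl.2.1.trans hρρ₁, hcl.2.2.trans hρρ₁⟩ t hts
  exact ⟨q1.trans hκ'κ, q2.trans hκ'κ, q3.trans hκ'κ⟩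

end

/-! ### Differentiability of crossing maps -/

section

variable {E : Type*} [NormedAddCommGroup E] [NormedSpace ℝ E]
variable {Y : E → E} {K : Set E} {ℓ : E →L[ℝ] ℝ} {c k κ t₀ T T' : ℝ} {γ γ' : ℝ → E}

/-- Bounds for a vector field, its derivative and its first order Taylor remainder on a set. -/
structure FieldBounds (Y : E → E) (K : Set E) (k : ℝ) : Prop where
  one_le : 1 ≤ k
  bound : ∀ x ∈ K, ‖Y x‖ ≤ k
  fderiv_bound : ∀ x ∈ K, ‖fderiv ℝ Y x‖ ≤ k
  lip : ∀ x ∈ K, ∀ y ∈ K, ‖Y y - Y x‖ ≤ k * ‖y - x‖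
  taylor : ∀ x ∈ K, ∀ y ∈ K, ‖Y y - Y x - fderiv ℝ Y x (y - x)‖ ≤ k * ‖y - x‖ ^ 2

theorem exists_fieldBounds (hY : ContDiff ℝ 2 Y) (hK : IsCompact K) (hKv : Convex ℝ K) :
    ∃ k, FieldBounds Y K k := by
  have hd : ContDiff ℝ 1 (fderiv ℝ Y) := hY.fderiv_right (by norm_num)
  have hdiff : Differentiable ℝ Y := hY.differentiable (by norm_num)
  obtain ⟨C₀, hC₀⟩ := hK.exists_bound_of_continuousOn hY.continuous.continuousOn
  obtain ⟨C₁, hC₁⟩ := hK.exists_bound_of_continuousOn hd.continuous.continuousOn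
  obtain ⟨C₂, hC₂⟩ := hK.exists_bound_of_continuousOn
    (hd.continuous_fderiv (by norm_num)).continuousOn
  obtain ⟨k, h1, h0k, h1k, h2k⟩ : ∃ k, 1 ≤ k ∧ C₀ ≤ k ∧ C₁ ≤ k ∧ C₂ ≤ k :=
    ⟨max 1 (max C₀ (max C₁ C₂)), by simp, by simp, by simp, by simp⟩
  refine ⟨k, h1, fun x hx => (hC₀ x hx).trans h0k, fun x hx => (hC₁ x hx).trans h1k,
    fun x hx y hy => hKv.norm_image_sub_le_of_norm_fderiv_le (fun z _ => hdiff z)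
      (fun z hz => (hC₁ z hz).trans h1k) hx hy, fun x hx y hy => ?_⟩
  have hsub : segment ℝ x y ⊆ K := hKv.segment_subset hx hy
  have := (convex_segment x y).norm_image_sub_le_of_norm_fderiv_le' (𝕜 := ℝ) (f := Y)
    (φ := fderiv ℝ Y x) (C := k * ‖y - x‖) (fun z _ => hdiff z) (fun z hz => by
      have h3 := hKv.norm_image_sub_le_of_norm_fderiv_le (𝕜 := ℝ)
        (fun w _ => hd.differentiable (by norm_num) w)
        (fun w hw => (hC₂ w hw).trans h2k) hx (hsub hz)
      exact h3.trans (mul_le_mul_of_nonneg_left (norm_sub_le_of_mem_segment hz) (by linarith)))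
    (left_mem_segment ℝ x y) (right_mem_segment ℝ x y)
  rwa [mul_assoc, ← sq] at this

/-- Grönwall's inequality in the form used for differences of trajectories. -/
theorem norm_le_of_norm_deriv_le_add {f f' : ℝ → E} {k s u π : ℝ} (hk : 0 < k)
    (hf : ContinuousOn f (Icc s u)) (hf' : ∀ t ∈ Ico s u, HasDerivWithinAt f (f' t) (Ici t) t)
    (hπ : 0 ≤ π) (hle : ∀ t ∈ Ico s u, ‖f' t‖ ≤ k * ‖f t‖ + k * π) :
    ∀ t ∈ Icc s u, ‖f t‖ ≤ (‖f s‖ + π) * Real.exp (k * (t - s)) := by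
  intro t ht
  have := norm_le_gronwallBound_of_norm_deriv_right_le hf hf' le_rfl hle t ht
  refine this.trans ?_
  rw [gronwallBound_of_K_ne_0 hk.ne', mul_div_cancel_left₀ _ hk.ne']
  linarith

/-- A trajectory of `Y` in `K` on `[0, T]` that ends on the hyperplane `ℓ = c` and approaches it, from the time
`t₀` on, at least at the speed `κ`. -/
structure IsCrossing (Y : E → E) (K : Set E) (ℓ : E →L[ℝ] ℝ) (c κ t₀ T : ℝ) (γ : ℝ → E) :
    Prop where
  start_le : t₀ ≤ T
  mem : ∀ t ∈ Icc 0 T, γ t ∈ K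
  deriv : ∀ t ∈ Icc 0 T, HasDerivWithinAt γ (Y (γ t)) (Icc 0 T) t
  end_mem : ℓ (γ T) = c
  speed : ∀ t ∈ Icc t₀ T, κ ≤ ℓ (Y (γ t))

namespace IsCrossing

theorem cont (h : IsCrossing Y K ℓ c κ t₀ T γ) : ContinuousOn γ (Icc 0 T) :=
  fun t ht => (h.deriv t ht).continuousWithinAt

theorem deriv_Ici (h : IsCrossing Y K ℓ c κ t₀ T γ) {t : ℝ} (ht : t ∈ Ico 0 T) :
    HasDerivWithinAt γ (Y (γ t)) (Ici t) t :=
  hasDerivWithinAt_Ici_of_Icc (h.deriv t ⟨ht.1, ht.2.le⟩) ht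

theorem norm_sub_le (h : IsCrossing Y K ℓ c κ t₀ T γ) (hb : FieldBounds Y K k) {s t : ℝ}
    (hs : 0 ≤ s) (hst : s ≤ t) (ht : t ≤ T) : ‖γ t - γ s‖ ≤ k * (t - s) :=
  norm_image_sub_le_of_norm_deriv_right_le_segment (h.cont.mono (Icc_subset_Icc hs le_rfl))
    (fun _ hx => h.deriv_Ici ⟨hs.trans hx.1, hx.2⟩)
    (fun x hx => hb.bound _ (h.mem x ⟨hs.trans hx.1, hx.2.le⟩)) t ⟨hst, ht⟩

/-- Trajectories diverge at most exponentially. -/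
theorem norm_sub_le_exp (h : IsCrossing Y K ℓ c κ t₀ T γ) (h' : IsCrossing Y K ℓ c κ t₀ T' γ')
    (hb : FieldBounds Y K k) {t : ℝ} (ht0 : 0 ≤ t) (ht : t ≤ T) (ht' : t ≤ T') :
    ‖γ' t - γ t‖ ≤ ‖γ' 0 - γ 0‖ * Real.exp (k * T) := by
  have hk := hb.one_le
  have := norm_le_of_norm_deriv_le_add (f := fun t => γ' t - γ t) (s := 0) (u := t) (k := k)
    (π := 0) (by linarith)
    ((h'.cont.mono (Icc_subset_Icc_right ht')).sub (h.cont.mono (Icc_subset_Icc_right ht)))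
    (fun x hx => (h'.deriv_Ici ⟨hx.1, hx.2.trans_le ht'⟩).sub
      (h.deriv_Ici ⟨hx.1, hx.2.trans_le ht⟩)) le_rfl
    (fun x hx => by
      simpa using hb.lip _ (h.mem x ⟨hx.1, hx.2.le.trans ht⟩) _
        (h'.mem x ⟨hx.1, hx.2.le.trans ht'⟩)) t ⟨ht0, le_rfl⟩
  refine this.trans ?_
  rw [add_zero]
  refine mul_le_mul_of_nonneg_left (Real.exp_le_exp.2 ?_) (norm_nonneg _)
  exact mul_le_mul_of_nonneg_left (by linarith) (by linarith)

/-- The crossing takes place at the latest after the time that the speed `κ` allows. -/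
theorem speed_le (h : IsCrossing Y K ℓ c κ t₀ T γ) (ht₀ : 0 ≤ t₀) {m : ℝ} (hm : t₀ ≤ m)
    (hmT : m ≤ T) : ℓ (γ m) + κ * (T - m) ≤ ℓ (γ T) :=
  le_sub_of_le_deriv (f := fun t => ℓ (γ t)) (s := m) (u := T)
    (ℓ.continuous.comp_continuousOn (h.cont.mono (Icc_subset_Icc_left (ht₀.trans hm))))
    (fun _ hx => ℓ.hasFDerivAt.comp_hasDerivWithinAt _
      (h.deriv_Ici ⟨ht₀.trans (hm.trans hx.1), hx.2⟩))
    (fun x hx => h.speed x ⟨hm.trans hx.1, hx.2.le⟩) T ⟨hmT, le_rfl⟩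

/-- The crossing time depends Lipschitz continuously on the starting point. -/
theorem abs_time_sub_le (h : IsCrossing Y K ℓ c κ t₀ T γ) (h' : IsCrossing Y K ℓ c κ t₀ T' γ')
    (hb : FieldBounds Y K k) (ht₀ : 0 ≤ t₀) (hκ : 0 < κ) :
    |T' - T| ≤ ‖ℓ‖ * (‖γ' 0 - γ 0‖ * Real.exp (k * T)) / κ := by
  rw [le_div_iff₀ hκ]
  have key : ∀ m, t₀ ≤ m → m ≤ T → m ≤ T' →
      |ℓ (γ' m) - ℓ (γ m)| ≤ ‖ℓ‖ * (‖γ' 0 - γ 0‖ * Real.exp (k * T)) := by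
    intro m hm hmT hmT'
    rw [← map_sub]
    exact (ℓ.le_opNorm _).trans (mul_le_mul_of_nonneg_left
      (h.norm_sub_le_exp h' hb (ht₀.trans hm) hmT hmT') (norm_nonneg _))
  rcases le_total T T' with hle | hle
  · have h1 := h'.speed_le ht₀ h.start_le hle
    have h2 := key T h.start_le le_rfl hle
    rw [h'.end_mem] at h1
    rw [h.end_mem] at h2
    rw [abs_of_nonneg (by linarith)]
    linarith [neg_abs_le (ℓ (γ' T) - c)]
  · have h1 := h.speed_le ht₀ h'.start_le hle
    have h2 := key T' h'.start_le hle le_rfl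
    rw [h.end_mem] at h1
    rw [h'.end_mem] at h2
    rw [abs_of_nonpos (by linarith)]
    linarith [le_abs_self (c - ℓ (γ T'))]

/-- Up to an error of second order, the difference of two trajectories solves the variational
equation. -/
theorem norm_sub_sub_smul_le (h : IsCrossing Y K ℓ c κ t₀ T γ)
    (h' : IsCrossing Y K ℓ c κ t₀ T' γ') (hb : FieldBounds Y K k) {u : ℝ → E}
    (hu : ∀ t ∈ Icc 0 T, HasDerivWithinAt u (fderiv ℝ Y (γ t) (u t)) (Icc 0 T) t) {m : ℝ}
    (hm0 : 0 ≤ m) (hm : m ≤ T) (hm' : m ≤ T') (s : ℝ) :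
    ‖γ' m - γ m - s • u m‖ ≤ (‖γ' 0 - γ 0 - s • u 0‖ + (‖γ' 0 - γ 0‖ * Real.exp (k * T)) ^ 2)
      * Real.exp (k * T) := by
  have hk := hb.one_le
  have hsub : Icc 0 m ⊆ Icc 0 T := Icc_subset_Icc_right hm
  have := norm_le_of_norm_deriv_le_add (f := fun t => γ' t - γ t - s • u t) (s := 0) (u := m)
    (k := k) (π := (‖γ' 0 - γ 0‖ * Real.exp (k * T)) ^ 2) (by linarith)
    (((h'.cont.mono (Icc_subset_Icc_right hm')).sub (h.cont.mono hsub)).sub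
      (continuousOn_const.smul fun t ht => ((hu t (hsub ht)).continuousWithinAt).mono hsub))
    (fun x hx => ((h'.deriv_Ici ⟨hx.1, hx.2.trans_le hm'⟩).sub
      (h.deriv_Ici ⟨hx.1, hx.2.trans_le hm⟩)).sub
        ((hasDerivWithinAt_Ici_of_Icc (hu x ⟨hx.1, hx.2.le.trans hm⟩)
          ⟨hx.1, hx.2.trans_le hm⟩).const_smul s)) (sq_nonneg _)
    (fun x hx => by
      have hxT : x ≤ T := hx.2.le.trans hm
      have hxT' : x ≤ T' := hx.2.le.trans hm'
      have hK := h.mem x ⟨hx.1, hxT⟩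
      have e1 : Y (γ' x) - Y (γ x) - s • fderiv ℝ Y (γ x) (u x) =
          fderiv ℝ Y (γ x) (γ' x - γ x - s • u x)
            + (Y (γ' x) - Y (γ x) - fderiv ℝ Y (γ x) (γ' x - γ x)) := by
        simp only [map_sub, map_smul]; abel
      rw [e1]
      refine (norm_add_le _ _).trans (add_le_add ?_ ?_)
      · exact ((fderiv ℝ Y (γ x)).le_opNorm _).trans
          (mul_le_mul_of_nonneg_right (hb.fderiv_bound _ hK) (norm_nonneg _))
      · refine (hb.taylor _ hK _ (h'.mem x ⟨hx.1, hxT'⟩)).trans ?_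
        exact mul_le_mul_of_nonneg_left
          (pow_le_pow_left₀ (norm_nonneg _) (h.norm_sub_le_exp h' hb hx.1 hxT hxT') 2)
          (by linarith)) m ⟨hm0, le_rfl⟩
  refine this.trans (mul_le_mul_of_nonneg_left (Real.exp_le_exp.2 ?_) (by positivity))
  exact mul_le_mul_of_nonneg_left (by linarith) (by linarith)

end IsCrossing

/-- The projection onto the kernel of `ℓ` along the vector `w`. -/
def projAlong (ℓ : E →L[ℝ] ℝ) (w : E) : E →L[ℝ] E :=
  ContinuousLinearMap.id ℝ E - (ℓ.smulRight ((ℓ w)⁻¹ • w))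

theorem projAlong_apply (ℓ : E →L[ℝ] ℝ) (w x : E) :
    projAlong ℓ w x = x - (ℓ x / ℓ w) • w := by
  simp [projAlong, smul_smul, div_eq_mul_inv]

theorem projAlong_self {w : E} (hw : ℓ w ≠ 0) : projAlong ℓ w w = 0 := by
  simp [projAlong_apply, div_self hw]

theorem projAlong_of_eq_zero {w x : E} (hx : ℓ x = 0) : projAlong ℓ w x = x := by
  simp [projAlong_apply, hx]

namespace IsCrossing

/-- On the last part of a crossing, the component along the section changes to second order only,
as measured by the projection along the velocity at a nearby point `q`. -/
theorem norm_projAlong_sub_le (h : IsCrossing Y K ℓ c κ t₀ T γ) (hb : FieldBounds Y K k) {q : E}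
    (hq : q ∈ K) (hqℓ : ℓ (Y q) ≠ 0) {m r : ℝ} (hm0 : 0 ≤ m) (hm : m ≤ T)
    (hr : ∀ t ∈ Icc m T, ‖γ t - q‖ ≤ r) :
    ‖projAlong ℓ (Y q) (γ T) - projAlong ℓ (Y q) (γ m)‖
      ≤ ‖projAlong ℓ (Y q)‖ * (k * r) * (T - m) := by
  have hk := hb.one_le
  refine norm_image_sub_le_of_norm_deriv_right_le_segment
    (f := fun t => projAlong ℓ (Y q) (γ t)) (a := m) (b := T)
    ((projAlong ℓ (Y q)).continuous.comp_continuousOn (h.cont.mono (Icc_subset_Icc_left hm0)))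
    (fun x hx => (projAlong ℓ (Y q)).hasFDerivAt.comp_hasDerivWithinAt _
      (h.deriv_Ici ⟨hm0.trans hx.1, hx.2⟩)) (fun x hx => ?_) T ⟨hm, le_rfl⟩
  have : projAlong ℓ (Y q) (Y (γ x)) = projAlong ℓ (Y q) (Y (γ x) - Y q) := by
    rw [map_sub, projAlong_self hqℓ, sub_zero]
  rw [this]
  refine (ContinuousLinearMap.le_opNorm _ _).trans (mul_le_mul_of_nonneg_left ?_ (norm_nonneg _))
  exact (hb.lip _ hq _ (h.mem x ⟨hm0.trans hx.1, hx.2.le⟩)).trans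
    (mul_le_mul_of_nonneg_left (hr x ⟨hx.1, hx.2.le⟩) (by linarith))

/-- First order expansion of the end point of a crossing in its starting point. -/
theorem exists_expansion (h : IsCrossing Y K ℓ c κ t₀ T γ) (hb : FieldBounds Y K k)
    (ht₀ : 0 ≤ t₀) (hκ : 0 < κ) {u : ℝ → E}
    (hu : ∀ t ∈ Icc 0 T, HasDerivWithinAt u (fderiv ℝ Y (γ t) (u t)) (Icc 0 T) t) :
    ∃ C, 0 ≤ C ∧ ∀ T' γ', IsCrossing Y K ℓ c κ t₀ T' γ' → ∀ s : ℝ,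
      ‖γ' T' - γ T - s • projAlong ℓ (Y (γ T)) (u T)‖
        ≤ C * (‖γ' 0 - γ 0 - s • u 0‖ + (‖γ' 0 - γ 0‖ + |s|) ^ 2) := by
  have hk := hb.one_le
  have hT0 : 0 ≤ T := ht₀.trans h.start_le
  have huc : ContinuousOn u (Icc 0 T) := fun t ht => (hu t ht).continuousWithinAt
  obtain ⟨U, hU⟩ := isCompact_Icc.exists_bound_of_continuousOn huc
  have hU0 : 0 ≤ U := (norm_nonneg _).trans (hU 0 ⟨le_rfl, hT0⟩)
  obtain ⟨D, hD0, hD⟩ : ∃ D, 0 ≤ D ∧ D = Real.exp (k * T) := ⟨_, (Real.exp_pos _).le, rfl⟩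
  set N := projAlong ℓ (Y (γ T)) with hN
  obtain ⟨G, hG0, hG⟩ : ∃ G, 0 ≤ G ∧ G = ‖ℓ‖ * D / κ := ⟨_, by positivity, rfl⟩
  have hq : γ T ∈ K := h.mem T ⟨hT0, le_rfl⟩
  have hqℓ : ℓ (Y (γ T)) ≠ 0 := (hκ.trans_le (h.speed T ⟨h.start_le, le_rfl⟩)).ne'
  refine ⟨‖N‖ * (k * (k * G + D)) * G + ‖N‖ * D + ‖N‖ * D ^ 2 * D + ‖N‖ * (k * U * G),
    by positivity, fun T' γ' h' s => ?_⟩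
  obtain ⟨n, hn0, hn⟩ : ∃ n, 0 ≤ n ∧ n = ‖γ' 0 - γ 0‖ := ⟨_, norm_nonneg _, rfl⟩
  have htime := h.abs_time_sub_le h' hb ht₀ hκ
  rw [← hD, ← hn, show ‖ℓ‖ * (n * D) / κ = G * n by rw [hG]; ring] at htime
  obtain ⟨m, hm⟩ : ∃ m, m = min T T' := ⟨_, rfl⟩
  have hmT : m ≤ T := hm ▸ min_le_left _ _
  have hmT' : m ≤ T' := hm ▸ min_le_right _ _
  have hm0 : 0 ≤ m := hm ▸ le_min hT0 (ht₀.trans h'.start_le)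
  have hpair := h.norm_sub_le_exp h' hb hm0 hmT hmT'
  have hfirst := h.norm_sub_sub_smul_le h' hb hu hm0 hmT hmT' s
  rw [← hD, ← hn] at hpair hfirst
  -- the end points differ by the projected difference at the common time, to second order
  have hend : ‖(γ' T' - γ T) - N (γ' m - γ m)‖ ≤ ‖N‖ * (k * (k * (G * n) + n * D)) * (G * n) := by
    have e1 : γ' T' - γ T = N (γ' T' - γ T) := by
      rw [hN, projAlong_of_eq_zero]
      rw [map_sub, h.end_mem, h'.end_mem, sub_self]
    rw [e1]
    rcases le_total T T' with hle | hle
    · have hmm : m = T := by rw [hm, min_eq_left hle]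
      rw [hmm, ← map_sub]
      have e2 : γ' T' - γ T - (γ' T - γ T) = γ' T' - γ' T := by abel
      rw [hmm] at hpair
      rw [abs_of_nonneg (by linarith)] at htime
      rw [e2, map_sub]
      refine (h'.norm_projAlong_sub_le hb hq hqℓ (r := k * (G * n) + n * D) hT0 hle
        fun t ht => ?_).trans (mul_le_mul_of_nonneg_left htime (by positivity))
      have e3 := h'.norm_sub_le hb hT0 ht.1 ht.2
      have e4 : k * (t - T) ≤ k * (G * n) := mul_le_mul_of_nonneg_left (by linarith [ht.2])
        (by linarith)
      linarith [norm_sub_le_norm_sub_add_norm_sub (γ' t) (γ' T) (γ T)]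
    · have hmm : m = T' := by rw [hm, min_eq_right hle]
      rw [hmm, ← map_sub]
      have e2 : γ' T' - γ T - (γ' T' - γ T') = -(γ T - γ T') := by abel
      rw [abs_of_nonpos (by linarith)] at htime
      rw [e2, map_neg, norm_neg, map_sub]
      have hT'0 : 0 ≤ T' := ht₀.trans h'.start_le
      refine (h.norm_projAlong_sub_le hb hq hqℓ (r := k * (G * n) + n * D) hT'0 hle
        fun t ht => ?_).trans (mul_le_mul_of_nonneg_left (by linarith) (by positivity))
      have e3 := h.norm_sub_le hb (hT'0.trans ht.1) ht.2 le_rfl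
      have e4 : k * (T - t) ≤ k * (G * n) := mul_le_mul_of_nonneg_left (by linarith [ht.1])
        (by linarith)
      have e5 : 0 ≤ n * D := by positivity
      rw [norm_sub_rev]
      linarith
  have hvar : ‖u T - u m‖ ≤ k * U * (T - m) :=
    norm_image_sub_le_of_norm_deriv_right_le_segment (huc.mono (Icc_subset_Icc_left hm0))
      (fun x hx => hasDerivWithinAt_Ici_of_Icc (hu x ⟨hm0.trans hx.1, hx.2.le⟩)
        ⟨hm0.trans hx.1, hx.2⟩)
      (fun x hx => (ContinuousLinearMap.le_opNorm _ _).trans (mul_le_mul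
        (hb.fderiv_bound _ (h.mem x ⟨hm0.trans hx.1, hx.2.le⟩))
        (hU x ⟨hm0.trans hx.1, hx.2.le⟩) (norm_nonneg _) (by linarith))) T ⟨hmT, le_rfl⟩
  have hTm : T - m ≤ G * n := by
    rcases min_choice T T' with h1 | h1
    · rw [hm, h1, sub_self]; positivity
    · rw [hm, h1]; linarith [neg_abs_le (T' - T)]
  have hvar' : ‖s • (u T - u m)‖ ≤ |s| * (k * U * (G * n)) := by
    rw [norm_smul, Real.norm_eq_abs]
    exact mul_le_mul_of_nonneg_left (hvar.trans (mul_le_mul_of_nonneg_left hTm (by positivity)))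
      (abs_nonneg _)
  have hdec : γ' T' - γ T - s • N (u T) = ((γ' T' - γ T) - N (γ' m - γ m))
      + N (γ' m - γ m - s • u m) - N (s • (u T - u m)) := by
    simp only [map_sub, map_smul, smul_sub]; abel
  have h1 : ‖N (γ' m - γ m - s • u m)‖ ≤ ‖N‖ * ((‖γ' 0 - γ 0 - s • u 0‖ + (n * D) ^ 2) * D) :=
    (N.le_opNorm _).trans (mul_le_mul_of_nonneg_left hfirst (norm_nonneg _))
  have h2 : ‖N (s • (u T - u m))‖ ≤ ‖N‖ * (|s| * (k * U * (G * n))) :=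
    (N.le_opNorm _).trans (mul_le_mul_of_nonneg_left hvar' (norm_nonneg _))
  obtain ⟨w, hw0, hw⟩ : ∃ w, 0 ≤ w ∧ w = ‖γ' 0 - γ 0 - s • u 0‖ := ⟨_, norm_nonneg _, rfl⟩
  rw [← hw] at h1
  rw [← hn, ← hw, hdec]
  refine (_root_.norm_sub_le _ _).trans ((add_le_add ((norm_add_le _ _).trans (add_le_add hend h1))
    h2).trans ?_)
  have hs := abs_nonneg s
  have i1 : n ^ 2 ≤ w + (n + |s|) ^ 2 := by nlinarith [mul_nonneg hn0 hs]
  have i2 : w ≤ w + (n + |s|) ^ 2 := by nlinarith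
  have i3 : |s| * n ≤ w + (n + |s|) ^ 2 := by nlinarith [mul_nonneg hn0 hs]
  have j1 := mul_le_mul_of_nonneg_left i1
    (show 0 ≤ ‖N‖ * (k * (k * G + D)) * G by positivity)
  have j2 := mul_le_mul_of_nonneg_left i2 (show 0 ≤ ‖N‖ * D by positivity)
  have j3 := mul_le_mul_of_nonneg_left i1 (show 0 ≤ ‖N‖ * D ^ 2 * D by positivity)
  have j4 := mul_le_mul_of_nonneg_left i3 (show 0 ≤ ‖N‖ * (k * U * G) by positivity)
  linarith

/-- The derivative of the end point along a differentiable family of starting points is the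
projection of the solution of the variational equation. -/
theorem hasDerivAt_end (h : IsCrossing Y K ℓ c κ t₀ T γ) (hb : FieldBounds Y K k)
    (ht₀ : 0 ≤ t₀) (hκ : 0 < κ) {u : ℝ → E}
    (hu : ∀ t ∈ Icc 0 T, HasDerivWithinAt u (fderiv ℝ Y (γ t) (u t)) (Icc 0 T) t) {P Q : ℝ → E}
    {s₀ : ℝ} (hP : HasDerivAt P (u 0) s₀) (hP0 : P s₀ = γ 0) (hQ0 : Q s₀ = γ T)
    (hPQ : ∀ᶠ s in 𝓝 s₀, ∃ T' γ', IsCrossing Y K ℓ c κ t₀ T' γ' ∧ γ' 0 = P s ∧ γ' T' = Q s) :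
    HasDerivAt Q (projAlong ℓ (Y (γ T)) (u T)) s₀ := by
  obtain ⟨C, hC0, hC⟩ := h.exists_expansion hb ht₀ hκ hu
  rw [hasDerivAt_iff_isLittleO] at hP ⊢
  have hlin : (fun s => ‖P s - P s₀‖ + |s - s₀|) =O[𝓝 s₀] fun s => s - s₀ := by
    refine Asymptotics.IsBigO.add ?_ ?_
    · exact (HasDerivAt.hasFDerivAt (hasDerivAt_iff_isLittleO.2 hP)).isBigO_sub.norm_left
    · exact (Asymptotics.isBigO_refl (fun s : ℝ => s - s₀) _).abs_left
  have htend : Tendsto (fun s : ℝ => s - s₀) (𝓝 s₀) (𝓝 0) := by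
    have : Continuous fun s : ℝ => s - s₀ := by fun_prop
    simpa using this.tendsto s₀
  have hsq : (fun s => (‖P s - P s₀‖ + |s - s₀|) ^ 2) =o[𝓝 s₀] fun s => s - s₀ := by
    refine (hlin.pow 2).trans_isLittleO ?_
    simp only [sq]
    simpa using (Asymptotics.isBigO_refl (fun s : ℝ => s - s₀) (𝓝 s₀)).mul_isLittleO
      ((Asymptotics.isLittleO_one_iff ℝ).2 htend)
  refine Asymptotics.IsBigO.trans_isLittleO ?_ (hP.norm_left.add hsq)
  refine Asymptotics.IsBigO.of_bound C ?_
  filter_upwards [hPQ] with s hs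
  obtain ⟨T', γ', h', h0, h1⟩ := hs
  have := hC T' γ' h' (s - s₀)
  rw [h0, h1, ← hP0, ← hQ0] at this
  rw [hQ0] at this ⊢
  refine this.trans (mul_le_mul_of_nonneg_left (le_abs_self _) hC0)

end IsCrossing

end

/-! ### Liouville's formula -/

section

variable {Y : ℝ × ℝ × ℝ → ℝ × ℝ × ℝ} {K : Set (ℝ × ℝ × ℝ)} {c k κ t₀ T : ℝ} {γ : ℝ → ℝ × ℝ × ℝ}

/-- The determinant of three vectors of `ℝ³`. -/
def det₃ (u v w : ℝ × ℝ × ℝ) : ℝ :=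
  u.1 * (v.2.1 * w.2.2 - v.2.2 * w.2.1) - v.1 * (u.2.1 * w.2.2 - u.2.2 * w.2.1)
    + w.1 * (u.2.1 * v.2.2 - u.2.2 * v.2.1)

/-- The trace of an endomorphism of `ℝ³`. -/
def trace₃ (M : ℝ × ℝ × ℝ →L[ℝ] ℝ × ℝ × ℝ) : ℝ :=
  (M (1, 0, 0)).1 + (M (0, 1, 0)).2.1 + (M (0, 0, 1)).2.2

theorem clm_apply_eq (M : ℝ × ℝ × ℝ →L[ℝ] ℝ × ℝ × ℝ) (u : ℝ × ℝ × ℝ) :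
    M u = u.1 • M (1, 0, 0) + u.2.1 • M (0, 1, 0) + u.2.2 • M (0, 0, 1) := by
  rw [← map_smul, ← map_smul, ← map_smul, ← map_add, ← map_add]
  congr 1
  ext <;> simp

theorem det₃_trace (M : ℝ × ℝ × ℝ →L[ℝ] ℝ × ℝ × ℝ) (u v w : ℝ × ℝ × ℝ) :
    det₃ (M u) v w + det₃ u (M v) w + det₃ u v (M w) = trace₃ M * det₃ u v w := by
  rw [clm_apply_eq M u, clm_apply_eq M v, clm_apply_eq M w]
  simp only [det₃, trace₃, Prod.fst_add, Prod.snd_add, Prod.smul_fst, Prod.smul_snd, smul_eq_mul]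
  ring

theorem HasDerivWithinAt.det₃ {u v w : ℝ → ℝ × ℝ × ℝ} {u' v' w' : ℝ × ℝ × ℝ} {s : Set ℝ} {t : ℝ}
    (hu : HasDerivWithinAt u u' s t) (hv : HasDerivWithinAt v v' s t)
    (hw : HasDerivWithinAt w w' s t) :
    HasDerivWithinAt (fun t => det₃ (u t) (v t) (w t))
      (CuspSFS.det₃ u' (v t) (w t) + CuspSFS.det₃ (u t) v' (w t) + CuspSFS.det₃ (u t) (v t) w')
      s t := by
  have c1 : ∀ {x : ℝ → ℝ × ℝ × ℝ} {x' : ℝ × ℝ × ℝ}, HasDerivWithinAt x x' s t →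
      HasDerivWithinAt (fun t => (x t).1) x'.1 s t ∧
      HasDerivWithinAt (fun t => (x t).2.1) x'.2.1 s t ∧
      HasDerivWithinAt (fun t => (x t).2.2) x'.2.2 s t := fun h =>
    ⟨h.fst, h.snd.fst, h.snd.snd⟩
  obtain ⟨u1, u2, u3⟩ := c1 hu
  obtain ⟨v1, v2, v3⟩ := c1 hv
  obtain ⟨w1, w2, w3⟩ := c1 hw
  have := ((u1.mul ((v2.mul w3).sub (v3.mul w2))).sub
    (v1.mul ((u2.mul w3).sub (u3.mul w2)))).add (w1.mul ((u2.mul v3).sub (u3.mul v2)))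
  refine this.congr_deriv ?_
  simp only [CuspSFS.det₃, Pi.mul_apply, Pi.sub_apply]
  ring

/-- Projecting the first two vectors along the third one is a column operation. -/
theorem det₃_projAlong (w u v : ℝ × ℝ × ℝ) (ℓ : ℝ × ℝ × ℝ →L[ℝ] ℝ) :
    det₃ (projAlong ℓ w u) (projAlong ℓ w v) w = det₃ u v w := by
  simp only [projAlong_apply, det₃, Prod.fst_sub, Prod.snd_sub, Prod.smul_fst, Prod.smul_snd,
    smul_eq_mul]
  ring

theorem trace₃_fderiv {x : ℝ × ℝ × ℝ} (hY : DifferentiableAt ℝ Y x) :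
    trace₃ (fderiv ℝ Y x) = divergence Y x := by
  have h1 : HasDerivAt (fun s : ℝ => ((s, x.2.1, x.2.2) : ℝ × ℝ × ℝ)) (1, 0, 0) x.1 :=
    (hasDerivAt_id _).prodMk ((hasDerivAt_const _ _).prodMk (hasDerivAt_const _ _))
  have h2 : HasDerivAt (fun s : ℝ => ((x.1, s, x.2.2) : ℝ × ℝ × ℝ)) (0, 1, 0) x.2.1 :=
    (hasDerivAt_const _ _).prodMk ((hasDerivAt_id _).prodMk (hasDerivAt_const _ _))
  have h3 : HasDerivAt (fun s : ℝ => ((x.1, x.2.1, s) : ℝ × ℝ × ℝ)) (0, 0, 1) x.2.2 :=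
    (hasDerivAt_const _ _).prodMk ((hasDerivAt_const _ _).prodMk (hasDerivAt_id _))
  have hx : HasFDerivAt Y (fderiv ℝ Y x) x := hY.hasFDerivAt
  have k1 : HasDerivAt (fun s : ℝ => (Y (s, x.2.1, x.2.2)).1) (fderiv ℝ Y x (1, 0, 0)).1 x.1 :=
    (hx.comp_hasDerivAt (f := fun s : ℝ => ((s, x.2.1, x.2.2) : ℝ × ℝ × ℝ)) x.1 h1).fst
  have k2 : HasDerivAt (fun s : ℝ => (Y (x.1, s, x.2.2)).2.1) (fderiv ℝ Y x (0, 1, 0)).2.1 x.2.1 :=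
    (hx.comp_hasDerivAt (f := fun s : ℝ => ((x.1, s, x.2.2) : ℝ × ℝ × ℝ)) x.2.1 h2).snd.fst
  have k3 : HasDerivAt (fun s : ℝ => (Y (x.1, x.2.1, s)).2.2) (fderiv ℝ Y x (0, 0, 1)).2.2 x.2.2 :=
    (hx.comp_hasDerivAt (f := fun s : ℝ => ((x.1, x.2.1, s) : ℝ × ℝ × ℝ)) x.2.2 h3).snd.snd
  simp only [trace₃, divergence]
  rw [k1.deriv, k2.deriv, k3.deriv]

/-- Liouville's formula: the volume spanned by two solutions of the variational equation and the
velocity grows at the rate given by the divergence. -/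
theorem IsCrossing.det₃_eq {ℓ : ℝ × ℝ × ℝ →L[ℝ] ℝ} (h : IsCrossing Y K ℓ c κ t₀ T γ)
    (hT : 0 ≤ T) (hY : ContDiff ℝ 2 Y) {u v : ℝ → ℝ × ℝ × ℝ}
    (hu : ∀ t ∈ Icc 0 T, HasDerivWithinAt u (fderiv ℝ Y (γ t) (u t)) (Icc 0 T) t)
    (hv : ∀ t ∈ Icc 0 T, HasDerivWithinAt v (fderiv ℝ Y (γ t) (v t)) (Icc 0 T) t) :
    det₃ (u T) (v T) (Y (γ T)) =
      det₃ (u 0) (v 0) (Y (γ 0)) * Real.exp (∫ t in (0 : ℝ)..T, divergence Y (γ t)) := by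
  have hdiff : Differentiable ℝ Y := hY.differentiable (by norm_num)
  have hcont : ContinuousOn (fun t => divergence Y (γ t)) (Icc 0 T) := by
    have h1 : (fun t => divergence Y (γ t)) = fun t => trace₃ (fderiv ℝ Y (γ t)) := by
      ext t; rw [trace₃_fderiv (hdiff _)]
    have h2 : ContinuousOn (fun t => fderiv ℝ Y (γ t)) (Icc 0 T) :=
      (hY.continuous_fderiv (by norm_num)).comp_continuousOn h.cont
    rw [h1]
    unfold trace₃
    exact (((h2.clm_apply continuousOn_const).fst).add
      ((h2.clm_apply continuousOn_const).snd.fst)).add (h2.clm_apply continuousOn_const).snd.snd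
  have hint : ∀ t ∈ Icc 0 T, HasDerivWithinAt (fun t => ∫ x in (0 : ℝ)..t, divergence Y (γ x))
      (divergence Y (γ t)) (Icc 0 T) t := fun t ht => by
    have : Fact (t ∈ Icc 0 T) := ⟨ht⟩
    exact intervalIntegral.integral_hasDerivWithinAt_right
      ((hcont.mono (Icc_subset_Icc_right ht.2)).intervalIntegrable_of_Icc ht.1)
      (hcont.stronglyMeasurableAtFilter_nhdsWithin measurableSet_Icc t) (hcont t ht)
  have hder : ∀ t ∈ Icc 0 T, HasDerivWithinAt
      (fun t => det₃ (u t) (v t) (Y (γ t)) * Real.exp (-∫ x in (0 : ℝ)..t, divergence Y (γ x)))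
      0 (Icc 0 T) t := fun t ht => by
    have h1 := (HasDerivWithinAt.det₃ (hu t ht) (hv t ht)
      ((hdiff (γ t)).hasFDerivAt.comp_hasDerivWithinAt t (h.deriv t ht))).mul (hint t ht).neg.exp
    refine h1.congr_deriv ?_
    simp only [Function.comp_apply]
    rw [det₃_trace, trace₃_fderiv (hdiff _)]
    ring
  have := constant_of_has_deriv_right_zero (fun t ht => (hder t ht).continuousWithinAt)
    (fun t ht => hasDerivWithinAt_Ici_of_Icc (hder t ⟨ht.1, ht.2.le⟩) ht) T ⟨hT, le_rfl⟩
  simp only [intervalIntegral.integral_same, neg_zero, Real.exp_zero, mul_one] at this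
  rw [← this, mul_assoc, ← Real.exp_add, neg_add_cancel, Real.exp_zero, mul_one]

/-- The Jacobian of the crossing map of a section `x.1 = c`: for two differentiable families of
starting points in a section `x.1 = c'`, the families of end points are differentiable and the
two areas are related by Liouville's formula. -/
theorem IsCrossing.jacobian (h : IsCrossing Y K (ContinuousLinearMap.fst ℝ ℝ (ℝ × ℝ)) c κ t₀ T γ)
    (hY : ContDiff ℝ 2 Y) (hK : IsCompact K) (hKv : Convex ℝ K) (ht₀ : 0 ≤ t₀) (hκ : 0 < κ)
    {P₁ P₂ Q₁ Q₂ : ℝ → ℝ × ℝ × ℝ} {v₁ v₂ : ℝ × ℝ × ℝ} {s₁ s₂ : ℝ}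
    (hP₁ : HasDerivAt P₁ v₁ s₁) (hP₂ : HasDerivAt P₂ v₂ s₂) (hv₁ : v₁.1 = 0) (hv₂ : v₂.1 = 0)
    (hP₁0 : P₁ s₁ = γ 0) (hP₂0 : P₂ s₂ = γ 0) (hQ₁0 : Q₁ s₁ = γ T) (hQ₂0 : Q₂ s₂ = γ T)
    (hPQ₁ : ∀ᶠ s in 𝓝 s₁, ∃ T' γ', IsCrossing Y K (ContinuousLinearMap.fst ℝ ℝ (ℝ × ℝ)) c κ t₀ T' γ'
      ∧ γ' 0 = P₁ s ∧ γ' T' = Q₁ s)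
    (hPQ₂ : ∀ᶠ s in 𝓝 s₂, ∃ T' γ', IsCrossing Y K (ContinuousLinearMap.fst ℝ ℝ (ℝ × ℝ)) c κ t₀ T' γ'
      ∧ γ' 0 = P₂ s ∧ γ' T' = Q₂ s) :
    ∃ w₁ w₂, HasDerivAt Q₁ w₁ s₁ ∧ HasDerivAt Q₂ w₂ s₂ ∧
      (Y (γ T)).1 * (w₁.2.1 * w₂.2.2 - w₁.2.2 * w₂.2.1) =
        (Y (γ 0)).1 * (v₁.2.1 * v₂.2.2 - v₁.2.2 * v₂.2.1)
          * Real.exp (∫ t in (0 : ℝ)..T, divergence Y (γ t)) := by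
  have hT : 0 ≤ T := ht₀.trans h.start_le
  obtain ⟨k, hb⟩ := exists_fieldBounds hY hK hKv
  have hM : ContinuousOn (fun t => fderiv ℝ Y (γ t)) (Icc 0 T) :=
    (hY.continuous_fderiv (by norm_num)).comp_continuousOn h.cont
  obtain ⟨u₁, hu₁0, hu₁⟩ := exists_linear_solution hT hM v₁
  obtain ⟨u₂, hu₂0, hu₂⟩ := exists_linear_solution hT hM v₂
  have hq : (Y (γ T)).1 ≠ 0 := (hκ.trans_le (h.speed T ⟨h.start_le, le_rfl⟩)).ne'
  have hfst : ∀ x, (projAlong (ContinuousLinearMap.fst ℝ ℝ (ℝ × ℝ)) (Y (γ T)) x).1 = 0 := by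
    intro x
    rw [projAlong_apply]
    simp [hq]
  refine ⟨_, _, h.hasDerivAt_end hb ht₀ hκ hu₁ (hu₁0 ▸ hP₁) hP₁0 hQ₁0 hPQ₁,
    h.hasDerivAt_end hb ht₀ hκ hu₂ (hu₂0 ▸ hP₂) hP₂0 hQ₂0 hPQ₂, ?_⟩
  have hdet := h.det₃_eq hT hY hu₁ hu₂
  rw [← det₃_projAlong _ _ _ (ContinuousLinearMap.fst ℝ ℝ (ℝ × ℝ)), hu₁0, hu₂0] at hdet
  have e1 : ∀ {x y w : ℝ × ℝ × ℝ}, x.1 = 0 → y.1 = 0 →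
      det₃ x y w = w.1 * (x.2.1 * y.2.2 - x.2.2 * y.2.1) := fun hx hy => by
    simp [det₃, hx, hy]
  rw [e1 (hfst _) (hfst _), e1 hv₁ hv₂] at hdet
  exact hdet

end

/-! ### Transitions in the slow time and convergence of the divergence integrals -/

section

open MeasureTheory

variable {f₁ f₂ f₃ : ℝ × ℝ × ℝ × ℝ → ℝ} {am ap e ε T : ℝ} {a b z : ℝ → ℝ}

/-- The vector field in the slow time, `ε⁻¹ X_ε`. -/
def slowField (f₁ f₂ f₃ : ℝ × ℝ × ℝ × ℝ → ℝ) (e : ℝ) (p : ℝ × ℝ × ℝ) : ℝ × ℝ × ℝ :=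
  (1 + f₁ (p.1, p.2.1, p.2.2, e), f₂ (p.1, p.2.1, p.2.2, e),
    -(cubic p.2.2 p.1 p.2.1 + e * f₃ (p.1, p.2.1, p.2.2, e)) / e)

theorem slowField_eq (he : e ≠ 0) (p : ℝ × ℝ × ℝ) :
    slowField f₁ f₂ f₃ e p = e⁻¹ • field f₁ f₂ f₃ e p := by
  simp only [slowField, field, cubic, Prod.smul_mk, smul_eq_mul]
  refine Prod.ext ?_ (Prod.ext ?_ ?_)
  · simp only; field_simp
  · simp only; field_simp
  · simp only; field_simp

theorem divergence_slowField (he : e ≠ 0) (p : ℝ × ℝ × ℝ) :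
    divergence (slowField f₁ f₂ f₃ e) p = e⁻¹ * divergence (field f₁ f₂ f₃ e) p := by
  have h : slowField f₁ f₂ f₃ e = fun p => e⁻¹ • field f₁ f₂ f₃ e p :=
    funext fun p => slowField_eq he p
  simp only [h, divergence, Prod.smul_fst, Prod.smul_snd, smul_eq_mul, deriv_const_mul_field]
  ring

theorem contDiff_slowField (hf₁ : ContDiff ℝ ∞ f₁) (hf₂ : ContDiff ℝ ∞ f₂) (hf₃ : ContDiff ℝ ∞ f₃)
    (e : ℝ) : ContDiff ℝ ∞ (slowField f₁ f₂ f₃ e) := by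
  unfold slowField cubic
  fun_prop

theorem IsTransit.hasDerivWithinAt (h : IsTransit f₁ f₂ f₃ ap e T a b z) {t : ℝ}
    (ht : t ∈ Icc 0 T) : HasDerivWithinAt (fun t => (a t, b t, z t))
      (slowField f₁ f₂ f₃ e (a t, b t, z t)) (Icc 0 T) t :=
  (h.da t ht).prodMk ((h.db t ht).prodMk (h.dz t ht))

/-- A transition in the fast time, rescaled to the slow time. -/
theorem IsTransition.exists_isTransit {p q : ℝ × ℝ × ℝ} (hε : 0 < ε)
    (h : IsTransition f₁ f₂ f₃ am ap ε p q) :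
    ∃ T a b z, IsTransit f₁ f₂ f₃ ap ε T a b z ∧ (a 0, b 0, z 0) = p ∧ (a T, b T, z T) = q := by
  obtain ⟨-, hq, τ, hτ, γ, h0, h1, hd, hfirst⟩ := h
  have hT : ε * τ / ε = τ := mul_div_cancel_left₀ _ hε.ne'
  have hmem : ∀ t ∈ Icc 0 (ε * τ), t / ε ∈ Icc 0 τ := fun t ht =>
    ⟨div_nonneg ht.1 hε.le, by rw [div_le_iff₀ hε]; linarith [ht.2]⟩
  have hder : ∀ t ∈ Icc 0 (ε * τ), HasDerivWithinAt (fun t => γ (t / ε))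
      (slowField f₁ f₂ f₃ ε (γ (t / ε))) (Icc 0 (ε * τ)) t := fun t ht => by
    have h1 : HasDerivWithinAt (fun t : ℝ => t / ε) (1 / ε) (Icc 0 (ε * τ)) t :=
      (hasDerivWithinAt_id t _).div_const ε
    have h2 := (hd (t / ε) (hmem t ht)).scomp t h1 hmem
    rw [slowField_eq hε.ne', ← one_div]
    exact h2
  refine ⟨ε * τ, fun t => (γ (t / ε)).1, fun t => (γ (t / ε)).2.1, fun t => (γ (t / ε)).2.2,
    ⟨hε, by positivity, fun t ht => (hder t ht).fst, fun t ht => (hder t ht).snd.fst,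
      fun t ht => (hder t ht).snd.snd, ?_, ?_, ?_⟩, ?_, ?_⟩
  · simp only [hT, h1]; exact hq.1
  · simp only [hT, h1]; exact hq.2
  · exact fun t ht => hfirst (t / ε) ⟨div_nonneg ht.1 hε.le, by
      rw [div_lt_iff₀ hε]; linarith [ht.2]⟩
  · simp only [zero_div, h0]
  · simp only [hT, h1]

/-- The divergence is jointly continuous in the point and `ε`, up to `ε = 0`. -/
theorem continuous_divergence (hf₁ : ContDiff ℝ ∞ f₁) (hf₂ : ContDiff ℝ ∞ f₂)
    (hf₃ : ContDiff ℝ ∞ f₃) :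
    Continuous fun x : ℝ × ℝ × ℝ × ℝ =>
      divergence (field f₁ f₂ f₃ x.2.2.2) (x.1, x.2.1, x.2.2.1) := by
  set F : ℝ × ℝ × ℝ × ℝ → ℝ × ℝ × ℝ := fun x => field f₁ f₂ f₃ x.2.2.2 (x.1, x.2.1, x.2.2.1) with hF
  have hFs : ContDiff ℝ ∞ F := by
    rw [hF]; unfold field
    fun_prop
  have hFd : Differentiable ℝ F := hFs.differentiable (by simp)
  have hFc : Continuous (fderiv ℝ F) := hFs.continuous_fderiv (by simp)
  have heq : (fun x : ℝ × ℝ × ℝ × ℝ => divergence (field f₁ f₂ f₃ x.2.2.2) (x.1, x.2.1, x.2.2.1)) =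
      fun x => (fderiv ℝ F x (1, 0, 0, 0)).1 + (fderiv ℝ F x (0, 1, 0, 0)).2.1
        + (fderiv ℝ F x (0, 0, 1, 0)).2.2 := by
    ext x
    have h1 : HasDerivAt (fun s : ℝ => ((s, x.2.1, x.2.2.1, x.2.2.2) : ℝ × ℝ × ℝ × ℝ))
        (1, 0, 0, 0) x.1 := (hasDerivAt_id _).prodMk ((hasDerivAt_const _ _).prodMk
          ((hasDerivAt_const _ _).prodMk (hasDerivAt_const _ _)))
    have h2 : HasDerivAt (fun s : ℝ => ((x.1, s, x.2.2.1, x.2.2.2) : ℝ × ℝ × ℝ × ℝ))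
        (0, 1, 0, 0) x.2.1 := (hasDerivAt_const _ _).prodMk ((hasDerivAt_id _).prodMk
          ((hasDerivAt_const _ _).prodMk (hasDerivAt_const _ _)))
    have h3 : HasDerivAt (fun s : ℝ => ((x.1, x.2.1, s, x.2.2.2) : ℝ × ℝ × ℝ × ℝ))
        (0, 0, 1, 0) x.2.2.1 := (hasDerivAt_const _ _).prodMk ((hasDerivAt_const _ _).prodMk
          ((hasDerivAt_id _).prodMk (hasDerivAt_const _ _)))
    have hx : HasFDerivAt F (fderiv ℝ F x) x := (hFd x).hasFDerivAt
    have k1 : HasDerivAt (fun s : ℝ => (field f₁ f₂ f₃ x.2.2.2 (s, x.2.1, x.2.2.1)).1)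
        (fderiv ℝ F x (1, 0, 0, 0)).1 x.1 :=
      (hx.comp_hasDerivAt (f := fun s : ℝ => ((s, x.2.1, x.2.2.1, x.2.2.2) : ℝ × ℝ × ℝ × ℝ))
        x.1 h1).fst
    have k2 : HasDerivAt (fun s : ℝ => (field f₁ f₂ f₃ x.2.2.2 (x.1, s, x.2.2.1)).2.1)
        (fderiv ℝ F x (0, 1, 0, 0)).2.1 x.2.1 :=
      (hx.comp_hasDerivAt (f := fun s : ℝ => ((x.1, s, x.2.2.1, x.2.2.2) : ℝ × ℝ × ℝ × ℝ))
        x.2.1 h2).snd.fst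
    have k3 : HasDerivAt (fun s : ℝ => (field f₁ f₂ f₃ x.2.2.2 (x.1, x.2.1, s)).2.2)
        (fderiv ℝ F x (0, 0, 1, 0)).2.2 x.2.2.1 :=
      (hx.comp_hasDerivAt (f := fun s : ℝ => ((x.1, x.2.1, s, x.2.2.2) : ℝ × ℝ × ℝ × ℝ))
        x.2.2.1 h3).snd.snd
    simp only [divergence]
    rw [k1.deriv, k2.deriv, k3.deriv]
  rw [heq]
  exact (((hFc.clm_apply continuous_const).fst).add
    ((hFc.clm_apply continuous_const).snd.fst)).add (hFc.clm_apply continuous_const).snd.snd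

/-- Near a slow orbit the transitions are crossings of `Σ⁺`, with uniform constants. -/
theorem SlowOrbit.exists_isCrossing (γ : SlowOrbit f₁ f₂ am ap) (hf₁ : ContDiff ℝ ∞ f₁)
    (hf₂ : ContDiff ℝ ∞ f₂) (hf₃ : ContDiff ℝ ∞ f₃) :
    ∃ R κ t₀ ρ : ℝ, 0 < κ ∧ 0 ≤ t₀ ∧ 0 < ρ ∧ ∀ (e T : ℝ) (a b z : ℝ → ℝ),
      IsTransit f₁ f₂ f₃ ap e T a b z → e ≤ ρ → Close a b z γ.a γ.b γ.z ρ 0 →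
      IsCrossing (slowField f₁ f₂ f₃ e) (Icc (-R) R ×ˢ Icc (-R) R ×ˢ Icc (-R) R)
        (ContinuousLinearMap.fst ℝ ℝ (ℝ × ℝ)) ap κ t₀ T fun t => (a t, b t, z t) := by
  obtain ⟨R, L, hb, hbox, hcap⟩ := γ.exists_capture hf₁ hf₂ hf₃
  have hk := γ.end_transversal
  obtain ⟨k, hk0⟩ : ∃ k, k = 1 + f₁ (γ.a γ.T, γ.b γ.T, γ.z γ.T, 0) := ⟨_, rfl⟩
  rw [← hk0] at hk
  have hcont : ContinuousAt (fun x : ℝ × ℝ × ℝ × ℝ => 1 + f₁ x) (γ.a γ.T, γ.b γ.T, γ.z γ.T, 0) :=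
    (continuous_const.add hf₁.continuous).continuousAt
  obtain ⟨δ, hδ0, hδ⟩ := Metric.continuousAt_iff.1 hcont (k / 2) (by linarith)
  obtain ⟨t₀, ht₀, -, ρ, hρ, hρ'⟩ := hcap (δ / 2) (by linarith)
  refine ⟨R, k / 2, t₀, min ρ (δ / 2), by linarith, ht₀, by positivity,
    fun e T a b z ht he hcl => ?_⟩
  obtain ⟨htr, h1, -, hend⟩ := hρ' e T a b z ht (he.trans (min_le_left _ _))
    ⟨hcl.1.trans (min_le_left _ _), hcl.2.1.trans (min_le_left _ _),
      hcl.2.2.trans (min_le_left _ _)⟩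
  refine ⟨h1, fun t hts => ?_, fun t hts => ht.hasDerivWithinAt hts, ht.a_end, fun t hts => ?_⟩
  · obtain ⟨q1, q2, q3⟩ := htr.box t hts
    exact ⟨abs_le.1 q1, abs_le.1 q2, abs_le.1 q3⟩
  · obtain ⟨q1, q2, q3⟩ := hend t hts
    rw [← γ.end_mem.1] at q1
    have := @hδ (a t, b t, z t, e) (by
      simp only [Prod.dist_eq, Real.dist_eq, max_lt_iff, sub_zero]
      have he' : e ≤ δ / 2 := he.trans (min_le_right _ _)
      exact ⟨by linarith, by linarith, by linarith, by rw [abs_of_pos ht.e_pos]; linarith⟩)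
    rw [Real.dist_eq, ← hk0] at this
    change k / 2 ≤ 1 + f₁ (a t, b t, z t, e)
    linarith [(abs_lt.1 this).1]

/-- The transitions that start closer and closer to a slow orbit end closer and closer to its end
point, and their divergence integrals converge to the slow divergence integral. -/
theorem SlowOrbit.tendsto_transit (γ : SlowOrbit f₁ f₂ am ap) (hf₁ : ContDiff ℝ ∞ f₁)
    (hf₂ : ContDiff ℝ ∞ f₂) (hf₃ : ContDiff ℝ ∞ f₃) {T : ℝ → ℝ} {a b z : ℝ → ℝ → ℝ}
    (h : ∀ᶠ ε in 𝓝[>] 0, IsTransit f₁ f₂ f₃ ap ε (T ε) (a ε) (b ε) (z ε))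
    (h0 : Tendsto (fun ε => (a ε 0, b ε 0, z ε 0)) (𝓝[>] 0) (𝓝 (γ.a 0, γ.b 0, γ.z 0))) :
    Tendsto (fun ε => (a ε (T ε), b ε (T ε), z ε (T ε))) (𝓝[>] 0)
      (𝓝 (γ.a γ.T, γ.b γ.T, γ.z γ.T)) ∧
    Tendsto (fun ε => ∫ t in (0 : ℝ)..T ε, divergence (field f₁ f₂ f₃ ε) (a ε t, b ε t, z ε t))
      (𝓝[>] 0) (𝓝 (γ.integral f₃)) := by
  obtain ⟨R, L, hb, hbox, hcap⟩ := γ.exists_capture hf₁ hf₂ hf₃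
  have hgood := γ.good (f₃ := f₃) hb hbox
  have hsmall : ∀ ρ > 0, ∀ᶠ ε : ℝ in 𝓝[>] 0, ε ≤ ρ := fun ρ hρ =>
    nhdsWithin_le_nhds ((Iic_mem_nhds hρ))
  have hclose : ∀ ρ > 0, ∀ᶠ ε in 𝓝[>] 0, Close (a ε) (b ε) (z ε) γ.a γ.b γ.z ρ 0 := by
    intro ρ hρ
    filter_upwards [Metric.tendsto_nhds.1 h0 ρ hρ] with ε hε
    simp only [Prod.dist_eq, Real.dist_eq, max_lt_iff] at hε
    exact ⟨hε.1.le, hε.2.1.le, hε.2.2.le⟩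
  have htraj : ∀ᶠ ε in 𝓝[>] 0,
      IsTraj (fun p => 1 + f₁ p) f₂ f₃ R ε (T ε) (a ε) (b ε) (z ε) ∧ 0 ≤ T ε := by
    obtain ⟨t₀, -, -, ρ, hρ, hρ'⟩ := hcap 1 one_pos
    filter_upwards [h, hsmall ρ hρ, hclose ρ hρ] with ε h1 h2 h3
    exact ⟨(hρ' ε _ _ _ _ h1 h2 h3).1, h1.T_pos.le⟩
  have hT : Tendsto T (𝓝[>] 0) (𝓝 γ.T) := by
    rw [Metric.tendsto_nhds]
    intro κ hκ
    obtain ⟨t₀, -, -, ρ, hρ, hρ'⟩ := hcap (κ / 2) (by linarith)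
    filter_upwards [h, hsmall ρ hρ, hclose ρ hρ] with ε h1 h2 h3
    rw [Real.dist_eq]
    linarith [(hρ' ε _ _ _ _ h1 h2 h3).2.2.1]
  refine ⟨?_, ?_⟩
  · rw [Metric.tendsto_nhds]
    intro κ hκ
    obtain ⟨t₀, -, -, ρ, hρ, hρ'⟩ := hcap (κ / 2) (by linarith)
    filter_upwards [h, hsmall ρ hρ, hclose ρ hρ] with ε h1 h2 h3
    obtain ⟨-, k1, -, k2⟩ := hρ' ε _ _ _ _ h1 h2 h3
    obtain ⟨q1, q2, q3⟩ := k2 (T ε) ⟨k1, le_rfl⟩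
    rw [← γ.end_mem.1] at q1
    simp only [Prod.dist_eq, Real.dist_eq, max_lt_iff]
    exact ⟨by linarith, by linarith, by linarith⟩
  · have hdiv := continuous_divergence hf₁ hf₂ hf₃
    -- the trajectories converge to the slow orbit, except possibly at the contact times
    have hpt : ∀ t ∈ Ico 0 γ.T, t ∉ γ.contact →
        Tendsto (fun ε => (a ε t, b ε t, z ε t, ε)) (𝓝[>] 0) (𝓝 (γ.a t, γ.b t, γ.z t, 0)) := by
      intro t ht htc
      rw [Metric.tendsto_nhds]
      intro κ hκ
      obtain ⟨ρ₁, hρ₁, h1⟩ := hgood.1 (κ / 2) (by linarith)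
      obtain ⟨ρ₂, hρ₂, h2⟩ := hgood.2 t ⟨ht.1, ht.2.le⟩ htc (κ / 2) (by linarith)
      filter_upwards [htraj, hsmall ρ₁ hρ₁, hclose ρ₁ hρ₁, hsmall ρ₂ hρ₂, hclose ρ₂ hρ₂,
        hT.eventually (lt_mem_nhds ht.2), hsmall (κ / 2) (by linarith), self_mem_nhdsWithin]
        with ε k0 k1 k2 k3 k4 k5 k6 k7
      obtain ⟨q1, q2⟩ := h1 ε _ _ _ _ k0.1 k1 k0.2 k2 t ⟨ht.1, ht.2.le⟩ k5.le
      have q3 := h2 ε _ _ _ _ k0.1 k3 k0.2 k4 t ⟨le_rfl, le_rfl⟩ k5.le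
      have k7' : 0 < ε := k7
      simp only [Prod.dist_eq, Real.dist_eq, max_lt_iff, sub_zero]
      exact ⟨by linarith, by linarith, by linarith, by rw [abs_of_pos k7']; linarith⟩
    obtain ⟨C, hC⟩ := (isCompact_Icc.prod (isCompact_Icc.prod (isCompact_Icc.prod
      (isCompact_Icc (a := (0 : ℝ)) (b := 1))))).exists_bound_of_continuousOn
      (s := Icc (-R) R ×ˢ Icc (-R) R ×ˢ Icc (-R) R ×ˢ Icc 0 1) hdiv.continuousOn
    have heq : γ.integral f₃ = ∫ t, (Ioc 0 γ.T).indicator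
        (fun t => divergence (field f₁ f₂ f₃ 0) (γ.a t, γ.b t, γ.z t)) t := by
      rw [integral_indicator measurableSet_Ioc, SlowOrbit.integral,
        intervalIntegral.integral_of_le γ.T_pos.le]
    have heq' : ∀ᶠ ε in 𝓝[>] 0, (∫ t, (Ioc 0 (T ε)).indicator
        (fun t => divergence (field f₁ f₂ f₃ ε) (a ε t, b ε t, z ε t)) t) =
        ∫ t in (0 : ℝ)..T ε, divergence (field f₁ f₂ f₃ ε) (a ε t, b ε t, z ε t) := by
      filter_upwards [htraj] with ε hε
      rw [integral_indicator measurableSet_Ioc, intervalIntegral.integral_of_le hε.2]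
    rw [heq]
    refine Tendsto.congr' heq' ?_
    refine tendsto_integral_filter_of_dominated_convergence
      ((Ioc 0 (γ.T + 1)).indicator fun _ => C) ?_ ?_ ?_ ?_
    · filter_upwards [htraj] with ε hε
      rw [aestronglyMeasurable_indicator_iff measurableSet_Ioc]
      refine ContinuousOn.aestronglyMeasurable ?_ measurableSet_Ioc
      have hsub : Ioc 0 (T ε) ⊆ Icc 0 (T ε) := Ioc_subset_Icc_self
      exact hdiv.comp_continuousOn (f := fun t => (a ε t, b ε t, z ε t, ε))
        ((hε.1.contA.mono hsub).prodMk ((hε.1.contB.mono hsub).prodMk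
          ((hε.1.contZ.mono hsub).prodMk continuousOn_const)))
    · filter_upwards [htraj, hT.eventually (gt_mem_nhds (lt_add_one γ.T))] with ε hε hTε
      refine ae_of_all _ fun t => ?_
      by_cases ht : t ∈ Ioc 0 (T ε)
      · rw [indicator_of_mem ht, indicator_of_mem (show t ∈ Ioc 0 (γ.T + 1) from ⟨ht.1, ht.2.trans hTε.le⟩)]
        obtain ⟨q1, q2, q3⟩ := hε.1.box t ⟨ht.1.le, ht.2⟩
        exact hC (a ε t, b ε t, z ε t, ε)
          ⟨abs_le.1 q1, abs_le.1 q2, abs_le.1 q3, hε.1.e_pos.le, hε.1.e_le⟩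
      · rw [indicator_of_notMem ht, norm_zero]
        refine indicator_nonneg (fun _ _ => ?_) _
        obtain ⟨q1, q2, q3⟩ := hε.1.box 0 ⟨le_rfl, hε.2⟩
        exact (norm_nonneg _).trans (hC (a ε 0, b ε 0, z ε 0, ε)
          ⟨abs_le.1 q1, abs_le.1 q2, abs_le.1 q3, hε.1.e_pos.le, hε.1.e_le⟩)
    · rw [integrable_indicator_iff measurableSet_Ioc]
      exact integrableOn_const (by simp)
    · have hfin : ((γ.contact : Set ℝ) ∪ {γ.T}).Finite :=
        γ.contact.finite_toSet.union (finite_singleton _)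
      filter_upwards [hfin.countable.ae_notMem volume] with t ht
      have htc : t ∉ γ.contact := fun h => ht (Or.inl h)
      have htT : t ≠ γ.T := fun h => ht (Or.inr h)
      rcases lt_or_gt_of_ne htT with hlt | hgt
      · by_cases h0t : 0 < t
        · rw [indicator_of_mem (show t ∈ Ioc 0 γ.T from ⟨h0t, hlt.le⟩)]
          have h1 := (hdiv.tendsto _).comp (hpt t ⟨h0t.le, hlt⟩ htc)
          refine h1.congr' ?_
          filter_upwards [hT.eventually (lt_mem_nhds hlt)] with ε hε
          rw [indicator_of_mem (show t ∈ Ioc 0 (T ε) from ⟨h0t, hε.le⟩)]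
          rfl
        · rw [indicator_of_notMem (fun h => h0t h.1)]
          exact tendsto_const_nhds.congr fun ε => (indicator_of_notMem (fun h => h0t h.1) _).symm
      · rw [indicator_of_notMem (fun h => hgt.not_ge h.2)]
        refine tendsto_const_nhds.congr' ?_
        filter_upwards [hT.eventually (gt_mem_nhds hgt)] with ε hε
        exact (indicator_of_notMem (fun h => hε.not_ge h.2) _).symm

end

/-! ### The transition map in charts -/

section

variable {f₁ f₂ f₃ : ℝ × ℝ × ℝ × ℝ → ℝ} {am ap ε : ℝ} {ℓ : ℕ}
variable {Θ Θm Θp : OpenPartialHomeomorph (ℝ × ℝ × ℝ) (ℝ × ℝ × ℝ)}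
variable {h φ A : ℝ → ℝ → ℝ} {Ψ : ℝ → ℝ → ℝ → ℝ}

/-- The Jacobian of a chart of a section at fixed `ε`. -/
def chartJacobian (Θ : OpenPartialHomeomorph (ℝ × ℝ × ℝ) (ℝ × ℝ × ℝ)) (x : ℝ × ℝ × ℝ) : ℝ :=
  (fderiv ℝ Θ x (1, 0, 0)).1 * (fderiv ℝ Θ x (0, 1, 0)).2.1
    - (fderiv ℝ Θ x (1, 0, 0)).2.1 * (fderiv ℝ Θ x (0, 1, 0)).1

theorem chartJacobian_mul (x : ℝ × ℝ × ℝ) {u v : ℝ × ℝ × ℝ} (hu : u.2.2 = 0) (hv : v.2.2 = 0) :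
    (fderiv ℝ Θ x u).1 * (fderiv ℝ Θ x v).2.1 - (fderiv ℝ Θ x u).2.1 * (fderiv ℝ Θ x v).1 =
      (u.1 * v.2.1 - u.2.1 * v.1) * chartJacobian Θ x := by
  rw [clm_apply_eq (fderiv ℝ Θ x) u, clm_apply_eq (fderiv ℝ Θ x) v, hu, hv]
  simp only [chartJacobian, Prod.fst_add, Prod.snd_add, Prod.smul_fst, Prod.smul_snd, smul_eq_mul]
  ring

theorem det_mul_det_eq_one {p q r s a b c d : ℝ} (h₁ : p * a + q * b = 1) (h₂ : p * c + q * d = 0)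
    (h₃ : r * c + s * d = 1) :
    (p * s - q * r) * (a * d - c * b) = 1 := by
  linear_combination (r * c + s * d) * h₁ + h₃ - (r * a + s * b) * h₂

namespace IsSectionChart

theorem differentiableAt (hΘ : IsSectionChart ℓ Θ) (hℓ : 1 ≤ ℓ) {x : ℝ × ℝ × ℝ}
    (hx : x ∈ Θ.source) : DifferentiableAt ℝ Θ x :=
  (hΘ.smooth.differentiableOn (by simp; omega)).differentiableAt (Θ.open_source.mem_nhds hx)

theorem differentiableAt_symm (hΘ : IsSectionChart ℓ Θ) (hℓ : 1 ≤ ℓ) {x : ℝ × ℝ × ℝ}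
    (hx : x ∈ Θ.target) : DifferentiableAt ℝ Θ.symm x :=
  (hΘ.smooth_symm.differentiableOn (by simp; omega)).differentiableAt (Θ.open_target.mem_nhds hx)

theorem continuousOn_chartJacobian (hΘ : IsSectionChart ℓ Θ) (hℓ : 1 ≤ ℓ) :
    ContinuousOn (chartJacobian Θ) Θ.source := by
  have h1 : ContinuousOn (fderiv ℝ Θ) Θ.source :=
    hΘ.smooth.continuousOn_fderiv_of_isOpen Θ.open_source (by exact_mod_cast hℓ)
  unfold chartJacobian
  exact (((h1.clm_apply continuousOn_const).fst).mul ((h1.clm_apply continuousOn_const).snd.fst)).sub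
    (((h1.clm_apply continuousOn_const).snd.fst).mul ((h1.clm_apply continuousOn_const).fst))

theorem fderiv_snd_snd (hΘ : IsSectionChart ℓ Θ) (hℓ : 1 ≤ ℓ) {x : ℝ × ℝ × ℝ}
    (hx : x ∈ Θ.source) (v : ℝ × ℝ × ℝ) : (fderiv ℝ Θ x v).2.2 = v.2.2 := by
  have h1 : HasFDerivAt (fun y => (Θ y).2.2) ((ContinuousLinearMap.snd ℝ ℝ ℝ).comp
      ((ContinuousLinearMap.snd ℝ ℝ (ℝ × ℝ)).comp (fderiv ℝ Θ x))) x :=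
    (hΘ.differentiableAt hℓ hx).hasFDerivAt.snd.snd
  have h2 : HasFDerivAt (fun y : ℝ × ℝ × ℝ => (Θ y).2.2) ((ContinuousLinearMap.snd ℝ ℝ ℝ).comp
      (ContinuousLinearMap.snd ℝ ℝ (ℝ × ℝ))) x := by
    refine (hasFDerivAt_snd.snd : HasFDerivAt (fun y : ℝ × ℝ × ℝ => y.2.2) _ x).congr_of_eventuallyEq
      ?_
    filter_upwards [Θ.open_source.mem_nhds hx] with y hy using hΘ.preserves y hy
  exact congrArg (fun M => M v) (h1.unique h2)

theorem chartJacobian_ne_zero (hΘ : IsSectionChart ℓ Θ) (hℓ : 1 ≤ ℓ) {x : ℝ × ℝ × ℝ}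
    (hx : x ∈ Θ.source) : chartJacobian Θ x ≠ 0 := by
  have h1 : HasFDerivAt (fun y => Θ.symm (Θ y))
      ((fderiv ℝ Θ.symm (Θ x)).comp (fderiv ℝ Θ x)) x :=
    (hΘ.differentiableAt_symm hℓ (Θ.map_source hx)).hasFDerivAt.comp x
      (hΘ.differentiableAt hℓ hx).hasFDerivAt
  have h2 : HasFDerivAt (fun y => Θ.symm (Θ y)) (ContinuousLinearMap.id ℝ (ℝ × ℝ × ℝ)) x := by
    refine (hasFDerivAt_id x).congr_of_eventuallyEq ?_
    filter_upwards [Θ.open_source.mem_nhds hx] with y hy using Θ.left_inv hy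
  have h3 : ∀ v, fderiv ℝ Θ.symm (Θ x) (fderiv ℝ Θ x v) = v :=
    fun v => congrArg (fun M => M v) (h1.unique h2)
  have e1 := h3 (1, 0, 0)
  have e2 := h3 (0, 1, 0)
  rw [clm_apply_eq (fderiv ℝ Θ.symm (Θ x)), hΘ.fderiv_snd_snd hℓ hx] at e1 e2
  simp only [Prod.ext_iff, Prod.fst_add, Prod.snd_add, Prod.smul_fst, Prod.smul_snd, smul_eq_mul,
    zero_mul, add_zero] at e1 e2
  obtain ⟨a1, a2, -⟩ := e1
  obtain ⟨-, b2, -⟩ := e2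
  intro h0
  -- the Jacobians of the two inverse maps multiply to one
  have h4 := det_mul_det_eq_one a1 a2 b2
  change chartJacobian Θ x * _ = 1 at h4
  rw [h0, zero_mul] at h4
  exact zero_ne_one h4

/-- A curve in a chart of a section is differentiable if its image is. -/
theorem exists_hasDerivAt (hΘ : IsSectionChart ℓ Θ) (hℓ : 1 ≤ ℓ) {x y : ℝ → ℝ} {c s₀ : ℝ}
    {w : ℝ × ℝ × ℝ} (hx : ∀ᶠ s in 𝓝 s₀, (x s, y s, ε) ∈ Θ.source)
    (hw : HasDerivAt (fun s => chartPoint Θ c (x s) (y s) ε) w s₀) :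
    ∃ x' y', HasDerivAt x x' s₀ ∧ HasDerivAt y y' s₀ ∧
      w.2.1 = (fderiv ℝ Θ (x s₀, y s₀, ε) (x', y', 0)).1 ∧
      w.2.2 = (fderiv ℝ Θ (x s₀, y s₀, ε) (x', y', 0)).2.1 := by
  have hx0 := hx.self_of_nhds
  have h1 : HasDerivAt (fun s => (Θ (x s, y s, ε)).1) w.2.1 s₀ := hw.snd.fst
  have h2 : HasDerivAt (fun s => (Θ (x s, y s, ε)).2.1) w.2.2 s₀ := hw.snd.snd
  have h3 : HasDerivAt (fun s => ((Θ (x s, y s, ε)).1, (Θ (x s, y s, ε)).2.1, ε)) (w.2.1, w.2.2, 0)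
    s₀ := h1.prodMk (h2.prodMk (hasDerivAt_const _ _))
  have hval : ∀ s, (x s, y s, ε) ∈ Θ.source →
      ((Θ (x s, y s, ε)).1, (Θ (x s, y s, ε)).2.1, ε) = Θ (x s, y s, ε) := fun s hs =>
    Prod.ext rfl (Prod.ext rfl (hΘ.preserves _ hs).symm)
  have h4 : HasDerivAt (fun s => (x s, y s, ε))
      (fderiv ℝ Θ.symm (Θ (x s₀, y s₀, ε)) (w.2.1, w.2.2, 0)) s₀ := by
    have h5 : HasFDerivAt Θ.symm (fderiv ℝ Θ.symm (Θ (x s₀, y s₀, ε)))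
        ((Θ (x s₀, y s₀, ε)).1, (Θ (x s₀, y s₀, ε)).2.1, ε) := by
      rw [hval s₀ hx0]
      exact (hΘ.differentiableAt_symm hℓ (Θ.map_source hx0)).hasFDerivAt
    refine (h5.comp_hasDerivAt s₀ h3).congr_of_eventuallyEq ?_
    filter_upwards [hx] with s hs
    simp only [Function.comp_apply, hval s hs, Θ.left_inv hs]
  obtain ⟨v, hv⟩ : ∃ v, v = fderiv ℝ Θ.symm (Θ (x s₀, y s₀, ε)) (w.2.1, w.2.2, 0) := ⟨_, rfl⟩
  rw [← hv] at h4
  have k1 : HasDerivAt x v.1 s₀ := h4.fst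
  have k2 : HasDerivAt y v.2.1 s₀ := h4.snd.fst
  have k3 : HasDerivAt (fun s => (x s, y s, ε)) (v.1, v.2.1, 0) s₀ :=
    k1.prodMk (k2.prodMk (hasDerivAt_const _ _))
  have k4 := (hΘ.differentiableAt hℓ hx0).hasFDerivAt.comp_hasDerivAt s₀ k3
  have k5 : HasDerivAt (fun s => (Θ (x s, y s, ε)).1)
      (fderiv ℝ Θ (x s₀, y s₀, ε) (v.1, v.2.1, 0)).1 s₀ := k4.fst
  have k6 : HasDerivAt (fun s => (Θ (x s, y s, ε)).2.1)
      (fderiv ℝ Θ (x s₀, y s₀, ε) (v.1, v.2.1, 0)).2.1 s₀ := k4.snd.fst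
  exact ⟨v.1, v.2.1, k1, k2, h1.unique k5, h2.unique k6⟩

theorem hasDerivAt_chartPoint (hΘ : IsSectionChart ℓ Θ) (hℓ : 1 ≤ ℓ) {x y : ℝ → ℝ}
    {c s₀ x' y' : ℝ} (hs : (x s₀, y s₀, ε) ∈ Θ.source) (hx : HasDerivAt x x' s₀)
    (hy : HasDerivAt y y' s₀) :
    HasDerivAt (fun s => chartPoint Θ c (x s) (y s) ε)
      (0, (fderiv ℝ Θ (x s₀, y s₀, ε) (x', y', 0)).1,
        (fderiv ℝ Θ (x s₀, y s₀, ε) (x', y', 0)).2.1) s₀ := by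
  have k3 : HasDerivAt (fun s => (x s, y s, ε)) (x', y', 0) s₀ :=
    hx.prodMk (hy.prodMk (hasDerivAt_const _ _))
  have k4 := (hΘ.differentiableAt hℓ hs).hasFDerivAt.comp_hasDerivAt s₀ k3
  have k5 : HasDerivAt (fun s => (Θ (x s, y s, ε)).1)
      (fderiv ℝ Θ (x s₀, y s₀, ε) (x', y', 0)).1 s₀ := k4.fst
  have k6 : HasDerivAt (fun s => (Θ (x s, y s, ε)).2.1)
      (fderiv ℝ Θ (x s₀, y s₀, ε) (x', y', 0)).2.1 s₀ := k4.snd.fst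
  exact (hasDerivAt_const _ _).prodMk (k5.prodMk k6)

theorem continuousAt_chartPoint {c B Z : ℝ} (hs : (B, Z, ε) ∈ Θ.source) :
    ContinuousAt (fun x : ℝ × ℝ × ℝ => chartPoint Θ c x.1 x.2.1 x.2.2) (B, Z, ε) := by
  have h1 : ContinuousAt Θ (B, Z, ε) := Θ.continuousAt hs
  exact continuousAt_const.prodMk (h1.fst.prodMk h1.snd.fst)

end IsSectionChart

theorem isOpen_baseDomain (Θ : OpenPartialHomeomorph (ℝ × ℝ × ℝ) (ℝ × ℝ × ℝ)) :
    IsOpen (baseDomain Θ) := by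
  have : baseDomain Θ = (fun x : ℝ × ℝ × ℝ => (x.1, x.2.2)) '' Θ.source := by
    ext ⟨B, ε⟩
    simp only [baseDomain, mem_ofPred_eq, mem_image, Prod.exists, Prod.mk.injEq]
    constructor
    · rintro ⟨Z, hZ⟩; exact ⟨B, Z, ε, hZ, rfl, rfl⟩
    · rintro ⟨B', Z, ε', hZ, rfl, rfl⟩; exact ⟨Z, hZ⟩
  rw [this]
  exact (IsOpenMap.id.prodMap isOpenMap_snd) _ Θ.open_source

/-- The `Z`-component of the exponential form. -/
def expForm (φ A : ℝ → ℝ → ℝ) (Ψ : ℝ → ℝ → ℝ → ℝ) (B Z ε : ℝ) : ℝ :=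
  φ B ε + Z * Real.exp (-(A B ε + Ψ B Z ε) / ε)

namespace IsExponentialTransition

variable (H : IsExponentialTransition ℓ f₁ f₂ f₃ am ap Θm Θp h φ A Ψ)
include H

theorem contDiffAt_h {B ε : ℝ} (hB : (B, ε) ∈ baseDomain Θm) :
    ContDiffAt ℝ ℓ (fun x : ℝ × ℝ => h x.1 x.2) (B, ε) :=
  H.h_smooth.contDiffAt ((isOpen_baseDomain Θm).mem_nhds hB)

theorem hasDerivAt_h (hℓ : 1 ≤ ℓ) {B ε : ℝ} (hB : (B, ε) ∈ baseDomain Θm) :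
    HasDerivAt (fun s => h s ε) (fderiv ℝ (fun x : ℝ × ℝ => h x.1 x.2) (B, ε) (1, 0)) B := by
  have h1 : HasFDerivAt (fun x : ℝ × ℝ => h x.1 x.2)
      (fderiv ℝ (fun x : ℝ × ℝ => h x.1 x.2) (B, ε)) (B, ε) :=
    ((H.contDiffAt_h hB).differentiableAt (by simp; omega)).hasFDerivAt
  have h2 : HasDerivAt (fun s : ℝ => (s, ε)) ((1 : ℝ), (0 : ℝ)) B :=
    (hasDerivAt_id B).prodMk (hasDerivAt_const B ε)
  exact h1.comp_hasDerivAt (f := fun s : ℝ => (s, ε)) B h2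

theorem continuousAt_deriv_h (hℓ : 1 ≤ ℓ) {B ε : ℝ} (hB : (B, ε) ∈ baseDomain Θm) :
    ContinuousAt (fun x => fderiv ℝ (fun x : ℝ × ℝ => h x.1 x.2) x (1, 0)) (B, ε) :=
  ((H.h_smooth.continuousOn_fderiv_of_isOpen (isOpen_baseDomain Θm) (by exact_mod_cast hℓ)).clm_apply
    continuousOn_const).continuousAt ((isOpen_baseDomain Θm).mem_nhds hB)

/-- Near the origin `B ↦ B + h (B, 0)` is a local diffeomorphism. -/
theorem eventually_deriv_ne (hℓ : 1 ≤ ℓ) :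
    ∀ᶠ B in 𝓝 (0 : ℝ), (B, 0, 0) ∈ Θm.source ∧ 1 + deriv (fun x => h x 0) B ≠ 0 := by
  have h0 : ((0 : ℝ), (0 : ℝ)) ∈ baseDomain Θm := ⟨0, H.origin_mem⟩
  have hflat : fderiv ℝ (fun x : ℝ × ℝ => h x.1 x.2) (0, 0) = 0 := by
    have := H.h_flat 1 hℓ
    rw [← norm_eq_zero, norm_iteratedFDeriv_one, norm_eq_zero] at this
    exact this
  have hc : Tendsto (fun B : ℝ => 1 + fderiv ℝ (fun x : ℝ × ℝ => h x.1 x.2) (B, 0) (1, 0)) (𝓝 0)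
      (𝓝 (1 + 0)) := by
    refine tendsto_const_nhds.add ?_
    have h1 := (H.continuousAt_deriv_h hℓ h0).tendsto
    rw [hflat] at h1
    have h2 : Tendsto (fun B : ℝ => (B, (0 : ℝ))) (𝓝 0) (𝓝 (0, 0)) :=
      (Continuous.tendsto (by fun_prop) 0)
    exact h1.comp h2
  have hsrc : ∀ᶠ B in 𝓝 (0 : ℝ), (B, (0 : ℝ), (0 : ℝ)) ∈ Θm.source := by
    have h2 : Tendsto (fun B : ℝ => (B, (0 : ℝ), (0 : ℝ))) (𝓝 0) (𝓝 (0, 0, 0)) :=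
      (Continuous.tendsto (by fun_prop) 0)
    exact h2.eventually (Θm.open_source.mem_nhds H.origin_mem)
  filter_upwards [hsrc, hc.eventually_ne (by norm_num : (1 : ℝ) + 0 ≠ 0)] with B h1 h2
  refine ⟨h1, ?_⟩
  rwa [(H.hasDerivAt_h hℓ ⟨0, h1⟩).deriv]

/-- Liouville's formula for the transition map, in the coordinates of the exponential form. -/
theorem jacobian (hℓ : 1 ≤ ℓ) (hf₁ : ContDiff ℝ ∞ f₁) (hf₂ : ContDiff ℝ ∞ f₂)
    (hf₃ : ContDiff ℝ ∞ f₃) {R κ t₀ ρ : ℝ} (hκ : 0 < κ) (ht₀ : 0 ≤ t₀) {p₀ : ℝ × ℝ × ℝ}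
    (hcross : ∀ (T : ℝ) (a b z : ℝ → ℝ), IsTransit f₁ f₂ f₃ ap ε T a b z →
      dist (a 0, b 0, z 0) p₀ < ρ →
      IsCrossing (slowField f₁ f₂ f₃ ε) (Icc (-R) R ×ˢ Icc (-R) R ×ˢ Icc (-R) R)
        (ContinuousLinearMap.fst ℝ ℝ (ℝ × ℝ)) ap κ t₀ T fun t => (a t, b t, z t))
    (hε : 0 < ε) {B Z : ℝ} (hs : (B, Z, ε) ∈ Θm.source)
    (hρ : dist (chartPoint Θm (-am) B Z ε) p₀ < ρ) :
    ∃ F', HasDerivAt (fun s => expForm φ A Ψ B s ε) F' Z ∧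
      ∃ T a b z, IsTransit f₁ f₂ f₃ ap ε T a b z ∧ (a 0, b 0, z 0) = chartPoint Θm (-am) B Z ε ∧
        (a T, b T, z T) = chartPoint Θp ap (B + h B ε) (expForm φ A Ψ B Z ε) ε ∧
        (1 + f₁ (a T, b T, z T, ε)) *
          ((1 + fderiv ℝ (fun x : ℝ × ℝ => h x.1 x.2) (B, ε) (1, 0)) * F'
            * chartJacobian Θp (B + h B ε, expForm φ A Ψ B Z ε, ε)) =
        (1 + f₁ (a 0, b 0, z 0, ε)) * chartJacobian Θm (B, Z, ε) *
          Real.exp (ε⁻¹ * ∫ t in (0 : ℝ)..T, divergence (field f₁ f₂ f₃ ε) (a t, b t, z t)) := by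
  have hnhds : ∀ᶠ x : ℝ × ℝ × ℝ in 𝓝 (B, Z, ε), x ∈ Θm.source ∧
      dist (chartPoint Θm (-am) x.1 x.2.1 x.2.2) p₀ < ρ :=
    Filter.Eventually.and (Θm.open_source.mem_nhds hs)
      (((IsSectionChart.continuousAt_chartPoint hs).dist continuousAt_const).eventually_lt
        continuousAt_const hρ)
  have hB : ∀ᶠ s in 𝓝 B, (s, Z, ε) ∈ Θm.source ∧ dist (chartPoint Θm (-am) s Z ε) p₀ < ρ :=
    (Continuous.tendsto (f := fun s : ℝ => (s, Z, ε)) (by fun_prop) B).eventually hnhds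
  have hZ : ∀ᶠ s in 𝓝 Z, (B, s, ε) ∈ Θm.source ∧ dist (chartPoint Θm (-am) B s ε) p₀ < ρ :=
    (Continuous.tendsto (f := fun s : ℝ => (B, s, ε)) (by fun_prop) Z).eventually hnhds
  have htrans : ∀ B Z, (B, Z, ε) ∈ Θm.source → dist (chartPoint Θm (-am) B Z ε) p₀ < ρ →
      ∃ T a b z, IsTransit f₁ f₂ f₃ ap ε T a b z ∧ (a 0, b 0, z 0) = chartPoint Θm (-am) B Z ε ∧
        (a T, b T, z T) = chartPoint Θp ap (B + h B ε) (expForm φ A Ψ B Z ε) ε ∧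
        IsCrossing (slowField f₁ f₂ f₃ ε) (Icc (-R) R ×ˢ Icc (-R) R ×ˢ Icc (-R) R)
          (ContinuousLinearMap.fst ℝ ℝ (ℝ × ℝ)) ap κ t₀ T fun t => (a t, b t, z t) := by
    intro B Z hs hρ
    obtain ⟨T, a, b, z, h1, h2, h3⟩ := (H.transition B Z ε hs hε).exists_isTransit hε
    exact ⟨T, a, b, z, h1, h2, h3, hcross T a b z h1 (h2 ▸ hρ)⟩
  obtain ⟨T, a, b, z, h1, h2, h3, h4⟩ := htrans B Z hs hρ
  obtain ⟨w₁, w₂, hw₁, hw₂, hdet⟩ := h4.jacobian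
    ((contDiff_slowField hf₁ hf₂ hf₃ ε).of_le (WithTop.coe_le_coe.2 (le_top : (2 : ℕ∞) ≤ ⊤)))
    (isCompact_Icc.prod (isCompact_Icc.prod isCompact_Icc))
    ((convex_Icc _ _).prod ((convex_Icc _ _).prod (convex_Icc _ _))) ht₀ hκ
    (P₁ := fun s => chartPoint Θm (-am) s Z ε) (P₂ := fun s => chartPoint Θm (-am) B s ε)
    (Q₁ := fun s => chartPoint Θp ap (s + h s ε) (expForm φ A Ψ s Z ε) ε)
    (Q₂ := fun s => chartPoint Θp ap (B + h B ε) (expForm φ A Ψ B s ε) ε)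
    (s₁ := B) (s₂ := Z)
    (H.chart_minus.hasDerivAt_chartPoint hℓ (x := fun s => s) (y := fun _ => Z) hs (hasDerivAt_id' B)
      (hasDerivAt_const B Z))
    (H.chart_minus.hasDerivAt_chartPoint hℓ (x := fun _ => B) (y := fun s => s) hs
      (hasDerivAt_const Z B) (hasDerivAt_id' Z))
    rfl rfl h2.symm h2.symm h3.symm h3.symm
    (hB.mono fun s hs => by
      obtain ⟨T', a', b', z', -, k2, k3, k4⟩ := htrans s Z hs.1 hs.2
      exact ⟨T', _, k4, k2, k3⟩)
    (hZ.mono fun s hs => by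
      obtain ⟨T', a', b', z', -, k2, k3, k4⟩ := htrans B s hs.1 hs.2
      exact ⟨T', _, k4, k2, k3⟩)
  obtain ⟨x₁, y₁, hx₁, -, e₁, e₁'⟩ := H.chart_plus.exists_hasDerivAt hℓ
    (y := fun s => expForm φ A Ψ s Z ε) (hB.mono fun s hs => H.target_mem s Z ε hs.1 hε) hw₁
  obtain ⟨x₂, y₂, hx₂, hy₂, e₂, e₂'⟩ := H.chart_plus.exists_hasDerivAt hℓ
    (y := fun s => expForm φ A Ψ B s ε) (hZ.mono fun s hs => H.target_mem B s ε hs.1 hε) hw₂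
  refine ⟨y₂, hy₂, T, a, b, z, h1, h2, h3, ?_⟩
  have hx₁' : x₁ = 1 + fderiv ℝ (fun x : ℝ × ℝ => h x.1 x.2) (B, ε) (1, 0) :=
    hx₁.unique ((hasDerivAt_id' B).add (H.hasDerivAt_h hℓ ⟨Z, hs⟩))
  have hx₂' : x₂ = 0 := hx₂.unique (hasDerivAt_const Z (B + h B ε))
  have hint : (∫ t in (0 : ℝ)..T, divergence (slowField f₁ f₂ f₃ ε) (a t, b t, z t)) =
      ε⁻¹ * ∫ t in (0 : ℝ)..T, divergence (field f₁ f₂ f₃ ε) (a t, b t, z t) := by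
    rw [← intervalIntegral.integral_const_mul]
    simp only [divergence_slowField hε.ne']
  rw [e₁, e₁', e₂, e₂', hint] at hdet
  have key₁ := chartJacobian_mul (Θ := Θp) (B + h B ε, expForm φ A Ψ B Z ε, ε)
    (u := (x₁, y₁, 0)) (v := (x₂, y₂, 0)) rfl rfl
  have key₂ := chartJacobian_mul (Θ := Θm) (B, Z, ε)
    (u := (1, 0, 0)) (v := (0, 1, 0)) rfl rfl
  simp only at key₁ key₂ hdet
  rw [key₁, key₂, hx₂', hx₁'] at hdet
  simp only [slowField] at hdet
  linear_combination hdet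

end IsExponentialTransition

end

/-! ### The limit `ε → 0` -/

section

variable {f₁ f₂ f₃ : ℝ × ℝ × ℝ × ℝ → ℝ} {am ap : ℝ} {ℓ : ℕ}
variable {Θm Θp : OpenPartialHomeomorph (ℝ × ℝ × ℝ) (ℝ × ℝ × ℝ)}
variable {h φ A : ℝ → ℝ → ℝ} {Ψ : ℝ → ℝ → ℝ → ℝ}

/-- If `E₁ exp (-α / ε) = E₂ exp (I / ε)` with `E₁`, `E₂` bounded away from zero, then `-α` and `I`
have the same limit as `ε → 0`. -/
theorem neg_eq_of_exp_balance {E₁ E₂ α I : ℝ → ℝ} {x₁ x₂ α₀ I₀ : ℝ} (hx₁ : x₁ ≠ 0) (hx₂ : x₂ ≠ 0)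
    (hE₁ : Tendsto E₁ (𝓝[>] 0) (𝓝 x₁)) (hE₂ : Tendsto E₂ (𝓝[>] 0) (𝓝 x₂))
    (hα : Tendsto α (𝓝[>] 0) (𝓝 α₀)) (hI : Tendsto I (𝓝[>] 0) (𝓝 I₀))
    (hbal : ∀ᶠ ε in 𝓝[>] 0, E₁ ε * Real.exp (-α ε / ε) = E₂ ε * Real.exp (ε⁻¹ * I ε)) :
    -α₀ = I₀ := by
  have h1 : Tendsto (fun ε => ε * Real.log (E₂ ε / E₁ ε)) (𝓝[>] 0) (𝓝 (0 * Real.log (x₂ / x₁))) :=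
    (tendsto_nhdsWithin_of_tendsto_nhds tendsto_id).mul
      ((hE₂.div hE₁ hx₁).log (div_ne_zero hx₂ hx₁))
  have h2 : Tendsto (fun ε => -α ε - I ε) (𝓝[>] 0) (𝓝 (-α₀ - I₀)) := hα.neg.sub hI
  have h3 : ∀ᶠ ε in 𝓝[>] 0, ε * Real.log (E₂ ε / E₁ ε) = -α ε - I ε := by
    filter_upwards [hbal, hE₁.eventually_ne hx₁, self_mem_nhdsWithin] with ε h4 h5 h6
    have hε : (ε : ℝ) ≠ 0 := ne_of_gt h6
    have h7 : E₂ ε / E₁ ε = Real.exp (-α ε / ε - ε⁻¹ * I ε) := by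
      rw [Real.exp_sub, div_eq_div_iff h5 (Real.exp_pos _).ne']
      linarith
    rw [h7, Real.log_exp]
    field_simp
  have h4 := tendsto_nhds_unique (h1.congr' h3) h2
  linarith

/-- The segments `0 ≤ Z ≤ ε` at the height `ε` shrink to the point `(B, 0, 0)`. -/
theorem eventually_forall_Icc_mem {B : ℝ} {U : Set (ℝ × ℝ × ℝ)} (hU : U ∈ 𝓝 (B, (0 : ℝ), (0 : ℝ))) :
    ∀ᶠ ε : ℝ in 𝓝[>] 0, ∀ Z ∈ Icc 0 ε, (B, Z, ε) ∈ U := by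
  obtain ⟨δ, hδ, hball⟩ := Metric.mem_nhds_iff.1 hU
  filter_upwards [nhdsWithin_le_nhds (Iio_mem_nhds hδ), self_mem_nhdsWithin] with ε h1 h2 Z hZ
  have h1' : ε < δ := h1
  have h2' : 0 < ε := h2
  refine hball ?_
  rw [Metric.mem_ball, Prod.dist_eq, Prod.dist_eq, dist_self, Real.dist_eq, Real.dist_eq, sub_zero,
    sub_zero, abs_of_nonneg hZ.1, abs_of_pos h2']
  exact max_lt hδ (max_lt (hZ.2.trans_lt h1') h1')

namespace IsExponentialTransition

variable (H : IsExponentialTransition ℓ f₁ f₂ f₃ am ap Θm Θp h φ A Ψ)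
include H

/-- The mean value theorem on the segment `0 ≤ Z ≤ ε` turns Liouville's formula for the derivative
of the transition map into one for the exponent of its exponential form. -/
theorem eventually_balance (hℓ : 1 ≤ ℓ) (hf₁ : ContDiff ℝ ∞ f₁) (hf₂ : ContDiff ℝ ∞ f₂)
    (hf₃ : ContDiff ℝ ∞ f₃) {B : ℝ} (hB : (B, 0, 0) ∈ Θm.source) (γ : SlowOrbit f₁ f₂ am ap)
    (hγ : (γ.a 0, γ.b 0, γ.z 0) = chartPoint Θm (-am) B 0 0) :
    ∀ᶠ ε in 𝓝[>] 0, ∃ Z ∈ Ioo 0 ε, ∃ (T : ℝ) (a b z : ℝ → ℝ), IsTransit f₁ f₂ f₃ ap ε T a b z ∧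
      (a 0, b 0, z 0) = chartPoint Θm (-am) B Z ε ∧
        (1 + f₁ (a T, b T, z T, ε)) *
          (1 + fderiv ℝ (fun x : ℝ × ℝ => h x.1 x.2) (B, ε) (1, 0))
            * chartJacobian Θp (B + h B ε, expForm φ A Ψ B Z ε, ε)
            * Real.exp (-(A B ε + Ψ B ε ε) / ε) =
        (1 + f₁ (a 0, b 0, z 0, ε)) * chartJacobian Θm (B, Z, ε) *
          Real.exp (ε⁻¹ * ∫ t in (0 : ℝ)..T, divergence (field f₁ f₂ f₃ ε) (a t, b t, z t)) := by
  obtain ⟨R, κ, t₀, ρ, hκ, ht₀, hρ, hcross⟩ := γ.exists_isCrossing hf₁ hf₂ hf₃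
  have hU : ∀ᶠ x : ℝ × ℝ × ℝ in 𝓝 (B, (0 : ℝ), (0 : ℝ)), x ∈ Θm.source ∧
      dist (chartPoint Θm (-am) x.1 x.2.1 x.2.2) (γ.a 0, γ.b 0, γ.z 0) < ρ :=
    Filter.Eventually.and (Θm.open_source.mem_nhds hB)
      (((IsSectionChart.continuousAt_chartPoint hB).dist continuousAt_const).eventually_lt
        continuousAt_const (by simpa [hγ] using hρ))
  filter_upwards [eventually_forall_Icc_mem hU, nhdsWithin_le_nhds (Iic_mem_nhds hρ),
    self_mem_nhdsWithin] with ε h1 h2 h3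
  have hε : 0 < ε := h3
  have hjac := fun Z hZ => H.jacobian hℓ hf₁ hf₂ hf₃ (R := R) hκ ht₀
    (p₀ := (γ.a 0, γ.b 0, γ.z 0)) (ρ := ρ) (ε := ε) (fun T a b z ht hd => by
      simp only [Prod.dist_eq, Real.dist_eq, max_lt_iff] at hd
      exact hcross ε T a b z ht h2 ⟨hd.1.le, hd.2.1.le, hd.2.2.le⟩) hε (h1 Z hZ).1 (h1 Z hZ).2
  have hder : ∀ Z ∈ Icc 0 ε, DifferentiableAt ℝ (fun s => expForm φ A Ψ B s ε) Z := fun Z hZ => by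
    obtain ⟨F', hF', -⟩ := hjac Z hZ
    exact hF'.differentiableAt
  obtain ⟨Z, hZ, hZ'⟩ := exists_deriv_eq_slope (fun s => expForm φ A Ψ B s ε) hε
    (fun Z hZ => (hder Z hZ).continuousAt.continuousWithinAt)
    (fun Z hZ => (hder Z ⟨hZ.1.le, hZ.2.le⟩).differentiableWithinAt)
  obtain ⟨F', hF', T, a, b, z, k1, k2, -, k4⟩ := hjac Z ⟨hZ.1.le, hZ.2.le⟩
  have hF : F' = Real.exp (-(A B ε + Ψ B ε ε) / ε) := by
    rw [← hF'.deriv, hZ', sub_zero, div_eq_iff hε.ne']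
    unfold expForm
    ring
  rw [hF] at k4
  exact ⟨Z, hZ, T, a, b, z, k1, k2, by linear_combination k4⟩

/-- The exponent of the transition map at `ε = 0` is the slow divergence integral. -/
theorem neg_A_eq_integral (hℓ : 1 ≤ ℓ) (hf₁ : ContDiff ℝ ∞ f₁) (hf₂ : ContDiff ℝ ∞ f₂)
    (hf₃ : ContDiff ℝ ∞ f₃) {B : ℝ} (hB : (B, 0, 0) ∈ Θm.source)
    (hreg : 1 + deriv (fun x => h x 0) B ≠ 0) (γ : SlowOrbit f₁ f₂ am ap)
    (hγ : (γ.a 0, γ.b 0, γ.z 0) = chartPoint Θm (-am) B 0 0) : -A B 0 = γ.integral f₃ := by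
  have hB0 : (B, (0 : ℝ)) ∈ baseDomain Θm := ⟨0, hB⟩
  rw [(H.hasDerivAt_h hℓ hB0).deriv] at hreg
  have hbal := H.eventually_balance hℓ hf₁ hf₂ hf₃ hB γ hγ
  obtain ⟨Z, hZ⟩ := hbal.choice
  obtain ⟨T, hT⟩ := (hZ.mono fun ε hε => hε.2).choice
  obtain ⟨a, ha⟩ := hT.choice
  obtain ⟨b, hb⟩ := ha.choice
  obtain ⟨z, hz⟩ := hb.choice
  have hZm : ∀ᶠ ε in 𝓝[>] 0, Z ε ∈ Ioo 0 ε := hZ.mono fun ε hε => hε.1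
  have hε : Tendsto (fun ε : ℝ => ε) (𝓝[>] 0) (𝓝 0) := tendsto_nhdsWithin_of_tendsto_nhds tendsto_id
  have hε0 : ∀ᶠ ε : ℝ in 𝓝[>] 0, 0 ≤ ε := by
    filter_upwards [self_mem_nhdsWithin] with ε h1 using le_of_lt h1
  have hZ0 : Tendsto Z (𝓝[>] 0) (𝓝 0) := by
    refine tendsto_of_tendsto_of_tendsto_of_le_of_le' tendsto_const_nhds hε ?_ ?_
    · exact hZm.mono fun ε h => h.1.le
    · exact hZm.mono fun ε h => h.2.le
  have hbase : Tendsto (fun ε : ℝ => (B, ε)) (𝓝[>] 0) (𝓝 (B, 0)) := tendsto_const_nhds.prodMk_nhds hε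
  have hpt : Tendsto (fun ε : ℝ => (B, Z ε, ε)) (𝓝[>] 0) (𝓝 (B, 0, 0)) :=
    tendsto_const_nhds.prodMk_nhds (hZ0.prodMk_nhds hε)
  have hdiag : Tendsto (fun ε : ℝ => (B, ε, ε)) (𝓝[>] 0) (𝓝 (B, 0, 0)) :=
    tendsto_const_nhds.prodMk_nhds (hε.prodMk_nhds hε)
  have hbaseW : Tendsto (fun ε : ℝ => (B, ε)) (𝓝[>] 0)
      (𝓝[baseDomain Θm ∩ {x | 0 ≤ x.2}] (B, 0)) := by
    refine tendsto_nhdsWithin_iff.2 ⟨hbase, ?_⟩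
    filter_upwards [hbase.eventually ((isOpen_baseDomain Θm).mem_nhds hB0), hε0] with ε h1 h2
      using ⟨h1, h2⟩
  have hWm : ∀ {x : ℝ → ℝ × ℝ × ℝ}, Tendsto x (𝓝[>] 0) (𝓝 (B, 0, 0)) →
      (∀ ε, (x ε).2.2 = ε) → Tendsto x (𝓝[>] 0) (𝓝[Θm.source ∩ {x | 0 ≤ x.2.2}] (B, 0, 0)) := by
    intro x hx hx'
    refine tendsto_nhdsWithin_iff.2 ⟨hx, ?_⟩
    filter_upwards [hx.eventually (Θm.open_source.mem_nhds hB), hε0] with ε h1 h2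
    exact ⟨h1, by rw [mem_ofPred_eq, hx']; exact h2⟩
  have hA : Tendsto (fun ε => A B ε) (𝓝[>] 0) (𝓝 (A B 0)) :=
    (H.A_cont (B, 0) ⟨hB0, le_refl (0 : ℝ)⟩).tendsto.comp hbaseW
  have hφ : Tendsto (fun ε => φ B ε) (𝓝[>] 0) (𝓝 0) := by
    have := (H.φ_cont (B, 0) ⟨hB0, le_refl (0 : ℝ)⟩).tendsto.comp hbaseW
    simp only [H.φ_zero B hB0] at this
    exact this
  have hΨ : ∀ {x : ℝ → ℝ}, Tendsto (fun ε : ℝ => (B, x ε, ε)) (𝓝[>] 0) (𝓝 (B, 0, 0)) →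
      Tendsto (fun ε => Ψ B (x ε) ε) (𝓝[>] 0) (𝓝 0) := by
    intro x hx
    have := (H.Ψ_cont (B, 0, 0) ⟨hB, le_refl (0 : ℝ)⟩).tendsto.comp (hWm hx fun _ => rfl)
    simp only [H.Ψ_zero B 0 hB] at this
    exact this
  have hα : Tendsto (fun ε => A B ε + Ψ B ε ε) (𝓝[>] 0) (𝓝 (A B 0)) := by
    simpa using hA.add (hΨ hdiag)
  -- the end points of the transitions converge to the point with coordinates `(B + h (B, 0), 0, 0)`
  have hF : Tendsto (fun ε => expForm φ A Ψ B (Z ε) ε) (𝓝[>] 0) (𝓝 0) := by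
    have h1 : Tendsto (fun ε => Z ε * Real.exp (-(A B ε + Ψ B (Z ε) ε) / ε)) (𝓝[>] 0) (𝓝 0) := by
      have h2 : Tendsto (fun ε => A B ε + Ψ B (Z ε) ε) (𝓝[>] 0) (𝓝 (A B 0)) := by
        simpa using hA.add (hΨ hpt)
      refine tendsto_of_tendsto_of_tendsto_of_le_of_le' tendsto_const_nhds hZ0 ?_ ?_
      · filter_upwards [hZm] with ε h using mul_nonneg h.1.le (Real.exp_pos _).le
      · filter_upwards [hZm, h2.eventually (lt_mem_nhds (H.A_pos B 0 hB0 le_rfl)), hε0]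
          with ε h3 h4 h5
        refine mul_le_of_le_one_right h3.1.le (Real.exp_le_one_iff.2 ?_)
        exact div_nonpos_of_nonpos_of_nonneg (by linarith) h5
    simpa [expForm] using hφ.add h1
  have hh : Tendsto (fun ε => h B ε) (𝓝[>] 0) (𝓝 (h B 0)) :=
    ((H.contDiffAt_h hB0).continuousAt.tendsto).comp hbase
  have hplus : Tendsto (fun ε => (B + h B ε, expForm φ A Ψ B (Z ε) ε, ε)) (𝓝[>] 0)
      (𝓝 (B + h B 0, 0, 0)) :=
    (tendsto_const_nhds.add hh).prodMk_nhds (hF.prodMk_nhds hε)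
  have hJp : Tendsto (fun ε => chartJacobian Θp (B + h B ε, expForm φ A Ψ B (Z ε) ε, ε)) (𝓝[>] 0)
      (𝓝 (chartJacobian Θp (B + h B 0, 0, 0))) :=
    (((H.chart_plus.continuousOn_chartJacobian hℓ).continuousAt
      (Θp.open_source.mem_nhds (H.limit_mem B hB0))).tendsto).comp hplus
  have hJm : Tendsto (fun ε => chartJacobian Θm (B, Z ε, ε)) (𝓝[>] 0)
      (𝓝 (chartJacobian Θm (B, 0, 0))) :=
    (((H.chart_minus.continuousOn_chartJacobian hℓ).continuousAt
      (Θm.open_source.mem_nhds hB)).tendsto).comp hpt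
  have hdh : Tendsto (fun ε => 1 + fderiv ℝ (fun x : ℝ × ℝ => h x.1 x.2) (B, ε) (1, 0)) (𝓝[>] 0)
      (𝓝 (1 + fderiv ℝ (fun x : ℝ × ℝ => h x.1 x.2) (B, 0) (1, 0))) :=
    tendsto_const_nhds.add ((H.continuousAt_deriv_h hℓ hB0).tendsto.comp hbase)
  have hstart : Tendsto (fun ε => (a ε 0, b ε 0, z ε 0)) (𝓝[>] 0) (𝓝 (γ.a 0, γ.b 0, γ.z 0)) := by
    rw [hγ]
    refine Tendsto.congr' (hz.mono fun ε h => h.2.1.symm) ?_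
    exact (IsSectionChart.continuousAt_chartPoint hB).tendsto.comp hpt
  obtain ⟨hend, hint⟩ := γ.tendsto_transit hf₁ hf₂ hf₃ (hz.mono fun ε h => h.1) hstart
  have hf : ∀ {x y w : ℝ → ℝ} {x₀ y₀ w₀ : ℝ},
      Tendsto (fun ε => (x ε, y ε, w ε)) (𝓝[>] 0) (𝓝 (x₀, y₀, w₀)) →
      Tendsto (fun ε => 1 + f₁ (x ε, y ε, w ε, ε)) (𝓝[>] 0) (𝓝 (1 + f₁ (x₀, y₀, w₀, 0))) := by
    intro x y w x₀ y₀ w₀ hx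
    have h1 : Continuous fun p : (ℝ × ℝ × ℝ) × ℝ => 1 + f₁ (p.1.1, p.1.2.1, p.1.2.2, p.2) :=
      continuous_const.add (hf₁.continuous.comp (by fun_prop))
    exact (h1.tendsto ((x₀, y₀, w₀), 0)).comp (hx.prodMk_nhds hε)
  exact neg_eq_of_exp_balance
    (mul_ne_zero (mul_ne_zero γ.end_transversal.ne' hreg)
      (H.chart_plus.chartJacobian_ne_zero hℓ (H.limit_mem B hB0)))
    (mul_ne_zero γ.start_transversal.ne' (H.chart_minus.chartJacobian_ne_zero hℓ hB))
    (((hf hend).mul hdh).mul hJp) ((hf hstart).mul hJm) hα hint (hz.mono fun ε h => h.2.2)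

end IsExponentialTransition

end

/-! ### Slow orbits of the normal form -/

section

open MeasureTheory

variable {f₁ f₂ f₃ : ℝ × ℝ × ℝ × ℝ → ℝ} {am ap b s : ℝ} {z : ℝ → ℝ}

theorem divergence_field_zero (f₁ f₂ f₃ : ℝ × ℝ × ℝ × ℝ → ℝ) (p : ℝ × ℝ × ℝ) :
    divergence (field f₁ f₂ f₃ 0) p = -(3 * p.2.2 ^ 2 + p.2.1) := by
  have h : HasDerivAt (fun x : ℝ => -(x ^ 3 + p.2.1 * x + p.1)) (-(3 * p.2.2 ^ 2 + p.2.1)) p.2.2 := by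
    refine ((((hasDerivAt_id' p.2.2).pow 3).add ((hasDerivAt_id' p.2.2).const_mul p.2.1)).add_const
      p.1).neg.congr_deriv ?_
    norm_num
  simp only [divergence, field, zero_mul, add_zero, deriv_const, zero_add, h.deriv]

theorem hasDerivAt_primitive (b x : ℝ) :
    HasDerivAt (primitive b) ((3 * x ^ 2 + b) ^ 2) x := by
  have h := ((((hasDerivAt_id' x).pow 5).const_mul (9 / 5)).add
    ((((hasDerivAt_id' x).pow 3).const_mul 2).mul_const b)).add ((hasDerivAt_id' x).const_mul (b ^ 2))
  refine h.congr_deriv ?_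
  norm_num
  ring

/-- Two points of `S` on the same branch `z ≥ m` where `3 m² + b ≥ 0`, `m ≥ 0`. -/
theorem abs_sub_pow_le_of_le {m x y v w : ℝ} (hm : 0 ≤ m) (hb : 0 ≤ 3 * m ^ 2 + b) (hx : m ≤ x)
    (hy : m ≤ y) (hxv : cubic x v b = 0) (hyw : cubic y w b = 0) : |x - y| ^ 3 ≤ |v - w| := by
  unfold cubic at hxv hyw
  have key : ∀ x y, m ≤ y → y ≤ x → (x - y) ^ 3 ≤ (x ^ 3 + b * x) - (y ^ 3 + b * y) := by
    intro x y hy hyx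
    have h1 : m * m ≤ x * y := mul_le_mul (hy.trans hyx) hy hm (hm.trans (hy.trans hyx))
    have h2 : 0 ≤ (x - y) * (3 * (x * y) + b) := mul_nonneg (by linarith) (by nlinarith)
    linarith [show (x ^ 3 + b * x) - (y ^ 3 + b * y) - (x - y) ^ 3 = (x - y) * (3 * (x * y) + b)
      by ring]
  rcases le_total y x with h | h
  · rw [abs_of_nonneg (by linarith)]
    refine (key x y hy h).trans ?_
    rw [abs_sub_comm]
    exact le_trans (by linarith) (le_abs_self _)
  · rw [abs_sub_comm, abs_of_nonneg (by linarith)]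
    exact (key y x hx h).trans (le_trans (by linarith) (le_abs_self _))

/-- For `b ≥ 0` the slow manifold is a graph over the slow variables. -/
theorem abs_sub_pow_le_of_nonneg {x y v w : ℝ} (hb : 0 ≤ b) (hxv : cubic x v b = 0)
    (hyw : cubic y w b = 0) : |x - y| ^ 3 ≤ 4 * |v - w| := by
  unfold cubic at hxv hyw
  have key : ∀ x y, y ≤ x → (x - y) ^ 3 ≤ 4 * ((x ^ 3 + b * x) - (y ^ 3 + b * y)) := by
    intro x y hyx
    have h2 : 0 ≤ (x - y) * (3 * (x + y) ^ 2 + 4 * b) := mul_nonneg (by linarith) (by positivity)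
    linarith [show 4 * ((x ^ 3 + b * x) - (y ^ 3 + b * y)) - (x - y) ^ 3 =
      (x - y) * (3 * (x + y) ^ 2 + 4 * b) by ring]
  rcases le_total y x with h | h
  · rw [abs_of_nonneg (by linarith), abs_sub_comm v w]
    linarith [key x y h, le_abs_self (w - v)]
  · rw [abs_sub_comm x y, abs_of_nonneg (by linarith)]
    linarith [key y x h, le_abs_self (v - w)]

/-- Hölder continuity with exponent `1 / 3`, which survives at the fold and at the cusp. -/
theorem tendsto_of_abs_sub_pow_le {f : ℝ → ℝ} {S : Set ℝ} {c l : ℝ}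
    (h : ∀ᶠ u in 𝓝[S] c, |f u - l| ^ 3 ≤ 4 * |u - c|) : Tendsto f (𝓝[S] c) (𝓝 l) := by
  rw [Metric.tendsto_nhds]
  intro ε hε
  filter_upwards [h, nhdsWithin_le_nhds (Metric.ball_mem_nhds c (show 0 < ε ^ 3 / 4 by positivity))]
    with u h1 h2
  rw [Metric.mem_ball, Real.dist_eq] at h2
  rw [Real.dist_eq]
  exact lt_of_pow_lt_pow_left₀ 3 hε.le (by linarith)

theorem exists_cubic_root_ge {m v : ℝ} (h : cubic m v b ≤ 0) : ∃ x, m ≤ x ∧ cubic x v b = 0 := by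
  have hlim : Tendsto (fun x : ℝ => cubic x v b) atTop atTop := by
    have h1 : Tendsto (fun x : ℝ => x * (x ^ 2 + b) + v) atTop atTop :=
      tendsto_atTop_add_const_right _ _ (tendsto_id.atTop_mul_atTop₀
        (tendsto_atTop_add_const_right _ _ (tendsto_pow_atTop two_ne_zero)))
    refine h1.congr fun x => ?_
    unfold cubic; ring
  obtain ⟨M, hM0, hM⟩ := ((hlim.eventually (eventually_ge_atTop 0)).and (eventually_ge_atTop m)).exists
  have hc : Continuous fun x : ℝ => cubic x v b := by unfold cubic; fun_prop
  obtain ⟨x, hx, hx0⟩ := intermediate_value_Icc hM hc.continuousOn ⟨h, hM0⟩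
  exact ⟨x, hx.1, hx0⟩

/-- The slow curve with parameter `b`, as a function `z` of `a`: up to the fold value `a = 2 s³`
it is the upper branch `z ≥ s`, and beyond it the lower branch `z ≤ -2 s`. The number
`s = √(-b/3)` is characterized by `3 s² + b = 0` if `b ≤ 0`, and `s = 0` if `b ≥ 0`. -/
structure IsSlowCurve (b s : ℝ) (z : ℝ → ℝ) : Prop where
  s_nonneg : 0 ≤ s
  fold_nonneg : 0 ≤ 3 * s ^ 2 + b
  fold_mul : s * (3 * s ^ 2 + b) = 0
  root : ∀ v, cubic (z v) v b = 0
  upper : ∀ v ≤ 2 * s ^ 3, s ≤ z v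
  lower : ∀ v, 2 * s ^ 3 < v → z v ≤ -2 * s

theorem exists_isSlowCurve (hs : 0 ≤ s) (hb : 0 ≤ 3 * s ^ 2 + b) (hsb : s * (3 * s ^ 2 + b) = 0) :
    ∃ z, IsSlowCurve b s z := by
  have hex : ∀ v, ∃ x, cubic x v b = 0 ∧ (v ≤ 2 * s ^ 3 → s ≤ x) ∧ (2 * s ^ 3 < v → x ≤ -2 * s) := by
    intro v
    rcases le_or_gt v (2 * s ^ 3) with hv | hv
    · obtain ⟨x, hx, hx0⟩ := exists_cubic_root_ge (m := s) (v := v) (b := b)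
        (by unfold cubic; linarith)
      exact ⟨x, hx0, fun _ => hx, fun h => absurd h hv.not_gt⟩
    · obtain ⟨x, hx, hx0⟩ := exists_cubic_root_ge (m := 2 * s) (v := -v) (b := b)
        (by unfold cubic; linarith)
      exact ⟨-x, by unfold cubic at hx0 ⊢; linarith, fun h => absurd hv h.not_gt,
        fun _ => by linarith⟩
  choose z h1 h2 h3 using hex
  exact ⟨z, hs, hb, hsb, h1, h2, h3⟩

namespace IsSlowCurve

variable (h : IsSlowCurve b s z)
include h

theorem root_fold : cubic s (2 * s ^ 3) b = 0 := by
  unfold cubic; linarith [h.fold_mul]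

theorem root_jump : cubic (-2 * s) (2 * s ^ 3) b = 0 := by
  unfold cubic; linarith [h.fold_mul]

theorem abs_sub_upper {v w x : ℝ} (hv : v ≤ 2 * s ^ 3) (hx : s ≤ x) (hxw : cubic x w b = 0) :
    |z v - x| ^ 3 ≤ |v - w| :=
  abs_sub_pow_le_of_le h.s_nonneg h.fold_nonneg (h.upper v hv) hx (h.root v) hxw

theorem abs_sub_lower {v w x : ℝ} (hv : 2 * s ^ 3 < v) (hx : x ≤ -2 * s) (hxw : cubic x w b = 0) :
    |z v - x| ^ 3 ≤ |v - w| := by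
  have h1 := h.lower v hv
  have h2 := h.root v
  have h3 := h.s_nonneg
  have h4 := h.fold_nonneg
  have := abs_sub_pow_le_of_le (b := b) (m := 2 * s) (x := -x) (y := -z v) (v := -w) (w := -v)
    (by linarith) (by nlinarith) (by linarith) (by linarith)
    (by unfold cubic at hxw ⊢; linarith) (by unfold cubic at h2 ⊢; linarith)
  rwa [neg_sub_neg, neg_sub_neg] at this

theorem attracting {v : ℝ} (hv : v ≠ 2 * s ^ 3 ∨ 0 < b) : 0 < 3 * z v ^ 2 + b := by
  have h0 := h.s_nonneg
  have hr := h.root v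
  have hf := h.fold_nonneg
  by_cases hb : 0 < b
  · positivity
  have hv := hv.resolve_right hb
  rcases lt_or_gt_of_ne hv with h1 | h1
  · have h2 : s < z v := by
      refine lt_of_le_of_ne (h.upper v h1.le) fun h3 => ?_
      have := h.root_fold
      rw [← h3] at hr
      unfold cubic at hr this
      linarith
    nlinarith
  · have h2 : z v < -2 * s := by
      refine lt_of_le_of_ne (h.lower v h1) fun h3 => ?_
      have := h.root_jump
      rw [h3] at hr
      unfold cubic at hr this
      linarith
    nlinarith

theorem continuousAt {v : ℝ} (hv : v ≠ 2 * s ^ 3 ∨ 0 < b) : ContinuousAt z v := by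
  rw [ContinuousAt, ← nhdsWithin_univ]
  refine tendsto_of_abs_sub_pow_le ?_
  rw [nhdsWithin_univ]
  by_cases hb : 0 < b
  · exact Eventually.of_forall fun u => abs_sub_pow_le_of_nonneg hb.le (h.root u) (h.root v)
  rcases lt_or_gt_of_ne (hv.resolve_right hb) with h1 | h1
  · filter_upwards [Iio_mem_nhds h1] with u hu
    linarith [h.abs_sub_upper (le_of_lt hu) (h.upper v h1.le) (h.root v), abs_nonneg (u - v)]
  · filter_upwards [Ioi_mem_nhds h1] with u hu
    linarith [h.abs_sub_lower hu (h.lower v h1) (h.root v), abs_nonneg (u - v)]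

theorem tendsto_fold : Tendsto z (𝓝[<] (2 * s ^ 3)) (𝓝 s) := by
  refine tendsto_of_abs_sub_pow_le ?_
  filter_upwards [self_mem_nhdsWithin] with u hu
  linarith [h.abs_sub_upper (le_of_lt hu) le_rfl h.root_fold, abs_nonneg (u - 2 * s ^ 3)]

theorem tendsto_jump : Tendsto z (𝓝[>] (2 * s ^ 3)) (𝓝 (-2 * s)) := by
  refine tendsto_of_abs_sub_pow_le ?_
  filter_upwards [self_mem_nhdsWithin] with u hu
  linarith [h.abs_sub_lower hu le_rfl h.root_jump, abs_nonneg (u - 2 * s ^ 3)]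

theorem eq_upper {v x : ℝ} (hv : v ≤ 2 * s ^ 3) (hx : s ≤ x) (hxv : cubic x v b = 0) : z v = x := by
  have h1 := h.abs_sub_upper hv hx hxv
  rw [sub_self, abs_zero] at h1
  have h2 : |z v - x| = 0 := pow_eq_zero_iff three_ne_zero |>.1 (le_antisymm h1 (by positivity))
  linarith [abs_eq_zero.1 h2]

theorem eq_lower {v x : ℝ} (hv : 2 * s ^ 3 < v) (hx : x ≤ -2 * s) (hxv : cubic x v b = 0) :
    z v = x := by
  have h1 := h.abs_sub_lower hv hx hxv
  rw [sub_self, abs_zero] at h1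
  have h2 : |z v - x| = 0 := pow_eq_zero_iff three_ne_zero |>.1 (le_antisymm h1 (by positivity))
  linarith [abs_eq_zero.1 h2]

/-- Along the slow curve, `Ĩ` is a primitive of the slow divergence. -/
theorem hasDerivAt_primitive_comp {v : ℝ} (hv : v ≠ 2 * s ^ 3) :
    HasDerivAt (fun v => primitive b (z v)) (-(3 * z v ^ 2 + b)) v := by
  have hpos := h.attracting (Or.inl hv)
  have h1 : HasDerivAt (fun x : ℝ => -(x ^ 3 + b * x)) (-(3 * z v ^ 2 + b)) (z v) := by
    refine (((hasDerivAt_id' (z v)).pow 3).add ((hasDerivAt_id' (z v)).const_mul b)).neg.congr_deriv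
      ?_
    norm_num
  have h2 : HasDerivAt z (-(3 * z v ^ 2 + b))⁻¹ v :=
    HasDerivAt.of_local_left_inverse (h.continuousAt (Or.inl hv)) h1 (by linarith)
      (Eventually.of_forall fun u => by
        have := h.root u
        unfold cubic at this
        linarith)
  refine ((hasDerivAt_primitive b (z v)).comp v h2).congr_deriv ?_
  field_simp

/-- The slow divergence integral over a part of the slow curve without contact points inside; the end
points may be limits at the fold. -/
theorem integral_Ioo {v w x y : ℝ} (hvw : v < w) (hne : ∀ u ∈ Ioo v w, u ≠ 2 * s ^ 3)
    (hv : Tendsto z (𝓝[>] v) (𝓝 x)) (hw : Tendsto z (𝓝[<] w) (𝓝 y)) :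
    IntervalIntegrable (fun u => -(3 * z u ^ 2 + b)) volume v w ∧
      ∫ u in v..w, -(3 * z u ^ 2 + b) = primitive b y - primitive b x := by
  have hprim : Continuous (primitive b) := by unfold primitive; fun_prop
  have hcont : ContinuousOn (fun u => -(3 * z u ^ 2 + b)) (Ioo v w) := fun u hu => by
    have := (h.continuousAt (Or.inl (hne u hu))).continuousWithinAt (s := Ioo v w)
    fun_prop
  have hint : IntervalIntegrable (fun u => -(3 * z u ^ 2 + b)) volume v w := by
    obtain ⟨g, hg, hgz⟩ : ∃ g : ℝ → ℝ, ContinuousOn g (Icc v w) ∧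
        EqOn g (fun u => -(3 * z u ^ 2 + b)) (Ioo v w) := by
      have hlim : ∀ {l : Filter ℝ} {x : ℝ}, Tendsto z l (𝓝 x) →
          Tendsto (fun u => -(3 * z u ^ 2 + b)) l (𝓝 (-(3 * x ^ 2 + b))) := fun hx =>
        (((hx.pow 2).const_mul 3).add_const b).neg
      exact ⟨_, continuousOn_Icc_extendFrom_Ioo hcont (hlim hv) (hlim hw),
        extendFrom_extends hcont⟩
    refine (hg.intervalIntegrable_of_Icc hvw.le).congr_ae ?_
    rw [uIoc_of_le hvw.le, ← restrict_Ioo_eq_restrict_Ioc]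
    filter_upwards [ae_restrict_mem measurableSet_Ioo] with u hu using hgz hu
  exact ⟨hint, intervalIntegral.integral_eq_sub_of_hasDerivAt_of_tendsto hvw
    (fun u hu => h.hasDerivAt_primitive_comp (hne u hu)) hint
    ((hprim.tendsto x).comp hv) ((hprim.tendsto y).comp hw)⟩

open Classical in
/-- The slow orbit along the slow curve, with slow time `t = a + a⁻`. The value `a = 2 s³` is a
contact time if `b ≤ 0`; for `b > 0` the orbit is attracting throughout. -/
def slowOrbit (hf : ∀ a b z, f₁ (a, b, z, 0) = 0 ∧ f₂ (a, b, z, 0) = 0) (ham : 0 < am)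
    (hap : 2 * s ^ 3 < ap) (hm : 0 < z (-am)) (hp : z ap < 0) : SlowOrbit f₁ f₂ am ap where
  T := am + ap
  a t := -am + t
  b _ := b
  z t := z (-am + t)
  contact := if 0 < b then ∅ else {am + 2 * s ^ 3}
  T_pos := by have := pow_nonneg h.s_nonneg 3; linarith
  contact_mem t ht := by
    have := pow_nonneg h.s_nonneg 3
    split_ifs at ht
    · simp at ht
    · rw [Finset.mem_singleton] at ht
      exact ⟨by linarith, by linarith⟩
  a_cont := by fun_prop
  b_cont := continuousOn_const
  z_cont t _ htc := by
    have h1 : ContinuousAt z (-am + t) := h.continuousAt (by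
      by_contra! hne
      rw [if_neg (not_lt.2 hne.2), Finset.mem_singleton] at htc
      exact htc (by linarith [hne.1]))
    exact (ContinuousAt.comp (f := fun t => -am + t) h1 (by fun_prop)).continuousWithinAt
  mem_slowManifold t _ _ := h.root (-am + t)
  attracting t _ htc := h.attracting (by
    by_contra! hne
    rw [if_neg (not_lt.2 hne.2), Finset.mem_singleton] at htc
    exact htc (by linarith [hne.1]))
  a_deriv t _ _ := by
    rw [(hf _ _ _).1, add_zero]
    exact ((hasDerivAt_id' t).const_add (-am)).hasDerivWithinAt
  b_deriv t _ _ := by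
    rw [(hf _ _ _).2]
    exact hasDerivWithinAt_const _ _ _
  jump t ht := by
    split_ifs at ht with hb
    · simp at ht
    · rw [Finset.mem_singleton] at ht
      have e1 : -am + t = 2 * s ^ 3 := by linarith
      have hmap : Tendsto (fun t => -am + t) (𝓝 t) (𝓝 (2 * s ^ 3)) :=
        e1 ▸ Continuous.tendsto (by fun_prop) t
      refine ⟨s, h.tendsto_fold.comp (tendsto_nhdsWithin_iff.2
        ⟨hmap.mono_left nhdsWithin_le_nhds, ?_⟩), h.tendsto_jump.comp (tendsto_nhdsWithin_iff.2
        ⟨hmap.mono_left nhdsWithin_le_nhds, ?_⟩), ?_, ?_⟩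
      · filter_upwards [self_mem_nhdsWithin] with u hu
        have hu' : u < t := hu
        change -am + u < _
        linarith
      · filter_upwards [self_mem_nhdsWithin] with u hu
        have hu' : t < u := hu
        change _ < -am + u
        linarith
      · rcases mul_eq_zero.1 h.fold_mul with h0 | h0
        · have := h.fold_nonneg
          rw [h0] at this ⊢
          linarith [not_lt.1 hb]
        · exact h0
      · rw [(hf _ _ _).1, (hf _ _ _).2]
        norm_num
  start_mem := ⟨by simp, by simpa using hm⟩
  end_mem := ⟨by simp, by simpa using hp⟩
  a_lt t ht := by linarith [ht.2]
  start_transversal := by rw [(hf _ _ _).1]; norm_num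
  end_transversal := by rw [(hf _ _ _).1]; norm_num

/-- The slow divergence integral, split at `a = 2 s³`. -/
theorem integral_slowOrbit (hf : ∀ a b z, f₁ (a, b, z, 0) = 0 ∧ f₂ (a, b, z, 0) = 0) (ham : 0 < am)
    (hap : 2 * s ^ 3 < ap) (hm : 0 < z (-am)) (hp : z ap < 0) :
    (h.slowOrbit hf ham hap hm hp).integral f₃ =
      (primitive b s - primitive b (z (-am))) + (primitive b (z ap) - primitive b (-2 * s)) := by
  have h0 := pow_nonneg h.s_nonneg 3
  obtain ⟨i1, e1⟩ := h.integral_Ioo (v := -am) (w := 2 * s ^ 3) (by linarith) (fun u hu => hu.2.ne)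
    (tendsto_nhdsWithin_of_tendsto_nhds (h.continuousAt (v := -am) (Or.inl (by linarith))))
    h.tendsto_fold
  obtain ⟨i2, e2⟩ := h.integral_Ioo (v := 2 * s ^ 3) (w := ap) hap (fun u hu => hu.1.ne')
    h.tendsto_jump
    (tendsto_nhdsWithin_of_tendsto_nhds (h.continuousAt (v := ap) (Or.inl hap.ne')))
  rw [← e1, ← e2, intervalIntegral.integral_add_adjacent_intervals i1 i2]
  have hsub := intervalIntegral.integral_comp_add_left (a := 0) (b := am + ap)
    (fun u => -(3 * z u ^ 2 + b)) (-am)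
  rw [add_zero, neg_add_cancel_left] at hsub
  rw [← hsub]
  simp only [SlowOrbit.integral, divergence_field_zero, slowOrbit]

end IsSlowCurve

/-- A slow orbit between given points of `Σ⁻ ∩ S` and `Σ⁺ ∩ S` in case that the slow flow is `∂_a`.
The conditions on `s` say that `s = √(-b/3)` for `b < 0` and `s = 0` for `b > 0`. -/
theorem exists_slowOrbit_of_eq_zero (hf : ∀ a b z, f₁ (a, b, z, 0) = 0 ∧ f₂ (a, b, z, 0) = 0)
    (f₃ : ℝ × ℝ × ℝ × ℝ → ℝ) (ham : 0 < am) (hs : 0 ≤ s) (hb : 0 ≤ 3 * s ^ 2 + b)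
    (hsb : s * (3 * s ^ 2 + b) = 0) (hap : 2 * s ^ 3 < ap) {ζm ζp : ℝ} (hm0 : 0 < ζm) (hp0 : ζp < 0)
    (hm : cubic ζm (-am) b = 0) (hp : cubic ζp ap b = 0) :
    ∃ γ : SlowOrbit f₁ f₂ am ap, (γ.a 0, γ.b 0, γ.z 0) = (-am, b, ζm) ∧
      γ.integral f₃ =
        (primitive b s - primitive b ζm) + (primitive b ζp - primitive b (-2 * s)) := by
  obtain ⟨z, h⟩ := exists_isSlowCurve hs hb hsb
  have h3 := pow_nonneg hs 3
  -- the given points lie on the two branches of the slow curve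
  have hsm : s ≤ ζm := by
    by_contra! hlt
    unfold cubic at hm
    rcases mul_eq_zero.1 hsb with h0 | h0
    · linarith
    · have : 0 ≤ ζm * (s ^ 2 - ζm ^ 2) := mul_nonneg hm0.le (by nlinarith)
      nlinarith [mul_nonneg hm0.le (sq_nonneg s)]
  have hsp : ζp ≤ -2 * s := by
    by_contra! hlt
    unfold cubic at hp
    rcases mul_eq_zero.1 hsb with h0 | h0
    · rw [h0] at hlt; linarith
    · have h1 : 0 ≤ (s - ζp) ^ 2 * (ζp + 2 * s) := mul_nonneg (sq_nonneg _) (by linarith)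
      have h2 : b = -(3 * s ^ 2) := by linarith
      rw [h2] at hp
      linarith [show (s - ζp) ^ 2 * (ζp + 2 * s) = ζp ^ 3 + -(3 * s ^ 2) * ζp + 2 * s ^ 3 by ring]
  have hzm : z (-am) = ζm := h.eq_upper (by linarith) hsm hm
  have hzp : z ap = ζp := h.eq_lower hap hsp hp
  refine ⟨h.slowOrbit hf ham hap (hzm ▸ hm0) (hzp ▸ hp0), ?_, ?_⟩
  · simp [IsSlowCurve.slowOrbit, hzm]
  · rw [h.integral_slowOrbit, hzm, hzp]

end

end CuspSFS

end

theorem mainTheorem8 (ℓ : ℕ) (hℓ : 1 ≤ ℓ)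
    (f₁ f₂ f₃ : ℝ × ℝ × ℝ × ℝ → ℝ)
    (hf₁ : ContDiff ℝ ∞ f₁) (hf₂ : ContDiff ℝ ∞ f₂) (hf₃ : ContDiff ℝ ∞ f₃)
    (am ap : ℝ) (ham : 0 < am) (hap : 0 < ap)
    (Θm Θp : OpenPartialHomeomorph (ℝ × ℝ × ℝ) (ℝ × ℝ × ℝ))
    (h φ A : ℝ → ℝ → ℝ) (Ψ : ℝ → ℝ → ℝ → ℝ)
    (hexp : CuspSFS.IsExponentialTransition ℓ f₁ f₂ f₃ am ap Θm Θp h φ A Ψ) :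
    (∀ᶠ B in 𝓝 (0 : ℝ), (B, 0, 0) ∈ Θm.source ∧ 1 + deriv (fun x => h x 0) B ≠ 0) ∧
    ∀ B : ℝ, (B, 0, 0) ∈ Θm.source → 1 + deriv (fun x => h x 0) B ≠ 0 →
      (∀ γ : CuspSFS.SlowOrbit f₁ f₂ am ap,
        (γ.a 0, γ.b 0, γ.z 0) = CuspSFS.chartPoint Θm (-am) B 0 0 →
        -A B 0 = γ.integral f₃) ∧
      ((∀ a b z, f₁ (a, b, z, 0) = 0 ∧ f₂ (a, b, z, 0) = 0) →
        ∀ b ζm ζp : ℝ, CuspSFS.chartPoint Θm (-am) B 0 0 = (-am, b, ζm) →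
          (ap, b, ζp) ∈ CuspSFS.slowManifold ∩ CuspSFS.sectionPlus ap →
          (0 ≤ b →
            ∃ γ : CuspSFS.SlowOrbit f₁ f₂ am ap,
              (γ.a 0, γ.b 0, γ.z 0) = (-am, b, ζm) ∧
              -A B 0 = γ.integral f₃ ∧
              γ.integral f₃ = CuspSFS.primitive b ζp - CuspSFS.primitive b ζm) ∧
          (b < 0 → 2 * Real.sqrt (-b / 3) ^ 3 < ap →
            ∃ γ : CuspSFS.SlowOrbit f₁ f₂ am ap,
              (γ.a 0, γ.b 0, γ.z 0) = (-am, b, ζm) ∧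
              -A B 0 = γ.integral f₃ ∧
              γ.integral f₃ =
                (CuspSFS.primitive b (Real.sqrt (-b / 3)) - CuspSFS.primitive b ζm) +
                (CuspSFS.primitive b ζp - CuspSFS.primitive b (-2 * Real.sqrt (-b / 3))))) := by
  refine ⟨hexp.eventually_deriv_ne hℓ, fun B hB hreg => ?_⟩
  have hone := hexp.neg_A_eq_integral hℓ hf₁ hf₂ hf₃ hB hreg
  refine ⟨hone, fun hf b ζm ζp hpt hp => ?_⟩
  have hm : CuspSFS.cubic ζm (-am) b = 0 := by
    have := hexp.slow B hB
    rwa [hpt] at this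
  -- `ζm ≥ 0` as a limit of starting points of transitions, and `ζm ≠ 0` because `a ≠ 0` there
  have hm0 : 0 < ζm := by
    have hcont := CuspSFS.IsSectionChart.continuousAt_chartPoint (c := -am) hB
    have hlim : Tendsto (fun ε : ℝ => (B, (0 : ℝ), ε)) (𝓝[>] 0) (𝓝 (B, 0, 0)) :=
      tendsto_nhdsWithin_of_tendsto_nhds (Continuous.tendsto (by fun_prop) 0)
    have h1 : 0 ≤ (CuspSFS.chartPoint Θm (-am) B 0 0).2.2 := by
      refine ge_of_tendsto (((continuous_snd.comp continuous_snd).tendsto _).comp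
        (hcont.tendsto.comp hlim)) ?_
      filter_upwards [hlim.eventually (Θm.open_source.mem_nhds hB), self_mem_nhdsWithin]
        with ε h2 h3 using (hexp.transition B 0 ε h2 h3).1.2.le
    rw [hpt] at h1
    refine lt_of_le_of_ne h1 fun h2 => ?_
    rw [← h2] at hm
    unfold CuspSFS.cubic at hm
    linarith
  have hpS : CuspSFS.cubic ζp ap b = 0 := hp.1
  refine ⟨fun hb => ?_, fun hb hs => ?_⟩
  · obtain ⟨γ, h1, h2⟩ := CuspSFS.exists_slowOrbit_of_eq_zero (s := 0) hf f₃ ham le_rfl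
      (by linarith) (zero_mul _) (by linarith) hm0 hp.2.2 hm hpS
    refine ⟨γ, h1, hone γ (h1.trans hpt.symm), h2.trans ?_⟩
    simp [CuspSFS.primitive]
    ring
  · have hsq : Real.sqrt (-b / 3) ^ 2 = -b / 3 := Real.sq_sqrt (by linarith)
    have h0 : 3 * Real.sqrt (-b / 3) ^ 2 + b = 0 := by rw [hsq]; ring
    obtain ⟨γ, h1, h2⟩ := CuspSFS.exists_slowOrbit_of_eq_zero hf f₃ ham (Real.sqrt_nonneg (-b / 3))
      h0.ge (by rw [h0, mul_zero]) hs hm0 hp.2.2 hm hpS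
    exact ⟨γ, h1, hone γ (h1.trans hpt.symm), h2⟩
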